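/- Let $\beta>0$, $K\in\mathbb R$ and $n\ge 1$. On $\{-1,0,1\}^n$ let $S_n(\omega)=\sum_{j=1}^n\omega_j$, $H_{n,K}(\omega)=\sum_{j=1}^n\omega_j^2-\frac Kn S_n(\omega)^2$, let $P_n$ be the $n$-fold product of the uniform distribution on $\{-1,0,1\}$, and let $P_{\beta,K,n}$ be the probability measure with density proportional to $e^{-\beta H_{n,K}}$ with respect to $P_n$ (the mean-field Blume–Emery–Griffiths model). Put $\beta_c=\log 4$, $K_c(\beta)=\frac{e^\beta+2}{4\beta}$, $c_\beta(t)=\log\frac{1+e^{-\beta}(e^t+e^{-t})}{1+2e^{-\beta}}$, $G_{\beta,K}(x)=\beta Kx^2-c_\beta(2\beta Kx)$ and $W_\gamma=S_n/n^{1-\gamma}$. **Theorem 2.4.** Fix $\beta\in(0,\beta_c)$, let $(\beta_n)_{n\ge1}$ be any positive sequence with $\beta_n\to\beta$, let $k\neq0$, $\Delta_2>0$, $K_n=K_c(\beta_n)-k/n^{\Delta_2}$, and let $\gamma\in(0,1/2]$ satisfy $\min(2\gamma+\Delta_2-1,\,4\gamma-1)=0$. Then $(\beta_n,K_n)\to(\beta,K_c(\beta))$.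 Let $P$ and $\mathbb E$ refer to $P_{\beta_n,K_n,n}$ for the spins, and let $Z_{a_1,a_2}$ be a real random variable with Lebesgue density proportional to $\exp(-(a_1x^2+a_2x^4))$. Below, $C$ denotes a constant that does not depend on $n$. 1. Let $\gamma=1/4$ and $\Delta_2=1/2$. Put $c_1=\frac{k}{K_c(\beta_n)}$, $c_2=\frac{G^{(4)}_{\beta_n,K_n}(0)}{3!\,2\beta_nK_n}$, $c_3=c_1\mathbb E(W_{1/4}^2)+c_2\mathbb E(W_{1/4}^4)$, $a_1=\frac{c_1}{2c_3}$ and $a_2=\frac{c_2}{4c_3}$ (these depend on $n$). Then $a_1\ne0$ and $a_2>0$ for all sufficiently large $n$, and there is $C$ such that for every $n\ge1$ for which $a_2$ is defined and positive $$\sup_{t\in\mathbb R}\bigl|P(W_{1/4}\le t)-P(Z_{a_1,a_2}\le t)\bigr|\le C\,n^{-1/4}.$$ 2. Let $2\gamma=1-\Delta_2$, $\gamma\in(1/4,1/2)$ (so $\Delta_2\in(0,1/2)$) and $k>0$. Put $a_1=(2\,\mathbb E(W_\gamma^2))^{-1}$ and $a_2=0$. Then $a_1>0$, and there is $C$ such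 that for all $n\ge1$ $$\sup_{t\in\mathbb R}\bigl|P(W_\gamma\le t)-P(Z_{a_1,a_2}\le t)\bigr|\le C\begin{cases}n^{1-4\gamma},&\gamma\in(1/4,1/3],\\ n^{-\gamma},&\gamma\in[1/3,1/2).\end{cases}$$ 3. Let $\gamma=1/4$ and $\Delta_2>1/2$. Put $a_1=0$ and $a_2=(4\,\mathbb E(W_{1/4}^4))^{-1}$. Then $a_2>0$, and there is $C$ such that for all $n\ge1$ $$\sup_{t\in\mathbb R}\bigl|P(W_{1/4}\le t)-P(Z_{a_1,a_2}\le t)\bigr|\le C\begin{cases}n^{-(\Delta_2-1/2)},&\Delta_2\in(1/2,3/4),\\ n^{-1/4},&\Delta_2\ge3/4.\end{cases}$$ -/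

import Mathlib

open Filter Topology MeasureTheory
open scoped ENNReal

namespace BEG

/-- Every subset of the three-point spin space is measurable. -/
instance instMeasurableSpaceSpin : MeasurableSpace SignType := ⊤

instance instDiscreteMeasurableSpaceSpin : DiscreteMeasurableSpace SignType :=
  ⟨fun _ => trivial⟩

/-- The configuration space `{-1,0,1}^n`. -/
abbrev Config (n : ℕ) : Type := Fin n → SignType

/-- The total spin `S_n(ω) = ∑_j ω_j`. -/
def totalSpin {n : ℕ} (ω : Config n) : ℝ := ∑ j, (ω j : ℝ)

/-- The Hamiltonian `H_{n,K}(ω) = ∑_j ω_j² - (K/n) (∑_j ω_j)²`. -/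
noncomputable def hamiltonian (n : ℕ) (K : ℝ) (ω : Config n) : ℝ :=
  (∑ j, (ω j : ℝ) ^ 2) - K / n * totalSpin ω ^ 2

/-- The single-spin measure `ρ = (δ_{-1} + δ_0 + δ_1) / 3`. -/
noncomputable def spinMeasure : Measure SignType :=
  (3 : ℝ≥0∞)⁻¹ • (Measure.dirac (-1) + Measure.dirac 0 + Measure.dirac 1)

/-- The probability measure `P_{β,K,n}`, with density proportional to `exp (-β H_{n,K})` with respect
to the `n`-fold product of `ρ`. -/
noncomputable def gibbs (n : ℕ) (β K : ℝ) : Measure (Config n) :=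
  (Measure.pi fun _ : Fin n => spinMeasure).tilted fun ω => -β * hamiltonian n K ω

/-- The rescaled total spin `W_γ = S_n / n^{1-γ}`. -/
noncomputable def W (n : ℕ) (γ : ℝ) (ω : Config n) : ℝ := totalSpin ω / (n : ℝ) ^ (1 - γ)

/-- The moment `E (W_γ ^ l)` under `P_{β,K,n}`. -/
noncomputable def moment (n : ℕ) (β K γ : ℝ) (l : ℕ) : ℝ := ∫ ω, W n γ ω ^ l ∂(gibbs n β K)

/-- The critical inverse temperature `β_c = log 4`. -/
noncomputable def betaC : ℝ := Real.log 4

/-- The curve `K_c(β) = (e^β + 2) / (4β)`. -/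
noncomputable def Kc (β : ℝ) : ℝ := (Real.exp β + 2) / (4 * β)

/-- The sequence `K_n = K_c(β_n) - k / n^{Δ₂}`. -/
noncomputable def Kseq (β : ℕ → ℝ) (k Δ₂ : ℝ) (n : ℕ) : ℝ := Kc (β n) - k / (n : ℝ) ^ Δ₂

/-- The cumulant generating function of `ρ_β`, the measure proportional to `exp (-β x²) ρ(dx)`. -/
noncomputable def cumulant (β t : ℝ) : ℝ :=
  Real.log ((1 + Real.exp (-β) * (Real.exp t + Real.exp (-t))) / (1 + 2 * Real.exp (-β)))

/-- The function `G_{β,K}(x) = β K x² - c_β(2 β K x)`. -/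
noncomputable def G (β K x : ℝ) : ℝ := β * K * x ^ 2 - cumulant β (2 * β * K * x)

/-- The law of `Z_{a₁,a₂}`: the probability measure on `ℝ` with Lebesgue density
`C exp (-(a₁ x² + a₂ x⁴))`, where `C` is the normalisation constant. (It is a probability measure when
`a₂ > 0`, or when `a₂ = 0` and `a₁ > 0`.) -/
noncomputable def lawZ (a₁ a₂ : ℝ) : Measure ℝ :=
  (volume : Measure ℝ).tilted fun x => -(a₁ * x ^ 2 + a₂ * x ^ 4)

/-- The Kolmogorov distance `sup_t |P_{β,K,n}(W_γ ≤ t) - P(Z_{a₁,a₂} ≤ t)|`. -/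
noncomputable def kolmogorov (n : ℕ) (β K γ a₁ a₂ : ℝ) : ℝ :=
  ⨆ t : ℝ, |(gibbs n β K).real {ω | W n γ ω ≤ t} - (lawZ a₁ a₂).real (Set.Iic t)|

/-- `c₁ = k / K_c(β)`. -/
noncomputable def coeff1 (β k : ℝ) : ℝ := k / Kc β

/-- `c₂ = G_{β,K}⁗(0) / (3! · 2βK)`. -/
noncomputable def coeff2 (β K : ℝ) : ℝ :=
  iteratedDeriv 4 (G β K) 0 / (Nat.factorial 3 * (2 * β * K))

/-- `c₃ = c₁ E(W_{1/4}²) + c₂ E(W_{1/4}⁴)`. -/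
noncomputable def coeff3 (n : ℕ) (β K k : ℝ) : ℝ :=
  coeff1 β k * moment n β K (1 / 4) 2 + coeff2 β K * moment n β K (1 / 4) 4

/-- The coefficient `a₁ = c₁ / (2 c₃)` of the critical regime. -/
noncomputable def critA1 (n : ℕ) (β K k : ℝ) : ℝ := coeff1 β k / (2 * coeff3 n β K k)

/-- The coefficient `a₂ = c₂ / (4 c₃)` of the critical regime. -/
noncomputable def critA2 (n : ℕ) (β K k : ℝ) : ℝ := coeff2 β K / (4 * coeff3 n β K k)

end BEG

/-! The proof is Stein's method, run directly on the spins. Given the other spins, of sum T, one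
spin is distributed as a free spin in the field 2βKT/n, with e^β changed by a factor 1 + O(1/n). So
ω_i minus its conditional mean m_i is orthogonal to every function of the other spins, and in
E[Σ(ω_i - m_i) F] only the increments of F under zeroing one spin survive. For F = g(W) this gives
E[drift · g(W)] ≈ E[(Σω_i²/n) g'(W)], where the drift is n^{-γ}(S - n c_β'(2βKS/n)). Here Σω_i²/n is
within O(n^{-γ}) in L¹ of the free variance p = 2/(e^β + 2). A Taylor expansion turns the drift into
θW + ηW³ + O(n^{-γ}W⁴), with θ = c₁ n^{1-2γ-Δ₂} (because p · 2βK_c = 1) and η = c₂ n^{1-4γ}. Hence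
E[(θW + ηW³) g(W)] = p E[g'(W)] + O(n^{-γ}), which is `Regime.abs_stein_sub_le`.

The law of Z is characterised by g' - (2a₁w + 4a₂w³) g = 1_{w ≤ z} - P(Z ≤ z). Inserting the
solution bounds the Kolmogorov distance by a multiple of n^{-γ} + |θ/p - 2a₁| + |η/p - 4a₂|
(`Regime.kolmogorov_le`). The test function g(w) = w yields θ E W² + η E W⁴ = p + O(n^{-γ})
(`Regime.abs_moment_identity_le`). This is why coefficients normalised by moments of W match θ/(2p)
and η/(4p) up to the stated rates. A term left out of the limit potential costs its own size:
n^{1-4γ} for the quartic one, n^{-(Δ₂-1/2)} for the quadratic one.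

Three inputs support this. Sixth moments are bounded uniformly, by the test function w⁵ and a cubic
lower bound on the drift; this is where β < log 4 enters. The derivative of the Stein solution jumps
at z, so P(|W - z| ≤ n^{γ-1}) = O(n^{-γ}) is needed, and comes from the same identity with a
truncated linear test function (`Regime.avg_near_le`). Finally the Stein solutions are bounded
uniformly over coefficients that vary with n, including a₁ < 0 (`Confining.exists_steinPair`). -/

namespace BEG

/-! ### A single spin in an external field: bounds and Taylor expansion -/

/-- The mean of a single spin in the field `t`, where `a = e^β`. -/
noncomputable def spinMean (a t : ℝ) : ℝ := 2 * Real.sinh t / (a + 2 * Real.cosh t)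

/-- The second moment of a single spin in the field `t`, where `a = e^β`. -/
noncomputable def spinSq (a t : ℝ) : ℝ := 2 * Real.cosh t / (a + 2 * Real.cosh t)

lemma spin_denom_pos {a : ℝ} (ha : 0 < a) (t : ℝ) : 0 < a + 2 * Real.cosh t := by
  have := Real.cosh_pos t; positivity

lemma spinSq_nonneg {a : ℝ} (ha : 0 < a) (t : ℝ) : 0 ≤ spinSq a t :=
  div_nonneg (by have := Real.cosh_pos t; positivity) (spin_denom_pos ha t).le

lemma spinSq_le_one {a : ℝ} (ha : 0 < a) (t : ℝ) : spinSq a t ≤ 1 := by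
  rw [spinSq, div_le_one (spin_denom_pos ha t)]; linarith

lemma abs_sinh_le_cosh (t : ℝ) : |Real.sinh t| ≤ Real.cosh t := by
  rw [abs_le]
  constructor
  · have := Real.exp_pos t; have h := Real.cosh_add_sinh t; linarith
  · exact (Real.sinh_lt_cosh t).le

lemma abs_spinMean_le_spinSq {a : ℝ} (ha : 0 < a) (t : ℝ) : |spinMean a t| ≤ spinSq a t := by
  have h := spin_denom_pos ha t
  rw [spinMean, spinSq, abs_div, abs_of_pos h, abs_mul, abs_two]
  gcongr
  exact abs_sinh_le_cosh t

lemma abs_spinMean_le_one {a : ℝ} (ha : 0 < a) (t : ℝ) : |spinMean a t| ≤ 1 :=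
  (abs_spinMean_le_spinSq ha t).trans (spinSq_le_one ha t)

@[simp] lemma spinMean_zero (a : ℝ) : spinMean a 0 = 0 := by simp [spinMean]

lemma spinSq_zero (a : ℝ) : spinSq a 0 = 2 / (a + 2) := by simp [spinSq]

lemma spinMean_neg (a t : ℝ) : spinMean a (-t) = -spinMean a t := by
  simp [spinMean, neg_div]

lemma hasDerivAt_spinMean {a : ℝ} (ha : 0 < a) (t : ℝ) :
    HasDerivAt (spinMean a) (spinSq a t - spinMean a t ^ 2) t := by
  have h := spin_denom_pos ha t
  have := ((Real.hasDerivAt_sinh t).const_mul 2).div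
    (((Real.hasDerivAt_cosh t).const_mul 2).const_add a) h.ne'
  refine this.congr_deriv ?_
  rw [spinSq, spinMean]; field_simp

lemma hasDerivAt_spinSq {a : ℝ} (ha : 0 < a) (t : ℝ) :
    HasDerivAt (spinSq a) (spinMean a t - spinSq a t * spinMean a t) t := by
  have h := spin_denom_pos ha t
  have := ((Real.hasDerivAt_cosh t).const_mul 2).div
    (((Real.hasDerivAt_cosh t).const_mul 2).const_add a) h.ne'
  refine this.congr_deriv ?_
  rw [spinSq, spinMean]; field_simp

lemma abs_sub_le_of_deriv_bound {f f' : ℝ → ℝ} {C : ℝ} (h : ∀ t, HasDerivAt f (f' t) t)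
    (hb : ∀ t, |f' t| ≤ C) (s t : ℝ) : |f s - f t| ≤ C * |s - t| := by
  have := Convex.norm_image_sub_le_of_norm_hasDerivWithin_le (f := f) (f' := f') (s := Set.univ)
    (fun x _ => (h x).hasDerivWithinAt) (fun x _ => hb x) convex_univ (Set.mem_univ t)
    (Set.mem_univ s)
  simpa using this

lemma abs_spinMean_sub_le {a : ℝ} (ha : 0 < a) (s t : ℝ) :
    |spinMean a s - spinMean a t| ≤ |s - t| := by
  have := abs_sub_le_of_deriv_bound (hasDerivAt_spinMean ha) (C := 1) (fun t => ?_) s t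
  · simpa using this
  have h1 := spinSq_nonneg ha t
  have h2 := spinSq_le_one ha t
  have h3 := abs_spinMean_le_one ha t
  have h4 := sq_le_one_iff_abs_le_one _ |>.mpr h3
  rw [abs_le]; constructor <;> nlinarith [sq_nonneg (spinMean a t)]

lemma abs_spinMean_le {a : ℝ} (ha : 0 < a) (t : ℝ) : |spinMean a t| ≤ |t| := by
  simpa using abs_spinMean_sub_le ha t 0

lemma abs_spinSq_sub_le {a : ℝ} (ha : 0 < a) (s t : ℝ) :
    |spinSq a s - spinSq a t| ≤ |s - t| := by
  have := abs_sub_le_of_deriv_bound (hasDerivAt_spinSq ha) (C := 1) (fun t => ?_) s t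
  · simpa using this
  have h1 := spinSq_nonneg ha t
  have h2 := spinSq_le_one ha t
  have h3 := abs_spinMean_le_one ha t
  rw [show spinMean a t - spinSq a t * spinMean a t = spinMean a t * (1 - spinSq a t) by ring,
    abs_mul, abs_of_nonneg (sub_nonneg.2 h2)]
  nlinarith [abs_nonneg (spinMean a t)]

lemma abs_spinMean_sub_param_le {a a' : ℝ} (ha : 0 < a) (ha' : 0 < a') (t : ℝ) :
    |spinMean a t - spinMean a' t| ≤ |a - a'| := by
  have h := spin_denom_pos ha t
  have h' := spin_denom_pos ha' t
  have hc := Real.one_le_cosh t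
  have e : spinMean a t - spinMean a' t = spinMean a t * ((a' - a) / (a' + 2 * Real.cosh t)) := by
    rw [spinMean, spinMean]; field_simp; ring
  rw [e, abs_mul, abs_div, abs_of_pos h', abs_sub_comm a' a]
  calc |spinMean a t| * (|a - a'| / (a' + 2 * Real.cosh t)) ≤ 1 * (|a - a'| / 1) := by
        gcongr
        · exact abs_spinMean_le_one ha t
        · linarith
    _ = |a - a'| := by simp

lemma abs_spinSq_sub_param_le {a a' : ℝ} (ha : 0 < a) (ha' : 0 < a') (t : ℝ) :
    |spinSq a t - spinSq a' t| ≤ |a - a'| := by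
  have h := spin_denom_pos ha t
  have h' := spin_denom_pos ha' t
  have hc := Real.one_le_cosh t
  have e : spinSq a t - spinSq a' t = spinSq a t * ((a' - a) / (a' + 2 * Real.cosh t)) := by
    rw [spinSq, spinSq]; field_simp; ring
  rw [e, abs_mul, abs_div, abs_of_pos h', abs_sub_comm a' a]
  calc |spinSq a t| * (|a - a'| / (a' + 2 * Real.cosh t)) ≤ 1 * (|a - a'| / 1) := by
        gcongr
        · rw [abs_of_nonneg (spinSq_nonneg ha t)]; exact spinSq_le_one ha t
        · linarith
    _ = |a - a'| := by simp

/-- Mean value inequality on the segment from 0 to `t`. Iterated, it lifts a bound on a high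
derivative to a Taylor remainder, forgoing the factorial gain. -/
lemma abs_le_mul_pow_succ {f f' : ℝ → ℝ} {C : ℝ} {k : ℕ} (h : ∀ t, HasDerivAt f (f' t) t)
    (h0 : f 0 = 0) (hb : ∀ t, |f' t| ≤ C * |t| ^ k) (hC : 0 ≤ C) (t : ℝ) :
    |f t| ≤ C * |t| ^ (k + 1) := by
  have := Convex.norm_image_sub_le_of_norm_hasDerivWithin_le (f := f) (f' := f')
    (s := Set.uIcc 0 t) (C := C * |t| ^ k)
    (fun x _ => (h x).hasDerivWithinAt) (fun x hx => (hb x).trans ?_) (convex_uIcc 0 t)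
    Set.left_mem_uIcc Set.right_mem_uIcc
  · rw [h0] at this
    simp only [sub_zero, Real.norm_eq_abs] at this
    rw [pow_succ, ← mul_assoc]; exact this
  · have : |x| ≤ |t| := by
      simpa using Set.abs_sub_left_of_mem_uIcc hx
    gcongr

/-- All derivatives of `spinMean` are polynomials in `spinMean` and `spinSq`, both at most 1 in
modulus, so the fourth one is bounded uniformly in `a` and `t`. Subtracting the Taylor polynomial
makes every lower derivative vanish at 0, and the bound is integrated four times. -/
lemma spinMean_taylor {a : ℝ} (ha : 0 < a) (t : ℝ) :
    |spinMean a t - 2 / (a + 2) * t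
      - (2 / (a + 2) - 3 * (2 / (a + 2)) ^ 2) / 6 * t ^ 3| ≤ 200 * t ^ 4 := by
  set p := 2 / (a + 2) with hp
  have hM := hasDerivAt_spinMean ha
  have hS := hasDerivAt_spinSq ha
  have hid := fun t : ℝ => hasDerivAt_id t
  -- successive derivatives
  have h4 : ∀ t, HasDerivAt (fun t => spinSq a t - 3 * spinSq a t ^ 2
      + 12 * spinMean a t ^ 2 * spinSq a t - 4 * spinMean a t ^ 2 - 6 * spinMean a t ^ 4
      - (p - 3 * p ^ 2)) (spinMean a t * ((1 - 6 * spinSq a t + 12 * spinMean a t ^ 2) *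
      (1 - spinSq a t) + (24 * spinSq a t - 8 - 24 * spinMean a t ^ 2) *
      (spinSq a t - spinMean a t ^ 2))) t := fun t =>
    ((((((hS t).sub (((hS t).pow 2).const_mul 3)).add ((((hM t).pow 2).const_mul 12).mul
      (hS t))).sub (((hM t).pow 2).const_mul 4)).sub (((hM t).pow 4).const_mul 6)).sub_const
      _).congr_deriv (by simp; ring)
  have h3 : ∀ t, HasDerivAt (fun t => spinMean a t - 3 * spinMean a t * spinSq a t
      + 2 * spinMean a t ^ 3 - (p - 3 * p ^ 2) * t) (spinSq a t - 3 * spinSq a t ^ 2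
      + 12 * spinMean a t ^ 2 * spinSq a t - 4 * spinMean a t ^ 2 - 6 * spinMean a t ^ 4
      - (p - 3 * p ^ 2)) t := fun t =>
    ((((hM t).sub (((hM t).const_mul 3).mul (hS t))).add (((hM t).pow 3).const_mul 2)).sub
      ((hid t).const_mul _)).congr_deriv (by simp; ring)
  have h2 : ∀ t, HasDerivAt (fun t => spinSq a t - spinMean a t ^ 2 - p
      - (p - 3 * p ^ 2) / 2 * t ^ 2) (spinMean a t - 3 * spinMean a t * spinSq a t
      + 2 * spinMean a t ^ 3 - (p - 3 * p ^ 2) * t) t := fun t =>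
    ((((hS t).sub ((hM t).pow 2)).sub_const p).sub (((hid t).pow 2).const_mul _)).congr_deriv
      (by simp; ring)
  have h1 : ∀ t, HasDerivAt (fun t => spinMean a t - p * t
      - (p - 3 * p ^ 2) / 6 * t ^ 3) (spinSq a t - spinMean a t ^ 2 - p
      - (p - 3 * p ^ 2) / 2 * t ^ 2) t := fun t =>
    (((hM t).sub ((hid t).const_mul p)).sub (((hid t).pow 3).const_mul _)).congr_deriv
      (by simp; ring)
  have b4 := abs_le_mul_pow_succ (k := 0) (C := 200) h4
    (by simp [spinSq_zero, ← hp]) (fun t => ?_) (by norm_num)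
  · have b3 := abs_le_mul_pow_succ h3 (by simp) b4 (by norm_num)
    have b2 := abs_le_mul_pow_succ h2 (by simp [spinSq_zero, ← hp]) b3 (by norm_num)
    have b1 := abs_le_mul_pow_succ h1 (by simp) b2 (by norm_num) t
    simpa [Even.pow_abs (show Even 4 by decide)] using b1
  · have q0 := spinSq_nonneg ha t
    have q1 := spinSq_le_one ha t
    have m1 := abs_spinMean_le_one ha t
    have q2 : |spinSq a t| ≤ 1 := by rwa [abs_of_nonneg q0]
    generalize spinSq a t = q at *
    generalize spinMean a t = m at *
    have s0 : 0 ≤ m ^ 2 := sq_nonneg m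
    have s1 : m ^ 2 ≤ 1 := (sq_le_one_iff_abs_le_one _).mpr m1
    have u1 : |1 - 6 * q + 12 * m ^ 2| ≤ 19 := abs_le.2 ⟨by linarith, by linarith⟩
    have u2 : |1 - q| ≤ 1 := abs_le.2 ⟨by linarith, by linarith⟩
    have u3 : |24 * q - 8 - 24 * m ^ 2| ≤ 56 := abs_le.2 ⟨by linarith, by linarith⟩
    have u4 : |q - m ^ 2| ≤ 1 := abs_le.2 ⟨by linarith, by linarith⟩
    rw [pow_zero, mul_one, abs_mul]
    calc _ ≤ 1 * (19 * 1 + 56 * 1 : ℝ) := by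
          gcongr
          refine (abs_add_le _ _).trans ?_
          rw [abs_mul, abs_mul]
          gcongr
      _ ≤ 200 := by norm_num

/-! ### Cubic gap between the mean spin and its linearisation -/

/-- Hyperbolic Cusa–Huygens inequality: three differentiations of the difference leave a positive
multiple of `y * sinh y`. -/
lemma sinh_le_cusa {t : ℝ} (ht : 0 ≤ t) : Real.sinh t ≤ t * (Real.cosh t + 2) / 3 := by
  have h1 : MonotoneOn (fun t => t * Real.sinh t - 2 * Real.cosh t) (Set.Ici 0) := by
    apply monotoneOn_of_deriv_nonneg (convex_Ici 0) (by fun_prop) (by fun_prop)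
    intro x hx
    simp at hx
    have : HasDerivAt (fun t => t * Real.sinh t - 2 * Real.cosh t)
        (x * Real.cosh x - Real.sinh x) x :=
      (((hasDerivAt_id x).mul (Real.hasDerivAt_sinh x)).sub
        ((Real.hasDerivAt_cosh x).const_mul 2)).congr_deriv (by simp; ring)
    rw [this.deriv]
    have hm : MonotoneOn (fun t => t * Real.cosh t - Real.sinh t) (Set.Ici 0) := by
      apply monotoneOn_of_deriv_nonneg (convex_Ici 0) (by fun_prop) (by fun_prop)
      intro y hy
      simp at hy
      have : HasDerivAt (fun t => t * Real.cosh t - Real.sinh t) (y * Real.sinh y) y :=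
        (((hasDerivAt_id y).mul (Real.hasDerivAt_cosh y)).sub
          (Real.hasDerivAt_sinh y)).congr_deriv (by simp)
      rw [this.deriv]
      exact mul_nonneg hy.le (Real.sinh_nonneg_iff.2 hy.le)
    simpa using hm (Set.mem_Ici.2 le_rfl) (Set.mem_Ici.2 hx.le) hx.le
  have h2 : MonotoneOn (fun t => t * (Real.cosh t + 2) / 3 - Real.sinh t) (Set.Ici 0) := by
    apply monotoneOn_of_deriv_nonneg (convex_Ici 0) (by fun_prop) (by fun_prop)
    intro x hx
    simp at hx
    have : HasDerivAt (fun t => t * (Real.cosh t + 2) / 3 - Real.sinh t)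
        ((x * Real.sinh x - 2 * Real.cosh x + 2) / 3) x :=
      ((((hasDerivAt_id x).mul ((Real.hasDerivAt_cosh x).add_const 2)).div_const 3).sub
        (Real.hasDerivAt_sinh x)).congr_deriv (by simp; ring)
    rw [this.deriv]
    have := h1 (Set.mem_Ici.2 le_rfl) (Set.mem_Ici.2 hx.le) hx.le
    simp at this
    linarith
  have := h2 (Set.mem_Ici.2 le_rfl) (Set.mem_Ici.2 ht) ht
  simp at this
  linarith

lemma one_add_half_sq_le_cosh (t : ℝ) : 1 + t ^ 2 / 2 ≤ Real.cosh t := by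
  have h := Real.cosh_two_mul (t / 2)
  rw [mul_div_cancel₀ _ two_ne_zero] at h
  have h2 := Real.cosh_sq (t / 2)
  have h3 : (t / 2) ^ 2 ≤ Real.sinh (t / 2) ^ 2 := by
    rw [sq_le_sq]
    rcases le_total 0 (t / 2) with h | h
    · rw [abs_of_nonneg h, abs_of_nonneg (Real.sinh_nonneg_iff.2 h)]
      exact Real.self_le_sinh_iff.2 h
    · rw [abs_of_nonpos h, abs_of_nonpos (Real.sinh_nonpos_iff.2 h)]
      have := Real.sinh_le_self_iff.2 h
      linarith
  nlinarith

/-- Below `β_c` the mean spin falls short of its linearisation by a cubic amount. -/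
lemma cubic_le_sub_spinMean {a₁ : ℝ} (ha₁ : a₁ < 4) : ∃ c > 0, ∀ a, 0 < a → a ≤ a₁ →
    ∀ t, 0 ≤ t → t ≤ 4 → c * t ^ 3 ≤ 2 / (a + 2) * t - spinMean a t := by
  -- Here 108 = 3 · 36: the numerator bound carries a factor 1/3, and the denominator is at most 6 ·
  -- 6 cosh 4. Fields up to 4 suffice because 2βK ≤ 4 and |S/n| ≤ 1.
  refine ⟨(4 - a₁) / (108 * Real.cosh 4), div_pos (sub_pos.2 ha₁) (by have := Real.cosh_pos 4; positivity), fun a ha haa t ht ht4 => ?_⟩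
  have hC := Real.one_le_cosh t
  have hC4 : Real.cosh t ≤ Real.cosh 4 := by
    rw [Real.cosh_le_cosh, abs_of_nonneg ht]; simpa using ht4
  have hd := spin_denom_pos ha t
  -- The numerator is the Cusa–Huygens gap times `a + 2`, plus a term with factor `4 - a`. The
  -- latter supplies the cubic growth, and its sign is favourable exactly below β_c = log 4.
  have key : (4 - a₁) * t ^ 3 / 3 ≤ 2 * ((a + 2) * (t * (Real.cosh t + 2) / 3 - Real.sinh t)
      + (4 - a) * t * (Real.cosh t - 1) / 3) := by
    have h1 := sinh_le_cusa ht
    have h2 := one_add_half_sq_le_cosh t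
    have h3 : t ^ 2 / 2 ≤ Real.cosh t - 1 := by linarith
    have h4 : (4 - a₁) * t * (t ^ 2 / 2) ≤ (4 - a) * t * (Real.cosh t - 1) := by
      gcongr
      · nlinarith
    have h5 : 0 ≤ (a + 2) * (t * (Real.cosh t + 2) / 3 - Real.sinh t) :=
      mul_nonneg (by linarith) (by linarith)
    nlinarith
  have e2 : 2 / (a + 2) * t - spinMean a t = 2 * ((a + 2) * (t * (Real.cosh t + 2) / 3 -
      Real.sinh t) + (4 - a) * t * (Real.cosh t - 1) / 3) / ((a + 2) * (a + 2 * Real.cosh t)) := by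
    rw [spinMean]; field_simp; ring
  rw [e2, le_div_iff₀ (by positivity)]
  refine le_trans ?_ key
  have hden : (a + 2) * (a + 2 * Real.cosh t) ≤ 6 * (6 * Real.cosh 4) := by
    gcongr
    · linarith
    · nlinarith
  calc (4 - a₁) / (108 * Real.cosh 4) * t ^ 3 * ((a + 2) * (a + 2 * Real.cosh t))
      ≤ (4 - a₁) / (108 * Real.cosh 4) * t ^ 3 * (6 * (6 * Real.cosh 4)) := by
        have := sub_pos.2 ha₁
        have := Real.cosh_pos 4
        gcongr
    _ = (4 - a₁) * t ^ 3 / 3 := by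
        have := (Real.cosh_pos 4).ne'
        field_simp; ring

/-- The cubic gap keeps the drift confining even when its linear coefficient is zero or negative.
The factor x⁵ prepares the sixth-moment estimate; negative x follows by oddness. -/
lemma drift_mul_pow_five_ge {a₁ : ℝ} (ha₁ : a₁ < 4) : ∃ c > 0, ∀ a, 0 < a → a ≤ a₁ →
    ∀ L, 1 ≤ L → L ≤ 4 → ∀ x, |x| ≤ 1 →
      (1 - 2 / (a + 2) * L) * x ^ 6 + c * x ^ 8 ≤ (x - spinMean a (L * x)) * x ^ 5 := by
  obtain ⟨c, hc, h⟩ := cubic_le_sub_spinMean ha₁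
  have main : ∀ a, 0 < a → a ≤ a₁ → ∀ L, 1 ≤ L → L ≤ 4 → ∀ x, 0 ≤ x → x ≤ 1 →
      (1 - 2 / (a + 2) * L) * x ^ 6 + c * x ^ 8 ≤ (x - spinMean a (L * x)) * x ^ 5 := by
    intro a ha haa L hL1 hL4 x hx0 hx1
    have h1 := h a ha haa (L * x) (by positivity) (by nlinarith)
    have h2 : c * x ^ 3 ≤ c * (L * x) ^ 3 := by
      gcongr
      nlinarith
    have h3 : (1 - 2 / (a + 2) * L) * x + c * x ^ 3 ≤ x - spinMean a (L * x) := by linarith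
    have h4 := mul_le_mul_of_nonneg_right h3 (pow_nonneg hx0 5)
    linarith [h4]
  refine ⟨c, hc, fun a ha haa L hL1 hL4 x hx => ?_⟩
  rw [abs_le] at hx
  rcases le_total 0 x with h0 | h0
  · exact main a ha haa L hL1 hL4 x h0 hx.2
  · have := main a ha haa L hL1 hL4 (-x) (by linarith) (by linarith)
    rw [mul_neg, spinMean_neg] at this
    nlinarith [this]

/-! ### Derivatives of the free-energy function `G` -/

lemma hasDerivAt_cumulant (β t : ℝ) : HasDerivAt (cumulant β) (spinMean (Real.exp β) t) t := by
  have hb := Real.exp_pos β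
  have h1 : ∀ t, 0 < 1 + Real.exp (-β) * (Real.exp t + Real.exp (-t)) := fun t => by positivity
  have h2 : 0 < 1 + 2 * Real.exp (-β) := by positivity
  have := ((((((Real.hasDerivAt_exp t).add ((hasDerivAt_neg t).exp)).const_mul
    (Real.exp (-β))).const_add 1).div_const (1 + 2 * Real.exp (-β))).log
    (div_pos (h1 t) h2).ne')
  refine this.congr_deriv ?_
  have h3 := spin_denom_pos hb t
  have h4 := h1 t
  simp only [Pi.add_apply]
  rw [Real.cosh_eq] at h3
  rw [spinMean, Real.sinh_eq, Real.cosh_eq]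
  rw [Real.exp_neg β] at *
  field_simp
  ring

/-- The fourth derivative of `G_{β,K}` at the origin. -/
lemma iteratedDeriv_four_G (β K : ℝ) : iteratedDeriv 4 (G β K) 0 =
    (2 * β * K) ^ 4 * (3 * (2 / (Real.exp β + 2)) ^ 2 - 2 / (Real.exp β + 2)) := by
  have ha := Real.exp_pos β
  set L := 2 * β * K with hL
  set a := Real.exp β with haa
  have hl := fun t : ℝ => (hasDerivAt_id' t).const_mul L
  have hM : ∀ t, HasDerivAt (fun t => spinMean a (L * t))
      ((spinSq a (L * t) - spinMean a (L * t) ^ 2) * L) t := fun t => by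
    exact ((hasDerivAt_spinMean ha (L * t)).comp t (hl t)).congr_deriv (by ring)
  have hS : ∀ t, HasDerivAt (fun t => spinSq a (L * t))
      ((spinMean a (L * t) - spinSq a (L * t) * spinMean a (L * t)) * L) t := fun t => by
    exact ((hasDerivAt_spinSq ha (L * t)).comp t (hl t)).congr_deriv (by ring)
  have d1 : deriv (G β K) = fun t => L * (t - spinMean a (L * t)) := by
    funext t
    have hc : HasDerivAt (fun t => cumulant β (L * t)) (spinMean a (L * t) * L) t := by
      exact ((hasDerivAt_cumulant β (L * t)).comp t (hl t)).congr_deriv (by ring)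
    have : HasDerivAt (G β K) (β * K * (2 * t) - spinMean a (L * t) * L) t := ((((hasDerivAt_id t).pow 2).const_mul (β * K)).sub hc).congr_deriv (by simp)
    rw [this.deriv]; simp only [hL]; ring
  have d2 : deriv (fun t => L * (t - spinMean a (L * t))) =
      fun t => L - L ^ 2 * (spinSq a (L * t) - spinMean a (L * t) ^ 2) := by
    funext t
    refine (HasDerivAt.congr_deriv (((hasDerivAt_id' t).sub (hM t)).const_mul L) ?_).deriv
    ring
  have d3 : deriv (fun t => L - L ^ 2 * (spinSq a (L * t) - spinMean a (L * t) ^ 2)) =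
      fun t => - L ^ 3 * (spinMean a (L * t) - 3 * spinMean a (L * t) * spinSq a (L * t)
        + 2 * spinMean a (L * t) ^ 3) := by
    funext t
    refine (HasDerivAt.congr_deriv ((((hS t).sub ((hM t).pow 2)).const_mul (L ^ 2)).const_sub L)
      ?_).deriv
    simp; ring
  have d4 : HasDerivAt (fun t => - L ^ 3 * (spinMean a (L * t) - 3 * spinMean a (L * t) *
      spinSq a (L * t) + 2 * spinMean a (L * t) ^ 3)) _ 0 :=
    (((hM 0).sub (((hM 0).const_mul 3).mul (hS 0))).add (((hM 0).pow 3).const_mul 2)).const_mul _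
  rw [iteratedDeriv_succ', iteratedDeriv_succ', iteratedDeriv_succ', iteratedDeriv_one, d1, d2, d3,
    d4.deriv]
  simp [spinSq_zero]
  ring

/-! ### Gibbs averages as weighted finite sums -/

instance instIsProbabilityMeasureSpin : IsProbabilityMeasure spinMeasure := by
  constructor
  simp [spinMeasure]
  rw [← ENNReal.inv_mul_cancel (a := 3) (by simp) (by simp)]
  ring

instance instIsProbabilityMeasureGibbs (n : ℕ) (β K : ℝ) : IsProbabilityMeasure (gibbs n β K) :=
  isProbabilityMeasure_tilted .of_finite

lemma spinMeasure_real_singleton (a : SignType) : spinMeasure.real {a} = 1 / 3 := by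
  rw [Measure.real, spinMeasure]
  cases a <;> simp [Set.indicator] 

lemma sum_signType (f : SignType → ℝ) : ∑ a, f a = f 0 + f (-1) + f 1 := by
  rw [SignType.univ_eq]
  rw [Finset.sum_insert (by decide), Finset.sum_insert (by decide), Finset.sum_singleton]
  ring

/-- The Gibbs expectation. -/
noncomputable def avg (n : ℕ) (β K : ℝ) (f : Config n → ℝ) : ℝ := ∫ ω, f ω ∂(gibbs n β K)

/-- Each configuration has product mass 3^{-n}. The identities proved later are homogeneous, so the
normalising constant can stay hidden. -/
lemma exists_avg_eq_sum (n : ℕ) (β K : ℝ) : ∃ c > 0, ∀ f : Config n → ℝ,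
    avg n β K f = c * ∑ ω, Real.exp (-β * hamiltonian n K ω) * f ω := by
  set μ : Measure (Config n) := Measure.pi fun _ : Fin n => spinMeasure
  have hμ : ∀ ω, μ.real {ω} = (1 / 3) ^ n := fun ω => by
    rw [Measure.real, Measure.pi_singleton, ENNReal.toReal_prod]
    simp only [← Measure.real_def, spinMeasure_real_singleton]
    simp
  have hZ : 0 < ∫ ω, Real.exp (-β * hamiltonian n K ω) ∂μ := integral_exp_pos .of_finite
  refine ⟨(1 / 3) ^ n / ∫ ω, Real.exp (-β * hamiltonian n K ω) ∂μ, by positivity, fun f => ?_⟩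
  rw [avg, gibbs, integral_tilted, integral_fintype .of_finite, Finset.mul_sum]
  refine Finset.sum_congr rfl fun ω _ => ?_
  rw [hμ, smul_eq_mul, smul_eq_mul]
  ring

section avg
variable {n : ℕ} {β K : ℝ}

lemma avg_add (f g : Config n → ℝ) :
    avg n β K (fun ω => f ω + g ω) = avg n β K f + avg n β K g :=
  integral_add .of_finite .of_finite

lemma avg_sub (f g : Config n → ℝ) :
    avg n β K (fun ω => f ω - g ω) = avg n β K f - avg n β K g :=
  integral_sub .of_finite .of_finite

lemma avg_const_mul (c : ℝ) (f : Config n → ℝ) :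
    avg n β K (fun ω => c * f ω) = c * avg n β K f :=
  integral_const_mul _ _

lemma avg_const (c : ℝ) : avg n β K (fun _ => c) = c := by simp [avg]

lemma avg_mono {f g : Config n → ℝ} (h : ∀ ω, f ω ≤ g ω) : avg n β K f ≤ avg n β K g :=
  integral_mono .of_finite .of_finite h

lemma avg_nonneg {f : Config n → ℝ} (h : ∀ ω, 0 ≤ f ω) : 0 ≤ avg n β K f :=
  integral_nonneg h

lemma abs_avg_le {f g : Config n → ℝ} (h : ∀ ω, |f ω| ≤ g ω) : |avg n β K f| ≤ avg n β K g :=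
  (abs_integral_le_integral_abs).trans (avg_mono h)

lemma avg_sum {ι : Type*} (s : Finset ι) (f : ι → Config n → ℝ) :
    avg n β K (fun ω => ∑ i ∈ s, f i ω) = ∑ i ∈ s, avg n β K (f i) :=
  integral_finsetSum _ fun _ _ => .of_finite

lemma avg_pos {f : Config n → ℝ} (h : ∀ ω, 0 ≤ f ω) {ω₀ : Config n} (h₀ : 0 < f ω₀) :
    0 < avg n β K f := by
  obtain ⟨c, hc, e⟩ := exists_avg_eq_sum n β K
  rw [e]
  refine mul_pos hc (Finset.sum_pos' (fun ω _ => mul_nonneg (Real.exp_pos _).le (h ω))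
    ⟨ω₀, Finset.mem_univ _, mul_pos (Real.exp_pos _) h₀⟩)

lemma avg_indicator_le (g : Config n → ℝ) (t : ℝ) :
    avg n β K (fun ω => if g ω ≤ t then 1 else 0) = (gibbs n β K).real {ω | g ω ≤ t} := by
  classical
  rw [avg, ← integral_indicator_one (Set.toFinite _).measurableSet]
  rfl

end avg

/-! ### Conditioning on all spins but one -/

/-- The configuration space is fibred along the coordinate `i`, each fibre being represented by its
point with `ω i = 0`. -/
lemma sum_eq_zero_of_sum_update {n : ℕ} (i : Fin n) (f : Config n → ℝ)
    (h : ∀ ω : Config n, ω i = 0 → ∑ a, f (Function.update ω i a) = 0) : ∑ ω, f ω = 0 := by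
  have e := Fintype.sum_equiv (Equiv.funSplitAt i SignType) f
    (fun x => f ((Equiv.funSplitAt i SignType).symm x)) (fun x => by rw [Equiv.symm_apply_apply])
  rw [e, Fintype.sum_prod_type_right]
  refine Finset.sum_eq_zero fun r _ => ?_
  rw [← h ((Equiv.funSplitAt i SignType).symm (0, r)) (by simp [Equiv.funSplitAt, Equiv.piSplitAt])]
  refine Finset.sum_congr rfl fun a _ => ?_
  congr 1
  funext j
  by_cases hj : j = i
  · subst hj; simp [Equiv.funSplitAt, Equiv.piSplitAt]
  · simp [Equiv.funSplitAt, Equiv.piSplitAt, hj]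

/-- The total spin with the `i`-th spin removed. -/
noncomputable def spinWithout {n : ℕ} (i : Fin n) (ω : Config n) : ℝ :=
  totalSpin (Function.update ω i 0)

lemma totalSpin_update {n : ℕ} (i : Fin n) (ω : Config n) (a : SignType) :
    totalSpin (Function.update ω i a) = spinWithout i ω + a := by
  simp only [spinWithout, totalSpin]
  rw [← Finset.add_sum_erase _ _ (Finset.mem_univ i), ← Finset.add_sum_erase Finset.univ
    (fun j => ((Function.update ω i 0 j : SignType) : ℝ)) (Finset.mem_univ i)]
  have : ∀ j ∈ Finset.univ.erase i, ((Function.update ω i a j : SignType) : ℝ) =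
      ((Function.update ω i 0 j : SignType) : ℝ) := fun j hj => by
    simp [Function.update_of_ne (Finset.ne_of_mem_erase hj)]
  rw [Finset.sum_congr rfl this]
  simp; ring

lemma spinWithout_eq {n : ℕ} (i : Fin n) (ω : Config n) :
    spinWithout i ω = totalSpin ω - ω i := by
  have := totalSpin_update i ω (ω i)
  rw [Function.update_eq_self] at this
  linarith

lemma spinWithout_update {n : ℕ} (i : Fin n) (ω : Config n) (a : SignType) :
    spinWithout i (Function.update ω i a) = spinWithout i ω := by
  simp [spinWithout]

lemma sum_sq_update {n : ℕ} (i : Fin n) (ω : Config n) (a : SignType) :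
    ∑ j, ((Function.update ω i a j : SignType) : ℝ) ^ 2 =
      ∑ j, ((Function.update ω i 0 j : SignType) : ℝ) ^ 2 + (a : ℝ) ^ 2 := by
  rw [← Finset.add_sum_erase _ _ (Finset.mem_univ i), ← Finset.add_sum_erase Finset.univ
    (fun j => ((Function.update ω i 0 j : SignType) : ℝ) ^ 2) (Finset.mem_univ i)]
  have : ∀ j ∈ Finset.univ.erase i, ((Function.update ω i a j : SignType) : ℝ) ^ 2 =
      ((Function.update ω i 0 j : SignType) : ℝ) ^ 2 := fun j hj => by
    simp [Function.update_of_ne (Finset.ne_of_mem_erase hj)]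
  rw [Finset.sum_congr rfl this]
  simp; ring

/-- The Boltzmann weight of the spin value `a` in the environment of total spin `T`. -/
noncomputable def siteWeight (n : ℕ) (β K T : ℝ) (a : SignType) : ℝ :=
  Real.exp (-β * ((a : ℝ) ^ 2 - K / n * (2 * a * T + (a : ℝ) ^ 2)))

lemma exp_hamiltonian_update {n : ℕ} (β K : ℝ) (i : Fin n) (ω : Config n) (a : SignType) :
    Real.exp (-β * hamiltonian n K (Function.update ω i a)) =
      Real.exp (-β * hamiltonian n K (Function.update ω i 0)) *
        siteWeight n β K (spinWithout i ω) a := by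
  rw [siteWeight, ← Real.exp_add]
  congr 1
  simp only [hamiltonian]
  rw [sum_sq_update, totalSpin_update, totalSpin_update]
  simp; ring

/-- Conditioning on all spins but one. -/
lemma avg_conditional {n : ℕ} (β K : ℝ) (i : Fin n) (u : SignType → ℝ) (m : ℝ → ℝ)
    (hm : ∀ T, ∑ a, siteWeight n β K T a * (u a - m T) = 0) (F : Config n → ℝ) :
    avg n β K (fun ω => (u (ω i) - m (spinWithout i ω)) * F (Function.update ω i 0)) = 0 := by
  obtain ⟨c, -, e⟩ := exists_avg_eq_sum n β K
  rw [e, sum_eq_zero_of_sum_update i, mul_zero]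
  intro ω _
  have : ∀ a, Real.exp (-β * hamiltonian n K (Function.update ω i a)) *
      ((u (Function.update ω i a i) - m (spinWithout i (Function.update ω i a))) *
        F (Function.update (Function.update ω i a) i 0)) =
      Real.exp (-β * hamiltonian n K (Function.update ω i 0)) * F (Function.update ω i 0) *
        (siteWeight n β K (spinWithout i ω) a * (u a - m (spinWithout i ω))) := fun a => by
    rw [exp_hamiltonian_update, spinWithout_update]
    simp; ring
  simp_rw [this]
  rw [← Finset.mul_sum, hm, mul_zero]

/-- The effective value of `e^β` seen by a single spin. -/
noncomputable def siteParam (n : ℕ) (β K : ℝ) : ℝ := Real.exp (β - β * K / n)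

lemma siteParam_pos (n : ℕ) (β K : ℝ) : 0 < siteParam n β K := Real.exp_pos _

lemma siteWeight_zero (n : ℕ) (β K T : ℝ) : siteWeight n β K T 0 = 1 := by simp [siteWeight]

/-- The diagonal part K ω_i²/n of the interaction is what shifts β to β - βK/n in `siteParam`. -/
lemma siteWeight_one (n : ℕ) (β K T : ℝ) : siteWeight n β K T 1 =
    (siteParam n β K)⁻¹ * Real.exp (2 * β * K * (T / n)) := by
  rw [siteWeight, siteParam, ← Real.exp_neg, ← Real.exp_add]
  congr 1; simp; ring

lemma siteWeight_neg_one (n : ℕ) (β K T : ℝ) : siteWeight n β K T (-1) =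
    (siteParam n β K)⁻¹ * Real.exp (-(2 * β * K * (T / n))) := by
  rw [siteWeight, siteParam, ← Real.exp_neg, ← Real.exp_add]
  congr 1; simp; ring

lemma sum_siteWeight_spin (n : ℕ) (β K T : ℝ) : ∑ a : SignType, siteWeight n β K T a *
    ((a : ℝ) - spinMean (siteParam n β K) (2 * β * K * (T / n))) = 0 := by
  have h := siteParam_pos n β K
  have h2 := spin_denom_pos h (2 * β * K * (T / n))
  rw [sum_signType, siteWeight_zero, siteWeight_one, siteWeight_neg_one]
  rw [spinMean, Real.sinh_eq, Real.cosh_eq] at *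
  simp
  field_simp
  ring

lemma sum_siteWeight_spinSq (n : ℕ) (β K T : ℝ) : ∑ a : SignType, siteWeight n β K T a *
    ((a : ℝ) ^ 2 - spinSq (siteParam n β K) (2 * β * K * (T / n))) = 0 := by
  have h := siteParam_pos n β K
  have h2 := spin_denom_pos h (2 * β * K * (T / n))
  rw [sum_signType, siteWeight_zero, siteWeight_one, siteWeight_neg_one]
  rw [spinSq, Real.cosh_eq] at *
  simp
  field_simp
  ring

/-- The conditional mean of the `i`-th spin given the others. -/
noncomputable def condMean (n : ℕ) (β K : ℝ) (i : Fin n) (ω : Config n) : ℝ :=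
  spinMean (siteParam n β K) (2 * β * K * (spinWithout i ω / n))

/-- The conditional second moment of the `i`-th spin given the others. -/
noncomputable def condSq (n : ℕ) (β K : ℝ) (i : Fin n) (ω : Config n) : ℝ :=
  spinSq (siteParam n β K) (2 * β * K * (spinWithout i ω / n))

lemma avg_spin_sub_condMean {n : ℕ} (β K : ℝ) (i : Fin n) (F : Config n → ℝ) :
    avg n β K (fun ω => ((ω i : ℝ) - condMean n β K i ω) * F (Function.update ω i 0)) = 0 :=
  avg_conditional β K i (fun a => (a : ℝ)) _ (sum_siteWeight_spin n β K) F

lemma avg_spinSq_sub_condSq {n : ℕ} (β K : ℝ) (i : Fin n) (F : Config n → ℝ) :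
    avg n β K (fun ω => ((ω i : ℝ) ^ 2 - condSq n β K i ω) * F (Function.update ω i 0)) = 0 :=
  avg_conditional β K i (fun a => (a : ℝ) ^ 2) _ (sum_siteWeight_spinSq n β K) F

/-- `F` with its i-th spin zeroed depends on the other spins only, hence is orthogonal to the
centred i-th spin; subtracting it leaves the increment. This is the source of every Stein identity
below. -/
lemma avg_sum_spin_mul {n : ℕ} (β K : ℝ) (F : Config n → ℝ) :
    avg n β K (fun ω => (∑ i, ((ω i : ℝ) - condMean n β K i ω)) * F ω) =
      avg n β K (fun ω => ∑ i, ((ω i : ℝ) - condMean n β K i ω) *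
        (F ω - F (Function.update ω i 0))) := by
  simp_rw [Finset.sum_mul, avg_sum]
  refine Finset.sum_congr rfl fun i _ => ?_
  simp_rw [mul_sub]
  rw [avg_sub, avg_spin_sub_condMean, sub_zero]

lemma avg_sum_spinSq_mul {n : ℕ} (β K : ℝ) (F : Config n → ℝ) :
    avg n β K (fun ω => (∑ i, ((ω i : ℝ) ^ 2 - condSq n β K i ω)) * F ω) =
      avg n β K (fun ω => ∑ i, ((ω i : ℝ) ^ 2 - condSq n β K i ω) *
        (F ω - F (Function.update ω i 0))) := by
  simp_rw [Finset.sum_mul, avg_sum]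
  refine Finset.sum_congr rfl fun i _ => ?_
  simp_rw [mul_sub]
  rw [avg_sub, avg_spinSq_sub_condSq, sub_zero]

/-! ### Uniform parameter range, and comparison of conditional with free moments -/

/-- The parameter range in which the estimates below are uniform. -/
structure Regime (n : ℕ) (β K γ : ℝ) : Prop where
  one_le : 1 ≤ n
  le_gamma : 1 / 4 ≤ γ
  gamma_le : γ ≤ 1 / 2
  beta_pos : 0 < β
  exp_le : Real.exp β ≤ 4
  one_le_field : 1 ≤ 2 * β * K
  field_le : 2 * β * K ≤ 4

/-- The rescaled drift `n^{-γ} (S_n - n c_β'(2βK S_n / n))`. -/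
noncomputable def drift (n : ℕ) (β K γ : ℝ) (ω : Config n) : ℝ :=
  (totalSpin ω - n * spinMean (Real.exp β) (2 * β * K * (totalSpin ω / n))) / (n : ℝ) ^ γ

/-- The variance `c_β''(0)` of a single free spin. -/
noncomputable def spinVar (β : ℝ) : ℝ := 2 / (Real.exp β + 2)

lemma spinVar_pos (β : ℝ) : 0 < spinVar β := by have := Real.exp_pos β; rw [spinVar]; positivity

lemma spinVar_le_one (β : ℝ) : spinVar β ≤ 1 := by
  have := Real.exp_pos β
  rw [spinVar, div_le_one (by positivity)]; linarith

lemma abs_spin_le_one (a : SignType) : |(a : ℝ)| ≤ 1 := by cases a <;> simp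

lemma spin_sq_le_one (a : SignType) : (a : ℝ) ^ 2 ≤ 1 := by cases a <;> simp

lemma abs_totalSpin_le {n : ℕ} (ω : Config n) : |totalSpin ω| ≤ n := by
  refine (Finset.abs_sum_le_sum_abs _ _).trans ?_
  refine (Finset.sum_le_sum fun i _ => abs_spin_le_one (ω i)).trans ?_
  simp

lemma abs_spinWithout_le {n : ℕ} (i : Fin n) (ω : Config n) :
    |spinWithout i ω| ≤ |totalSpin ω| + 1 := by
  rw [spinWithout_eq]
  exact (abs_sub _ _).trans (by linarith [abs_spin_le_one (ω i)])

lemma W_update {n : ℕ} (γ : ℝ) (i : Fin n) (ω : Config n) :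
    W n γ (Function.update ω i 0) = W n γ ω - (ω i : ℝ) / (n : ℝ) ^ (1 - γ) := by
  have := spinWithout_eq i ω
  rw [spinWithout] at this
  rw [W, this, W, sub_div]

namespace Regime
variable {n : ℕ} {β K γ : ℝ}

lemma one_le_cast (h : Regime n β K γ) : (1 : ℝ) ≤ n := by exact_mod_cast h.one_le

lemma cast_pos (h : Regime n β K γ) : (0 : ℝ) < n := by linarith [h.one_le_cast]

lemma one_le_rpow (h : Regime n β K γ) : 1 ≤ (n : ℝ) ^ γ :=
  Real.one_le_rpow h.one_le_cast (by linarith [h.le_gamma])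

lemma rpow_le (h : Regime n β K γ) : (n : ℝ) ^ γ ≤ (n : ℝ) ^ (1 - γ) :=
  Real.rpow_le_rpow_of_exponent_le h.one_le_cast (by linarith [h.gamma_le])

lemma rpow_mul (h : Regime n β K γ) : (n : ℝ) ^ γ * (n : ℝ) ^ (1 - γ) = n := by
  rw [← Real.rpow_add h.cast_pos]; simp

lemma le_rpow_pow (h : Regime n β K γ) : (n : ℝ) ≤ ((n : ℝ) ^ γ) ^ 4 := by
  rw [← Real.rpow_natCast, ← Real.rpow_mul h.cast_pos.le]
  conv_lhs => rw [← Real.rpow_one (n : ℝ)]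
  refine Real.rpow_le_rpow_of_exponent_le h.one_le_cast ?_
  have := h.le_gamma
  push_cast; linarith

lemma abs_param_sub_le (h : Regime n β K γ) : |Real.exp β - siteParam n β K| ≤ 8 / n := by
  have hn := h.cast_pos
  have hx : 0 ≤ β * K / n := div_nonneg (by linarith [h.one_le_field]) hn.le
  have hx2 : β * K / n ≤ 2 / n := by gcongr; linarith [h.field_le]
  have e : Real.exp β - siteParam n β K = Real.exp β * (1 - Real.exp (-(β * K / n))) := by
    rw [siteParam, sub_eq_add_neg β, Real.exp_add]; ring
  have h1 : 1 - Real.exp (-(β * K / n)) ≤ β * K / n := by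
    linarith [Real.add_one_le_exp (-(β * K / n))]
  have h2 : 0 ≤ 1 - Real.exp (-(β * K / n)) := by
    have := Real.exp_le_one_iff.2 (neg_nonpos.2 hx); linarith
  rw [e, abs_of_nonneg (mul_nonneg (Real.exp_pos _).le h2)]
  calc _ ≤ 4 * (2 / (n : ℝ)) := mul_le_mul h.exp_le (h1.trans hx2) h2 (by norm_num)
    _ = 8 / (n : ℝ) := by ring

lemma abs_field_mul (h : Regime n β K γ) (x : ℝ) : |2 * β * K * (x / n)| ≤ 4 * |x| / n := by
  rw [abs_mul, abs_div, abs_of_pos h.cast_pos, abs_of_nonneg (by linarith [h.one_le_field]),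
    mul_div_assoc]
  have := h.cast_pos
  gcongr
  exact h.field_le

/-- Of the 12/n, 8/n pays for the shift of e^β to `siteParam` and 4/n for removing one spin from the
field. -/
lemma abs_condMean_sub_le (h : Regime n β K γ) (i : Fin n) (ω : Config n) :
    |condMean n β K i ω - spinMean (Real.exp β) (2 * β * K * (totalSpin ω / n))| ≤ 12 / n := by
  have h1 := abs_spinMean_sub_param_le (siteParam_pos n β K) (Real.exp_pos β)
    (2 * β * K * (spinWithout i ω / n))
  have h2 := abs_spinMean_sub_le (Real.exp_pos β) (2 * β * K * (spinWithout i ω / n))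
    (2 * β * K * (totalSpin ω / n))
  have h3 := h.abs_param_sub_le
  rw [abs_sub_comm] at h3
  have h4 : |2 * β * K * (spinWithout i ω / n) - 2 * β * K * (totalSpin ω / n)| ≤ 4 / n := by
    rw [spinWithout_eq, ← mul_sub, ← sub_div]
    refine (h.abs_field_mul _).trans ?_
    have := h.cast_pos
    gcongr
    rw [sub_sub_cancel_left, abs_neg]
    linarith [abs_spin_le_one (ω i)]
  rw [condMean]
  calc _ ≤ 8 / (n : ℝ) + 4 / n := (abs_sub_le _ _ _).trans
        (add_le_add (h1.trans h3) (h2.trans h4))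
    _ = 12 / n := by ring

lemma abs_condMean_le (h : Regime n β K γ) (i : Fin n) (ω : Config n) :
    |condMean n β K i ω| ≤ 4 * (|totalSpin ω| + 1) / n := by
  refine (abs_spinMean_le (siteParam_pos n β K) _).trans ((h.abs_field_mul _).trans ?_)
  have := h.cast_pos
  gcongr
  exact abs_spinWithout_le i ω

lemma abs_condSq_sub_le (h : Regime n β K γ) (i : Fin n) (ω : Config n) :
    |condSq n β K i ω - spinVar β| ≤ (12 + 4 * |totalSpin ω|) / n := by
  have h1 := abs_spinSq_sub_param_le (siteParam_pos n β K) (Real.exp_pos β)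
    (2 * β * K * (spinWithout i ω / n))
  have h2 := abs_spinSq_sub_le (Real.exp_pos β) (2 * β * K * (spinWithout i ω / n)) 0
  have h3 := h.abs_param_sub_le
  rw [abs_sub_comm] at h3
  have h4 : |2 * β * K * (spinWithout i ω / n) - 0| ≤ 4 * (|totalSpin ω| + 1) / n := by
    rw [sub_zero]
    refine (h.abs_field_mul _).trans ?_
    have := h.cast_pos
    gcongr
    exact abs_spinWithout_le i ω
  rw [condSq, spinVar, ← spinSq_zero]
  calc _ ≤ 8 / (n : ℝ) + 4 * (|totalSpin ω| + 1) / n := (abs_sub_le _ _ _).trans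
        (add_le_add (h1.trans h3) (h2.trans h4))
    _ = _ := by ring

lemma abs_sum_sub_drift_le (h : Regime n β K γ) (ω : Config n) :
    |drift n β K γ ω - (∑ i, ((ω i : ℝ) - condMean n β K i ω)) / (n : ℝ) ^ γ| ≤
      12 / (n : ℝ) ^ γ := by
  have hr := h.one_le_rpow
  have hn := h.cast_pos
  rw [drift, ← sub_div, abs_div, abs_of_pos (show 0 < (n : ℝ) ^ γ by linarith)]
  gcongr
  have : totalSpin ω - n * spinMean (Real.exp β) (2 * β * K * (totalSpin ω / n)) -
      ∑ i, ((ω i : ℝ) - condMean n β K i ω) = ∑ i : Fin n, (condMean n β K i ω -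
        spinMean (Real.exp β) (2 * β * K * (totalSpin ω / n))) := by
    rw [Finset.sum_sub_distrib, Finset.sum_sub_distrib, totalSpin]
    simp
  rw [this]
  refine (Finset.abs_sum_le_sum_abs _ _).trans ?_
  refine (Finset.sum_le_sum fun i _ => h.abs_condMean_sub_le i ω).trans ?_
  simp
  field_simp
  exact le_rfl

lemma abs_W_mul (h : Regime n β K γ) (ω : Config n) :
    |totalSpin ω| = |W n γ ω| * (n : ℝ) ^ (1 - γ) := by
  have : 0 < (n : ℝ) ^ (1 - γ) := Real.rpow_pos_of_pos h.cast_pos _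
  rw [W, abs_div, abs_of_pos this]; field_simp

/-! ### Stein's identity for the rescaled spin -/

/-- Stein's identity for the total spin, with an explicit error. -/
lemma stein_identity (h : Regime n β K γ) (g d : ℝ → ℝ) (R : Config n → ℝ)
    (hR : ∀ ω v, |v| ≤ 1 / (n : ℝ) ^ (1 - γ) →
      |g (W n γ ω) - g (W n γ ω - v) - v * d (W n γ ω)| ≤ R ω / (n : ℝ) ^ (1 - γ)) :
    |avg n β K (fun ω => drift n β K γ ω * g (W n γ ω)) -
      avg n β K (fun ω => (∑ i, (ω i : ℝ) ^ 2) / n * d (W n γ ω))| ≤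
    avg n β K (fun ω => 12 / (n : ℝ) ^ γ * |g (W n γ ω)| + (2 * R ω +
      4 * (|W n γ ω| + 1) / (n : ℝ) ^ γ * |d (W n γ ω)|)) := by
  set r := (n : ℝ) ^ γ with hr
  set s := (n : ℝ) ^ (1 - γ) with hs
  have hn := h.cast_pos
  have r1 : 1 ≤ r := h.one_le_rpow
  have rs : r ≤ s := h.rpow_le
  have rsn : r * s = n := h.rpow_mul
  have r0 : 0 < r := by linarith
  have s0 : 0 < s := by linarith
  have e := avg_sum_spin_mul β K (fun ω : Config n => g (W n γ ω))
  have e1 : avg n β K (fun ω => drift n β K γ ω * g (W n γ ω)) -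
      avg n β K (fun ω => (∑ i, (ω i : ℝ) ^ 2) / n * d (W n γ ω)) =
      avg n β K (fun ω => (drift n β K γ ω * g (W n γ ω) -
        1 / r * ((∑ i, ((ω i : ℝ) - condMean n β K i ω)) * g (W n γ ω))) +
        (1 / r * (∑ i, ((ω i : ℝ) - condMean n β K i ω) *
          (g (W n γ ω) - g (W n γ (Function.update ω i 0)))) -
            (∑ i, (ω i : ℝ) ^ 2) / n * d (W n γ ω))) := by
    rw [avg_add, avg_sub, avg_sub, avg_const_mul, avg_const_mul, e]; ring
  rw [e1]
  refine abs_avg_le fun ω => (abs_add_le _ _).trans (add_le_add ?_ ?_)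
  · have := h.abs_sum_sub_drift_le ω
    rw [show drift n β K γ ω * g (W n γ ω) -
        1 / r * ((∑ i, ((ω i : ℝ) - condMean n β K i ω)) * g (W n γ ω)) =
        (drift n β K γ ω - (∑ i, ((ω i : ℝ) - condMean n β K i ω)) / r) * g (W n γ ω) by ring,
      abs_mul]
    gcongr
  -- Linearising the increment of `g`, the product ω_i · ω_i/s produces the main term, since rs = n.
  -- Two errors remain. The Taylor remainder, with |ω_i - m_i| ≤ 2 and n summands of size R/s
  -- divided by r, gives 2R. The conditional means, of size 4(|S| + 1)/n, multiply the linear part.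
  · have e2 : 1 / r * (∑ i, ((ω i : ℝ) - condMean n β K i ω) *
          (g (W n γ ω) - g (W n γ (Function.update ω i 0)))) -
            (∑ i, (ω i : ℝ) ^ 2) / n * d (W n γ ω) = 1 / r * ∑ i,
        (((ω i : ℝ) - condMean n β K i ω) * (g (W n γ ω) - g (W n γ ω - (ω i : ℝ) / s) -
          (ω i : ℝ) / s * d (W n γ ω)) - condMean n β K i ω * ((ω i : ℝ) / s * d (W n γ ω))) := by
      have : (∑ i, (ω i : ℝ) ^ 2) / n * d (W n γ ω) =
          1 / r * ∑ i, (ω i : ℝ) * ((ω i : ℝ) / s * d (W n γ ω)) := by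
        rw [← rsn, Finset.sum_div, Finset.sum_mul, Finset.mul_sum]
        refine Finset.sum_congr rfl fun i _ => ?_
        field_simp
      rw [this, ← mul_sub, ← Finset.sum_sub_distrib]
      congr 1
      refine Finset.sum_congr rfl fun i _ => ?_
      rw [W_update]; ring
    have hterm : ∀ i : Fin n, |((ω i : ℝ) - condMean n β K i ω) *
        (g (W n γ ω) - g (W n γ ω - (ω i : ℝ) / s) - (ω i : ℝ) / s * d (W n γ ω)) -
          condMean n β K i ω * ((ω i : ℝ) / s * d (W n γ ω))| ≤
        2 * (R ω / s) + 4 * (|totalSpin ω| + 1) / n * (1 / s * |d (W n γ ω)|) := by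
      intro i
      have hv : |(ω i : ℝ) / s| ≤ 1 / s := by
        rw [abs_div, abs_of_pos s0]; gcongr; exact abs_spin_le_one _
      have hb : |(ω i : ℝ) - condMean n β K i ω| ≤ 2 := by
        refine (abs_sub _ _).trans ?_
        have := abs_spinMean_le_one (siteParam_pos n β K) (2 * β * K * (spinWithout i ω / n))
        rw [condMean]
        linarith [abs_spin_le_one (ω i)]
      have := hR ω _ hv
      refine (abs_sub _ _).trans (add_le_add ?_ ?_)
      · rw [abs_mul]; gcongr
      · rw [abs_mul, abs_mul]
        gcongr
        exact h.abs_condMean_le i ω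
    rw [e2, abs_mul, abs_of_pos (show 0 < 1 / r by positivity)]
    calc _ ≤ 1 / r * ∑ i : Fin n, (2 * (R ω / s) +
          4 * (|totalSpin ω| + 1) / n * (1 / s * |d (W n γ ω)|)) := by
          gcongr
          exact (Finset.abs_sum_le_sum_abs _ _).trans (Finset.sum_le_sum fun i _ => hterm i)
      _ = 2 * R ω + 4 * (|W n γ ω| + 1 / s) / r * |d (W n γ ω)| := by
          rw [Finset.sum_const, Finset.card_univ, Fintype.card_fin, nsmul_eq_mul, h.abs_W_mul,
            ← hs, ← rsn]
          field_simp
      _ ≤ _ := by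
          gcongr
          rw [div_le_one s0]; linarith

end Regime

/-! ### Sixth moments, and the law of large numbers for Σω_i² -/

/-- Either y ≤ M/c or M ≤ cy: the fifth power is absorbed by any small multiple of the sixth. -/
lemma pow_five_le {c M y : ℝ} (hc : 0 < c) (hM : 0 ≤ M) (hy : 0 ≤ y) :
    M * y ^ 5 ≤ c * y ^ 6 + M * (M / c) ^ 5 := by
  rcases le_total y (M / c) with h | h
  · have : M * y ^ 5 ≤ M * (M / c) ^ 5 := by gcongr
    have : 0 ≤ c * y ^ 6 := by positivity
    linarith
  · have h1 : M ≤ c * y := by rwa [div_le_iff₀' hc] at h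
    have : M * y ^ 5 ≤ c * y * y ^ 5 := by gcongr
    have : 0 ≤ M * (M / c) ^ 5 := by positivity
    nlinarith

lemma pow_le_one_add_pow {y : ℝ} (hy : 0 ≤ y) {j k : ℕ} (hjk : j ≤ k) : y ^ j ≤ 1 + y ^ k := by
  rcases le_total y 1 with h | h
  · have := pow_le_one₀ hy h (n := j)
    have := pow_nonneg hy k
    linarith
  · have := pow_le_pow_right₀ h hjk
    linarith

namespace Regime
variable {n : ℕ} {β K γ : ℝ}

lemma sum_sq_div_le (h : Regime n β K γ) (ω : Config n) : (∑ i, (ω i : ℝ) ^ 2) / n ≤ 1 := by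
  rw [div_le_one h.cast_pos]
  refine (Finset.sum_le_sum fun i _ => spin_sq_le_one (ω i)).trans ?_
  simp

/-- Stein's identity with g(w) = w⁵. Every term other than the drift grows at most like |W|⁵ and is
absorbed into half of κ E W⁶. -/
lemma moment_six_le (h : Regime n β K γ) {κ C : ℝ} (hκ : 0 < κ)
    (hD : ∀ ω, κ * W n γ ω ^ 6 - C ≤ drift n β K γ ω * W n γ ω ^ 5) :
    avg n β K (fun ω => W n γ ω ^ 6) ≤ 2 / κ * (C + 129 + 109 * (109 / (κ / 2)) ^ 5) := by
  set s := (n : ℝ) ^ (1 - γ) with hs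
  have r1 : 1 ≤ (n : ℝ) ^ γ := h.one_le_rpow
  have s1 : 1 ≤ s := r1.trans h.rpow_le
  have hR : ∀ (ω : Config n) v, |v| ≤ 1 / s →
      |W n γ ω ^ 5 - (W n γ ω - v) ^ 5 - v * (5 * W n γ ω ^ 4)| ≤
        (26 * (1 + |W n γ ω| ^ 3)) / s := by
    intro ω v hv
    generalize W n γ ω = w
    have hv1 : |v| ≤ 1 := hv.trans (by rw [div_le_one (by linarith)]; exact s1)
    have e : w ^ 5 - (w - v) ^ 5 - v * (5 * w ^ 4) =
        v * (v * (-10 * w ^ 3 + 10 * w ^ 2 * v - 5 * w * v ^ 2 + v ^ 3)) := by ring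
    have hy := abs_nonneg w
    have hb : |-10 * w ^ 3 + 10 * w ^ 2 * v - 5 * w * v ^ 2 + v ^ 3| ≤
        10 * |w| ^ 3 + 10 * |w| ^ 2 * 1 + 5 * |w| * 1 ^ 2 + 1 ^ 3 := by
      refine (abs_add_le _ _).trans (add_le_add ((abs_sub _ _).trans (add_le_add
        ((abs_add_le _ _).trans (add_le_add ?_ ?_)) ?_)) ?_)
      · rw [abs_mul, abs_pow]; norm_num
      · rw [abs_mul, abs_mul, abs_pow, abs_of_pos (show (0 : ℝ) < 10 by norm_num)]; gcongr
      · rw [abs_mul, abs_mul, abs_pow, abs_of_pos (show (0 : ℝ) < 5 by norm_num)]; gcongr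
      · rw [abs_pow]; gcongr
    rw [e, abs_mul, abs_mul]
    have h1 := pow_le_one_add_pow hy (show 2 ≤ 3 by norm_num)
    have h2 := pow_le_one_add_pow hy (show 1 ≤ 3 by norm_num)
    rw [pow_one] at h2
    calc _ ≤ 1 / s * (1 * (26 * (1 + |w| ^ 3))) := by
          gcongr
          refine hb.trans ?_
          nlinarith [pow_nonneg hy 3]
      _ = _ := by ring
  have main := le_of_abs_le (h.stein_identity (fun w => w ^ 5) (fun w => 5 * w ^ 4)
    (fun ω => 26 * (1 + |W n γ ω| ^ 3)) hR)
  have lower := avg_mono (β := β) (K := K) hD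
  -- After lower powers are replaced by 1 + y⁵, the constants add up to 129 and the coefficients of
  -- y⁵ to 109.
  have upper : avg n β K (fun ω => (∑ i, (ω i : ℝ) ^ 2) / n * (5 * W n γ ω ^ 4) +
      (12 / (n : ℝ) ^ γ * |W n γ ω ^ 5| + (2 * (26 * (1 + |W n γ ω| ^ 3)) +
      4 * (|W n γ ω| + 1) / (n : ℝ) ^ γ * |5 * W n γ ω ^ 4|))) ≤
      avg n β K (fun ω => κ / 2 * W n γ ω ^ 6 + (129 + 109 * (109 / (κ / 2)) ^ 5)) := by
    refine avg_mono fun ω => ?_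
    have hQ := h.sum_sq_div_le ω
    generalize (∑ i, (ω i : ℝ) ^ 2) / n = q at *
    have e4 : W n γ ω ^ 4 = |W n γ ω| ^ 4 := (Even.pow_abs (by decide) _).symm
    have e6 : W n γ ω ^ 6 = |W n γ ω| ^ 6 := (Even.pow_abs (by decide) _).symm
    rw [e6, abs_mul, abs_pow, abs_pow, e4, abs_of_pos (show (0 : ℝ) < 5 by norm_num)]
    have hy := abs_nonneg (W n γ ω)
    generalize |W n γ ω| = y at *
    have h1 := pow_le_one_add_pow hy (show 4 ≤ 5 by norm_num)
    have h2 := pow_le_one_add_pow hy (show 3 ≤ 5 by norm_num)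
    have h3 := pow_five_le (half_pos hκ) (show (0 : ℝ) ≤ 109 by norm_num) hy
    calc _ ≤ 1 * (5 * y ^ 4) + (12 / 1 * y ^ 5 + (2 * (26 * (1 + y ^ 3)) +
          4 * (y + 1) / 1 * (5 * y ^ 4))) := by gcongr
      _ ≤ _ := by nlinarith
  rw [avg_sub, avg_const_mul, avg_const] at lower
  rw [avg_add (fun ω => (∑ i, (ω i : ℝ) ^ 2) / n * (5 * W n γ ω ^ 4)),
    avg_add (fun ω => κ / 2 * W n γ ω ^ 6), avg_const_mul (κ / 2), avg_const] at upper
  have : κ / 2 * avg n β K (fun ω => W n γ ω ^ 6) ≤ C + 129 + 109 * (109 / (κ / 2)) ^ 5 := by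
    linarith
  rw [div_mul_eq_mul_div, le_div_iff₀ hκ]
  linarith

lemma avg_le_of_moment_six {M c : ℝ} (hM : avg n β K (fun ω => W n γ ω ^ 6) ≤ M) (hc : 0 ≤ c)
    {f : Config n → ℝ} (hf : ∀ ω, f ω ≤ c * (1 + W n γ ω ^ 6)) :
    avg n β K f ≤ c * (1 + M) := by
  refine (avg_mono hf).trans ?_
  rw [avg_const_mul, avg_add, avg_const]
  gcongr

lemma abs_pow_le_moment (w : ℝ) {j : ℕ} (hj : j ≤ 6) : |w| ^ j ≤ 1 + w ^ 6 := by
  rw [← Even.pow_abs (show Even 6 by decide) w]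
  exact pow_le_one_add_pow (abs_nonneg w) hj

/-- The conditioning identity is applied to α = Σω_i²/n - p itself. Zeroing a spin changes α by at
most 1/n, so fluctuations contribute O(1/n) to E α²; the conditional second moments are within O((1
+ |W|) n^{-γ}) of p. -/
lemma avg_abs_sum_sq_sub_le (h : Regime n β K γ) {M : ℝ}
    (hM : avg n β K (fun ω => W n γ ω ^ 6) ≤ M) :
    avg n β K (fun ω => |(∑ i, (ω i : ℝ) ^ 2) / n - spinVar β|) ≤
      (2 + 300 * (1 + M)) / (n : ℝ) ^ γ := by
  set r := (n : ℝ) ^ γ with hr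
  set s := (n : ℝ) ^ (1 - γ) with hs
  have hn := h.cast_pos
  have r1 : 1 ≤ r := h.one_le_rpow
  have rs : r ≤ s := h.rpow_le
  have rsn : r * s = n := h.rpow_mul
  have r0 : 0 < r := by linarith
  have s0 : 0 < s := by linarith
  set α : Config n → ℝ := fun ω => (∑ i, (ω i : ℝ) ^ 2) / n - spinVar β with hα
  have hdiff : ∀ (ω : Config n) i, α ω - α (Function.update ω i 0) = (ω i : ℝ) ^ 2 / n := by
    intro ω i
    have := sum_sq_update i ω (ω i)
    rw [Function.update_eq_self] at this
    simp only [hα]; rw [this]; ring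
  have e := avg_sum_spinSq_mul β K α
  have h1 : avg n β K (fun ω => (∑ i, ((ω i : ℝ) ^ 2 - condSq n β K i ω)) * α ω) ≤ 1 := by
    rw [e]
    refine (avg_mono (g := fun _ => 1) fun ω => ?_).trans (avg_const _).le
    calc _ ≤ ∑ i : Fin n, (1 / n : ℝ) := by
          refine Finset.sum_le_sum fun i _ => ?_
          rw [hdiff, ← mul_div_assoc]
          gcongr
          have q0 := spinSq_nonneg (siteParam_pos n β K) (2 * β * K * (spinWithout i ω / n))
          have := spin_sq_le_one (ω i)
          rw [condSq]
          nlinarith [sq_nonneg (ω i : ℝ)]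
      _ = 1 := by simp; field_simp
  have h2 : ∀ ω : Config n, n * α ω ^ 2 ≤
      (∑ i, ((ω i : ℝ) ^ 2 - condSq n β K i ω)) * α ω +
        n * (α ω ^ 2 / 2 + 288 * (1 + W n γ ω ^ 6) / r ^ 2) := by
    intro ω
    have e3 : n * α ω = ∑ i, ((ω i : ℝ) ^ 2 - condSq n β K i ω) +
        ∑ i, (condSq n β K i ω - spinVar β) := by
      rw [← Finset.sum_add_distrib]
      simp [hα]
      field_simp
    have e4 : |∑ i, (condSq n β K i ω - spinVar β)| ≤ n * (12 * (1 + |W n γ ω|) / r) := by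
      refine (Finset.abs_sum_le_sum_abs _ _).trans
        ((Finset.sum_le_sum fun i _ => h.abs_condSq_sub_le i ω).trans ?_)
      rw [Finset.sum_const, Finset.card_univ, Fintype.card_fin, nsmul_eq_mul]
      refine mul_le_mul_of_nonneg_left ?_ hn.le
      rw [h.abs_W_mul, ← hs, div_le_div_iff₀ hn r0, ← rsn]
      have hy := abs_nonneg (W n γ ω)
      have : r * 1 ≤ r * s := by gcongr; linarith
      nlinarith [mul_nonneg hy (mul_pos r0 s0).le]
    have e5 : (∑ i, (condSq n β K i ω - spinVar β)) * α ω ≤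
        n * (12 * (1 + |W n γ ω|) / r) * |α ω| := by
      refine (le_abs_self _).trans ?_
      rw [abs_mul]; gcongr
    have e6 : 12 * (1 + |W n γ ω|) / r * |α ω| ≤
        α ω ^ 2 / 2 + 288 * (1 + W n γ ω ^ 6) / r ^ 2 := by
      have t1 := two_mul_le_add_sq (12 * (1 + |W n γ ω|) / r) (|α ω|)
      rw [sq_abs] at t1
      have t2 : (12 * (1 + |W n γ ω|) / r) ^ 2 ≤ 2 * (288 * (1 + W n γ ω ^ 6) / r ^ 2) := by
        rw [div_pow, ← mul_div_assoc]
        gcongr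
        have u1 := abs_pow_le_moment (W n γ ω) (show 2 ≤ 6 by norm_num)
        nlinarith [sq_nonneg (1 - |W n γ ω|), sq_abs (W n γ ω), pow_nonneg (abs_nonneg (W n γ ω)) 6,
          Even.pow_abs (show Even 6 by decide) (W n γ ω)]
      linarith
    calc n * α ω ^ 2 = (n * α ω) * α ω := by ring
      _ = (∑ i, ((ω i : ℝ) ^ 2 - condSq n β K i ω)) * α ω +
          (∑ i, (condSq n β K i ω - spinVar β)) * α ω := by rw [e3, add_mul]
      _ ≤ _ := by
        have := mul_le_mul_of_nonneg_left e6 hn.le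
        linarith
  have h3 := avg_mono (β := β) (K := K) h2
  rw [avg_add, avg_const_mul, avg_const_mul, avg_add] at h3
  have h4 : avg n β K (fun ω => 288 * (1 + W n γ ω ^ 6) / r ^ 2) ≤ 288 / r ^ 2 * (1 + M) :=
    avg_le_of_moment_six hM (by positivity) fun ω => by
      rw [div_mul_eq_mul_div]
  have h5 : avg n β K (fun ω => α ω ^ 2 / 2) = avg n β K (fun ω => α ω ^ 2) / 2 := by
    rw [← mul_one_div, mul_comm, ← avg_const_mul]; congr 1; funext ω; ring
  have h6 : avg n β K (fun ω => α ω ^ 2) ≤ (2 + 576 * (1 + M)) / r ^ 2 := by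
    have hnr : (1 : ℝ) / n ≤ 1 / r ^ 2 := by
      gcongr
      rw [← rsn]; nlinarith
    have : n * avg n β K (fun ω => α ω ^ 2) ≤ 1 + n * (avg n β K (fun ω => α ω ^ 2) / 2 +
        288 / r ^ 2 * (1 + M)) := by
      rw [h5] at h3
      have := mul_le_mul_of_nonneg_left h4 hn.le
      linarith
    have h7 : avg n β K (fun ω => α ω ^ 2) ≤ 1 / n + (avg n β K (fun ω => α ω ^ 2) / 2 +
        288 / r ^ 2 * (1 + M)) := by
      rw [← mul_le_mul_iff_right₀ hn, mul_add, mul_one_div_cancel hn.ne']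
      exact this
    have : (2 + 576 * (1 + M)) / r ^ 2 = 2 * (1 / r ^ 2 + 288 / r ^ 2 * (1 + M)) := by ring
    rw [this]; linarith
  -- The weighted inequality |α| ≤ (r/2)α² + 1/(2r) converts an L² bound of order r^{-2} into an L¹
  -- bound of order r^{-1}.
  have h8 : avg n β K (fun ω => |α ω|) ≤ avg n β K (fun ω => r / 2 * α ω ^ 2 + 1 / (2 * r)) := by
    refine avg_mono fun ω => ?_
    have : 0 ≤ (r * |α ω| - 1) ^ 2 / (2 * r) := by positivity
    have e : (r * |α ω| - 1) ^ 2 / (2 * r) = r / 2 * |α ω| ^ 2 + 1 / (2 * r) - |α ω| := by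
      field_simp; ring
    rw [e, sq_abs] at this
    linarith
  rw [avg_add, avg_const_mul, avg_const] at h8
  refine h8.trans ?_
  have : r / 2 * avg n β K (fun ω => α ω ^ 2) ≤ r / 2 * ((2 + 576 * (1 + M)) / r ^ 2) := by gcongr
  have h9 : r / 2 * ((2 + 576 * (1 + M)) / r ^ 2) + 1 / (2 * r) = (3 / 2 + 288 * (1 + M)) / r := by
    field_simp; ring
  have hM0 : 0 ≤ M := le_trans (avg_nonneg fun ω => by positivity) hM
  calc _ ≤ (3 / 2 + 288 * (1 + M)) / r := by linarith
    _ ≤ _ := by gcongr <;> norm_num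

end Regime

/-! ### Expansion of the drift, and truncated linear test functions -/

/-- The coefficient of `W` in the expansion of the drift. -/
noncomputable def linCoeff (n : ℕ) (β K γ : ℝ) : ℝ :=
  n / ((n : ℝ) ^ γ) ^ 2 * (1 - spinVar β * (2 * β * K))

/-- The coefficient of `W³` in the expansion of the drift. -/
noncomputable def cubCoeff (n : ℕ) (β K γ : ℝ) : ℝ := n / ((n : ℝ) ^ γ) ^ 4 * coeff2 β K

lemma coeff2_eq {β K : ℝ} (h : 2 * β * K ≠ 0) :
    coeff2 β K = (2 * β * K) ^ 3 * (3 * spinVar β ^ 2 - spinVar β) / 6 := by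
  rw [coeff2, iteratedDeriv_four_G, ← spinVar]
  have : (Nat.factorial 3 : ℝ) = 6 := by norm_num [Nat.factorial]
  rw [this]
  generalize 2 * β * K = L at *
  field_simp

lemma clamp_sub_le {c : ℝ} (hc : 0 < c) (x : ℝ) (a : SignType) :
    |max (-(2 * c)) (min (2 * c) x) - max (-(2 * c)) (min (2 * c) (x - a * c))| ≤ c := by
  rw [abs_le]
  cases a <;> simp only [SignType.zero_eq_zero, SignType.neg_eq_neg_one, SignType.pos_eq_one,
    SignType.coe_zero, SignType.coe_one, SignType.coe_neg_one, max_def, min_def] <;>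
    split_ifs <;> constructor <;> linarith

/-- For |x| ≤ c, neither x nor x - ac is affected by truncation at ±2c, so the increment is exactly
ac. Elsewhere monotonicity of the truncation gives the sign. -/
lemma le_mul_clamp_sub {c : ℝ} (hc : 0 < c) (x : ℝ) (a : SignType) :
    (if |x| ≤ c then 1 else 0) * ((a : ℝ) ^ 2 * c) ≤ (a : ℝ) *
      (max (-(2 * c)) (min (2 * c) x) - max (-(2 * c)) (min (2 * c) (x - a * c))) := by
  by_cases h : |x| ≤ c
  · rw [if_pos h]
    rw [abs_le] at h
    cases a <;> simp only [SignType.zero_eq_zero, SignType.neg_eq_neg_one, SignType.pos_eq_one,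
      SignType.coe_zero, SignType.coe_one, SignType.coe_neg_one, max_def, min_def] <;>
      split_ifs <;> linarith
  · rw [if_neg h]
    clear h
    cases a <;> simp only [SignType.zero_eq_zero, SignType.neg_eq_neg_one, SignType.pos_eq_one,
      SignType.coe_zero, SignType.coe_one, SignType.coe_neg_one, max_def, min_def] <;>
      split_ifs <;> linarith

/-- The properties of a solution `g` of Stein's equation, with "derivative" `d` jumping at `z`, that
are used in the normal and quartic approximations. -/
structure SteinPair (B z : ℝ) (g d : ℝ → ℝ) : Prop where
  bound : ∀ w, |g w| ≤ B
  deriv_bound : ∀ w, |d w| ≤ B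
  taylor : ∀ w v, |v| ≤ 1 → |g w - g (w - v) - v * d w| ≤
    B * |v| * (|v| * (1 + |w| ^ 3) + if |w - z| ≤ |v| then 1 else 0)

namespace Regime
variable {n : ℕ} {β K γ : ℝ}

lemma abs_coeff2_le (h : Regime n β K γ) : |coeff2 β K| ≤ 64 := by
  have h1 := h.one_le_field
  have h4 := h.field_le
  rw [coeff2_eq (by linarith)]
  have p0 := spinVar_pos β
  have p1 := spinVar_le_one β
  generalize 2 * β * K = L at *
  generalize spinVar β = p at *
  have hp : |3 * p ^ 2 - p| ≤ 3 := abs_le.2 ⟨by nlinarith, by nlinarith⟩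
  rw [abs_div, abs_mul, abs_of_pos (show 0 < L ^ 3 by positivity), abs_of_pos (show (0 : ℝ) < 6 by
    norm_num)]
  calc L ^ 3 * |3 * p ^ 2 - p| / 6 ≤ 4 ^ 3 * 3 / 6 := by gcongr
    _ ≤ 64 := by norm_num

lemma abs_cubCoeff_le (h : Regime n β K γ) : |cubCoeff n β K γ| ≤ 64 := by
  have hr : 0 < (n : ℝ) ^ γ := by linarith [h.one_le_rpow]
  rw [cubCoeff, abs_mul, abs_of_nonneg (by positivity)]
  have : (n : ℝ) / ((n : ℝ) ^ γ) ^ 4 ≤ 1 := by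
    rw [div_le_one (by positivity)]; exact h.le_rpow_pow
  calc _ ≤ 1 * (64 : ℝ) := by gcongr; exact h.abs_coeff2_le
    _ = 64 := one_mul _

lemma totalSpin_div (h : Regime n β K γ) (ω : Config n) :
    totalSpin ω / n = W n γ ω / (n : ℝ) ^ γ := by
  have hr : 0 < (n : ℝ) ^ γ := by linarith [h.one_le_rpow]
  have hs : 0 < (n : ℝ) ^ (1 - γ) := by linarith [h.one_le_rpow, h.rpow_le]
  have e := h.rpow_mul
  rw [W]
  nth_rewrite 1 [← e]
  field_simp

lemma drift_eq (h : Regime n β K γ) (ω : Config n) : drift n β K γ ω = n / (n : ℝ) ^ γ *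
    (W n γ ω / (n : ℝ) ^ γ - spinMean (Real.exp β) (2 * β * K * (W n γ ω / (n : ℝ) ^ γ))) := by
  have := h.cast_pos
  rw [drift, ← h.totalSpin_div]
  field_simp

/-- The drift is n/r times the nonlinear defect at W/r. The constant 51200 is 200 · 4⁴, with 2βK ≤
4, and the factor n/r⁴ ≤ 1 uses γ ≥ 1/4. -/
lemma drift_taylor (h : Regime n β K γ) (ω : Config n) :
    |drift n β K γ ω - (linCoeff n β K γ * W n γ ω + cubCoeff n β K γ * W n γ ω ^ 3)| ≤
      51200 / (n : ℝ) ^ γ * W n γ ω ^ 4 := by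
  have r0 : 0 < (n : ℝ) ^ γ := by linarith [h.one_le_rpow]
  have hnr := h.le_rpow_pow
  have hn := h.cast_pos
  have hL := h.field_le
  have hL1 := h.one_le_field
  rw [h.drift_eq, linCoeff, cubCoeff, coeff2_eq (by linarith)]
  have key := spinMean_taylor (Real.exp_pos β) (2 * β * K * (W n γ ω / (n : ℝ) ^ γ))
  rw [← spinVar] at key
  generalize spinMean (Real.exp β) (2 * β * K * (W n γ ω / (n : ℝ) ^ γ)) = φ at *
  generalize 2 * β * K = L at *
  generalize spinVar β = p at *
  generalize W n γ ω = w at *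
  generalize (n : ℝ) ^ γ = r at *
  rw [show n / r * (w / r - φ) - (n / r ^ 2 * (1 - p * L) * w + n / r ^ 4 *
    (L ^ 3 * (3 * p ^ 2 - p) / 6) * w ^ 3) = -(n / r) * (φ - p * (L * (w / r)) -
      (p - 3 * p ^ 2) / 6 * (L * (w / r)) ^ 3) by field_simp; ring, abs_mul, abs_neg,
    abs_of_nonneg (by positivity)]
  calc _ ≤ n / r * (200 * (L * (w / r)) ^ 4) := by gcongr
    _ = n / r ^ 4 * L ^ 4 * (200 / r * w ^ 4) := by field_simp
    _ ≤ 1 * 4 ^ 4 * (200 / r * w ^ 4) := by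
        gcongr
        rw [div_le_one (by positivity)]; exact hnr
    _ = _ := by ring

lemma abs_drift_le (h : Regime n β K γ) {Θ : ℝ} (hΘ : |linCoeff n β K γ| ≤ Θ) (ω : Config n) :
    |drift n β K γ ω| ≤ (Θ + 51264) * (1 + W n γ ω ^ 6) := by
  have h1 := h.drift_taylor ω
  have h2 := h.abs_cubCoeff_le
  have r1 := h.one_le_rpow
  have p1 := abs_pow_le_moment (W n γ ω) (show 1 ≤ 6 by norm_num)
  have p3 := abs_pow_le_moment (W n γ ω) (show 3 ≤ 6 by norm_num)
  have p4 := abs_pow_le_moment (W n γ ω) (show 4 ≤ 6 by norm_num)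
  rw [Even.pow_abs (by decide)] at p4
  rw [pow_one] at p1
  have hΘ0 : 0 ≤ Θ := (abs_nonneg _).trans hΘ
  calc |drift n β K γ ω| ≤ 51200 / (n : ℝ) ^ γ * W n γ ω ^ 4 +
        |linCoeff n β K γ * W n γ ω + cubCoeff n β K γ * W n γ ω ^ 3| := by
        have := abs_sub_abs_le_abs_sub (drift n β K γ ω)
          (linCoeff n β K γ * W n γ ω + cubCoeff n β K γ * W n γ ω ^ 3)
        linarith
    _ ≤ 51200 / 1 * W n γ ω ^ 4 + (Θ * |W n γ ω| + 64 * |W n γ ω| ^ 3) := by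
        gcongr
        refine (abs_add_le _ _).trans (add_le_add ?_ ?_)
        · rw [abs_mul]; gcongr
        · rw [abs_mul, abs_pow]; gcongr
    _ ≤ 51200 / 1 * (1 + W n γ ω ^ 6) + (Θ * (1 + W n γ ω ^ 6) + 64 * (1 + W n γ ω ^ 6)) := by
        gcongr
    _ = _ := by ring

lemma exists_drift_mul_pow_five_ge {a₁ : ℝ} (ha₁ : a₁ < 4) : ∃ c > 0, ∀ {n : ℕ} {β K γ : ℝ},
    Regime n β K γ → Real.exp β ≤ a₁ → ∀ ω : Config n,
      linCoeff n β K γ * W n γ ω ^ 6 + c * (n / ((n : ℝ) ^ γ) ^ 4) * W n γ ω ^ 8 ≤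
        drift n β K γ ω * W n γ ω ^ 5 := by
  obtain ⟨c, hc, key⟩ := drift_mul_pow_five_ge ha₁
  refine ⟨c, hc, fun {n β K γ} h ha ω => ?_⟩
  have r0 : 0 < (n : ℝ) ^ γ := by linarith [h.one_le_rpow]
  have hn := h.cast_pos
  have hx : |W n γ ω / (n : ℝ) ^ γ| ≤ 1 := by
    rw [← h.totalSpin_div, abs_div, abs_of_pos hn, div_le_one hn]
    exact abs_totalSpin_le ω
  have := key _ (Real.exp_pos β) ha _ h.one_le_field h.field_le _ hx
  rw [← spinVar] at this
  rw [h.drift_eq, linCoeff]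
  generalize spinMean (Real.exp β) (2 * β * K * (W n γ ω / (n : ℝ) ^ γ)) = φ at *
  generalize (n : ℝ) ^ γ = r at *
  generalize W n γ ω = w at *
  have e := mul_le_mul_of_nonneg_left this (show 0 ≤ n * r ^ 4 by positivity)
  calc _ = n * r ^ 4 * ((1 - spinVar β * (2 * β * K)) * (w / r) ^ 6 + c * (w / r) ^ 8) := by
        field_simp
    _ ≤ _ := e
    _ = _ := by field_simp

/-! ### Local concentration and the approximate Stein identity -/

/-- Concentration of the rescaled spin at the scale of its increments. -/
lemma avg_near_le (h : Regime n β K γ) {M Θ : ℝ} (hM : avg n β K (fun ω => W n γ ω ^ 6) ≤ M)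
    (hΘ : |linCoeff n β K γ| ≤ Θ) (z : ℝ) :
    spinVar β * avg n β K (fun ω => if |W n γ ω - z| ≤ 1 / (n : ℝ) ^ (1 - γ) then 1 else 0) ≤
      (200000 + 2 * Θ) * (2 + M) / (n : ℝ) ^ γ := by
  set r := (n : ℝ) ^ γ with hr
  set s := (n : ℝ) ^ (1 - γ) with hs
  have hn := h.cast_pos
  have r1 : 1 ≤ r := h.one_le_rpow
  have rs : r ≤ s := h.rpow_le
  have rsn : r * s = n := h.rpow_mul
  have r0 : 0 < r := by linarith
  have s0 : 0 < s := by linarith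
  have c0 : 0 < 1 / s := by positivity
  have hΘ0 : 0 ≤ Θ := (abs_nonneg _).trans hΘ
  have hM0 : 0 ≤ M := le_trans (avg_nonneg fun ω => by positivity) hM
  set I : Config n → ℝ := fun ω => if |W n γ ω - z| ≤ 1 / s then 1 else 0 with hI
  have I0 : ∀ ω, 0 ≤ I ω := fun ω => by simp only [hI]; split_ifs <;> norm_num
  have I1 : ∀ ω, I ω ≤ 1 := fun ω => by simp only [hI]; split_ifs <;> norm_num
  -- Linear near z and truncated at height 2/s: the function is only O(1/s), yet it registers in
  -- full every spin flip that starts within 1/s of z.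
  set g : ℝ → ℝ := fun w => max (-(2 * (1 / s))) (min (2 * (1 / s)) (w - z)) with hg
  have gb : ∀ w, |g w| ≤ 2 * (1 / s) := fun w => abs_le.2
    ⟨le_max_left _ _, max_le (by linarith) (min_le_left _ _)⟩
  have e := avg_sum_spin_mul β K (fun ω : Config n => g (W n γ ω))
  have upper : ∀ ω : Config n, (∑ i, ((ω i : ℝ) - condMean n β K i ω)) * g (W n γ ω) ≤
      2 * ((Θ + 51264) * (1 + W n γ ω ^ 6) + 12) := by
    intro ω
    have h1 := h.abs_sum_sub_drift_le ω
    have h2 := h.abs_drift_le hΘ ω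
    set σ := ∑ i, ((ω i : ℝ) - condMean n β K i ω)
    have h3 : |σ / r| ≤ (Θ + 51264) * (1 + W n γ ω ^ 6) + 12 := by
      have h4 : 12 / r ≤ 12 := div_le_self (by norm_num) r1
      have := abs_sub_abs_le_abs_sub (σ / r) (drift n β K γ ω)
      rw [abs_sub_comm] at this
      linarith
    rw [abs_div, abs_of_pos r0] at h3
    refine (le_abs_self _).trans ?_
    rw [abs_mul]
    have h5 : r / s ≤ 1 := (div_le_one s0).2 rs
    have h6 : 0 ≤ |σ| / r := by positivity
    calc |σ| * |g (W n γ ω)| ≤ |σ| * (2 * (1 / s)) := by gcongr; exact gb _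
      _ = 2 * (|σ| / r) * (r / s) := by field_simp
      _ ≤ 2 * (|σ| / r) * 1 := by gcongr
      _ ≤ _ := by linarith
  -- Near z the increments sum to r · Σω_i²/n. The other side of the identity is O(1 + W⁶), because
  -- its factors are of order r and 1/s with r ≤ s. Comparing the two gains the factor 1/r.
  have lower : ∀ ω : Config n, r * (I ω * ((∑ i, (ω i : ℝ) ^ 2) / n)) - 4 * (|W n γ ω| + 1) ≤
      ∑ i, ((ω i : ℝ) - condMean n β K i ω) *
        (g (W n γ ω) - g (W n γ (Function.update ω i 0))) := by
    intro ω
    calc _ ≤ ∑ i, (I ω * ((ω i : ℝ) ^ 2 * (1 / s)) -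
          4 * (|totalSpin ω| + 1) / n * (1 / s)) := by
          rw [Finset.sum_sub_distrib, Finset.sum_const, Finset.card_univ, Fintype.card_fin,
            nsmul_eq_mul, h.abs_W_mul, ← hs, ← Finset.mul_sum, ← Finset.sum_mul, ← rsn]
          have : 1 / s ≤ 1 := by rw [div_le_one s0]; linarith
          have e1 : r * s * (4 * (|W n γ ω| * s + 1) / (r * s) * (1 / s)) =
            4 * (|W n γ ω| + 1 / s) := by field_simp
          have e2 : r * (I ω * ((∑ i, (ω i : ℝ) ^ 2) / (r * s))) =
            I ω * ((∑ i, (ω i : ℝ) ^ 2) * (1 / s)) := by field_simp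
          rw [e1, e2]
          linarith
      _ ≤ _ := by
          refine Finset.sum_le_sum fun i _ => ?_
          have e1 : g (W n γ (Function.update ω i 0)) =
              max (-(2 * (1 / s))) (min (2 * (1 / s)) (W n γ ω - z - ω i * (1 / s))) := by
            rw [W_update]; simp only [hg]; congr 2; ring
          have h1 := le_mul_clamp_sub c0 (W n γ ω - z) (ω i)
          have h2 := clamp_sub_le c0 (W n γ ω - z) (ω i)
          rw [← e1] at h1 h2
          have h3 := mul_le_mul (h.abs_condMean_le i ω) h2 (abs_nonneg _) (by positivity)
          rw [← abs_mul] at h3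
          have h4 := le_of_abs_le h3
          rw [sub_mul]
          exact sub_le_sub h1 h4
  have h1 := avg_mono (β := β) (K := K) lower
  have h2 := avg_mono (β := β) (K := K) upper
  rw [e] at h2
  rw [avg_sub, avg_const_mul] at h1
  have h3 : avg n β K (fun ω => 4 * (|W n γ ω| + 1)) ≤ 8 * (1 + M) :=
    avg_le_of_moment_six hM (by norm_num) fun ω => by
      have := abs_pow_le_moment (W n γ ω) (show 1 ≤ 6 by norm_num)
      have : 0 ≤ W n γ ω ^ 6 := by positivity
      linarith
  have h4 : avg n β K (fun ω => 2 * ((Θ + 51264) * (1 + W n γ ω ^ 6) + 12)) ≤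
      (2 * (Θ + 51264) + 24) * (1 + M) :=
    avg_le_of_moment_six hM (by positivity) fun ω => by
      have : 0 ≤ W n γ ω ^ 6 := by positivity
      nlinarith
  have h5 : avg n β K (fun ω => I ω * ((∑ i, (ω i : ℝ) ^ 2) / n)) ≤
      (2 * (Θ + 51264) + 32) * (1 + M) / r := by
    rw [le_div_iff₀' r0]; linarith
  have h6 := h.avg_abs_sum_sq_sub_le hM
  have h7 : spinVar β * avg n β K I ≤ avg n β K (fun ω => I ω * ((∑ i, (ω i : ℝ) ^ 2) / n) +
      |(∑ i, (ω i : ℝ) ^ 2) / n - spinVar β|) := by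
    rw [← avg_const_mul]
    refine avg_mono fun ω => ?_
    have := neg_le_abs ((∑ i, (ω i : ℝ) ^ 2) / n - spinVar β)
    have h8 := I0 ω
    have h9 := I1 ω
    have := abs_nonneg ((∑ i, (ω i : ℝ) ^ 2) / n - spinVar β)
    nlinarith
  rw [avg_add] at h7
  refine h7.trans ((add_le_add h5 h6).trans ?_)
  rw [← hr, ← add_div]
  gcongr
  nlinarith

/-- Stein's identity with the drift replaced by its expansion, against bounded test functions. -/
lemma abs_stein_sub_le (h : Regime n β K γ) {M Θ B z : ℝ}
    (hM : avg n β K (fun ω => W n γ ω ^ 6) ≤ M) (hΘ : |linCoeff n β K γ| ≤ Θ) {g d : ℝ → ℝ}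
    (hg : SteinPair B z g d) :
    |avg n β K (fun ω => (linCoeff n β K γ * W n γ ω + cubCoeff n β K γ * W n γ ω ^ 3) *
        g (W n γ ω)) - spinVar β * avg n β K (fun ω => d (W n γ ω))| ≤
      (1000000 + 4 * Θ) * (B * (2 + M) / spinVar β) / (n : ℝ) ^ γ := by
  set r := (n : ℝ) ^ γ with hr
  set s := (n : ℝ) ^ (1 - γ) with hs
  have r1 : 1 ≤ r := h.one_le_rpow
  have rs : r ≤ s := h.rpow_le
  have r0 : 0 < r := by linarith
  have s0 : 0 < s := by linarith
  have hΘ0 : 0 ≤ Θ := (abs_nonneg _).trans hΘ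
  have hM0 : 0 ≤ M := le_trans (avg_nonneg fun ω => by positivity) hM
  have hB : 0 ≤ B := (abs_nonneg _).trans (hg.bound 0)
  have p0 := spinVar_pos β
  have p1 := spinVar_le_one β
  set I : Config n → ℝ := fun ω => if |W n γ ω - z| ≤ 1 / s then 1 else 0 with hI
  have near := h.avg_near_le hM hΘ z
  -- Increments are at most 1/s ≤ 1/r, so the indicator in the Taylor bound is dominated by `I`,
  -- whose mean is O(1/r) by local concentration.
  have h1 := h.stein_identity g d (fun ω => B * (1 / r * (1 + |W n γ ω| ^ 3) + I ω))
    (fun ω v hv => by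
      refine (hg.taylor (W n γ ω) v (hv.trans ?_)).trans ?_
      · rw [div_le_one s0]; linarith
      · have : (if |W n γ ω - z| ≤ |v| then (1 : ℝ) else 0) ≤ I ω := by
          simp only [hI]
          split_ifs with h1 h2 <;> first | exact absurd (h1.trans hv) h2 | norm_num
        have h2 : |v| ≤ 1 / r := hv.trans (by gcongr)
        calc _ ≤ B * (1 / s) * (1 / r * (1 + |W n γ ω| ^ 3) + I ω) := by gcongr
          _ = _ := by rw [hs]; ring)
  have h2 : |avg n β K (fun ω => (∑ i, (ω i : ℝ) ^ 2) / n * d (W n γ ω)) -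
      spinVar β * avg n β K (fun ω => d (W n γ ω))| ≤ B * ((2 + 300 * (1 + M)) / r) := by
    rw [← avg_const_mul, ← avg_sub]
    refine (abs_avg_le (g := fun ω => B * |(∑ i, (ω i : ℝ) ^ 2) / n - spinVar β|)
      fun ω => ?_).trans ?_
    · rw [← sub_mul, abs_mul, mul_comm]
      gcongr
      exact hg.deriv_bound _
    · rw [avg_const_mul]
      gcongr
      exact h.avg_abs_sum_sq_sub_le hM
  have h3 : |avg n β K (fun ω => (linCoeff n β K γ * W n γ ω + cubCoeff n β K γ * W n γ ω ^ 3) *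
      g (W n γ ω)) - avg n β K (fun ω => drift n β K γ ω * g (W n γ ω))| ≤
      51200 / r * B * (1 + M) := by
    rw [← avg_sub]
    refine (abs_avg_le (g := fun ω => 51200 / r * W n γ ω ^ 4 * B) fun ω => ?_).trans
      (avg_le_of_moment_six hM (by positivity) fun ω => ?_)
    · rw [← sub_mul, abs_mul, abs_sub_comm]
      gcongr
      · exact h.drift_taylor ω
      · exact hg.bound _
    · have := abs_pow_le_moment (W n γ ω) (show 4 ≤ 6 by norm_num)
      rw [Even.pow_abs (by decide)] at this
      calc _ ≤ 51200 / r * (1 + W n γ ω ^ 6) * B := by gcongr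
        _ = _ := by ring
  have h4 : avg n β K (fun ω => 12 / r * |g (W n γ ω)| + (2 * (B * (1 / r * (1 + |W n γ ω| ^ 3) +
      I ω)) + 4 * (|W n γ ω| + 1) / r * |d (W n γ ω)|)) ≤
      B * 24 / r * (1 + M) + 2 * B * avg n β K I := by
    have : ∀ ω, 12 / r * |g (W n γ ω)| + (2 * (B * (1 / r * (1 + |W n γ ω| ^ 3) +
        I ω)) + 4 * (|W n γ ω| + 1) / r * |d (W n γ ω)|) ≤
        B * 24 / r * (1 + W n γ ω ^ 6) + 2 * B * I ω := by
      intro ω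
      have q1 := abs_pow_le_moment (W n γ ω) (show 1 ≤ 6 by norm_num)
      have q3 := abs_pow_le_moment (W n γ ω) (show 3 ≤ 6 by norm_num)
      have q0 : 0 ≤ W n γ ω ^ 6 := by positivity
      rw [pow_one] at q1
      calc _ ≤ 12 / r * B + (2 * (B * (1 / r * (1 + (1 + W n γ ω ^ 6)) + I ω)) +
            4 * ((1 + W n γ ω ^ 6) + 1) / r * B) := by
            gcongr
            · exact hg.bound _
            · exact hg.deriv_bound _
        _ = B * (24 + 6 * W n γ ω ^ 6) / r + 2 * B * I ω := by ring
        _ ≤ B * (24 + 24 * W n γ ω ^ 6) / r + 2 * B * I ω := by gcongr; norm_num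
        _ = _ := by ring
    refine (avg_mono this).trans ?_
    rw [avg_add, avg_const_mul, avg_const_mul, avg_add, avg_const]
    gcongr
  have h5 : avg n β K I ≤ (200000 + 2 * Θ) * (2 + M) / r / spinVar β := by
    rw [le_div_iff₀' p0]; exact near
  have h6 := abs_sub_le (avg n β K (fun ω => (linCoeff n β K γ * W n γ ω +
      cubCoeff n β K γ * W n γ ω ^ 3) * g (W n γ ω)))
    (avg n β K (fun ω => drift n β K γ ω * g (W n γ ω)))
    (spinVar β * avg n β K (fun ω => d (W n γ ω)))
  have h7 := abs_sub_le (avg n β K (fun ω => drift n β K γ ω * g (W n γ ω)))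
    (avg n β K (fun ω => (∑ i, (ω i : ℝ) ^ 2) / n * d (W n γ ω)))
    (spinVar β * avg n β K (fun ω => d (W n γ ω)))
  have h8 : 2 * B * avg n β K I ≤ 2 * B * ((200000 + 2 * Θ) * (2 + M) / r / spinVar β) := by gcongr
  have h9 : 51200 / r * B * (1 + M) + (B * 24 / r * (1 + M) + B * ((2 + 300 * (1 + M)) / r)) ≤
      60000 * (B * (2 + M) / spinVar β) / r := by
    have : B * (2 + M) ≤ B * (2 + M) / spinVar β := le_div_self (by positivity) p0 p1
    calc _ = (51524 * (B * (1 + M)) + 2 * B) / r := by ring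
      _ ≤ (60000 * (B * (2 + M))) / r := by gcongr; nlinarith
      _ ≤ _ := by gcongr
  calc _ ≤ 60000 * (B * (2 + M) / spinVar β) / r +
        2 * B * ((200000 + 2 * Θ) * (2 + M) / r / spinVar β) := by linarith
    _ = (460000 + 4 * Θ) * (B * (2 + M) / spinVar β) / r := by ring
    _ ≤ _ := by gcongr; norm_num

/-- Stein's identity for the test function `w ↦ w`. -/
lemma abs_moment_identity_le (h : Regime n β K γ) {M : ℝ}
    (hM : avg n β K (fun ω => W n γ ω ^ 6) ≤ M) :
    |linCoeff n β K γ * moment n β K γ 2 + cubCoeff n β K γ * moment n β K γ 4 - spinVar β| ≤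
      60000 * (2 + M) / (n : ℝ) ^ γ := by
  set r := (n : ℝ) ^ γ with hr
  have r1 : 1 ≤ r := h.one_le_rpow
  have r0 : 0 < r := by linarith
  have hM0 : 0 ≤ M := le_trans (avg_nonneg fun ω => by positivity) hM
  have h1 := h.stein_identity (fun w => w) (fun _ => 1) (fun _ => 0) (fun ω v hv => by simp)
  have h2 : |avg n β K (fun ω => (∑ i, (ω i : ℝ) ^ 2) / n * 1) - spinVar β| ≤
      (2 + 300 * (1 + M)) / r := by
    have : avg n β K (fun ω => (∑ i, (ω i : ℝ) ^ 2) / n * 1) - spinVar β =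
        avg n β K (fun ω => (∑ i, (ω i : ℝ) ^ 2) / n - spinVar β) := by
      rw [avg_sub, avg_const]; simp
    rw [this]
    exact (abs_avg_le fun _ => le_rfl).trans (h.avg_abs_sum_sq_sub_le hM)
  have h3 : |linCoeff n β K γ * moment n β K γ 2 + cubCoeff n β K γ * moment n β K γ 4 -
      avg n β K (fun ω => drift n β K γ ω * W n γ ω)| ≤ 51200 / r * (1 + M) := by
    have : linCoeff n β K γ * moment n β K γ 2 + cubCoeff n β K γ * moment n β K γ 4 -
        avg n β K (fun ω => drift n β K γ ω * W n γ ω) = avg n β K (fun ω =>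
        linCoeff n β K γ * W n γ ω ^ 2 + cubCoeff n β K γ * W n γ ω ^ 4 -
          drift n β K γ ω * W n γ ω) := by
      rw [avg_sub, avg_add, avg_const_mul, avg_const_mul]; rfl
    rw [this]
    refine (abs_avg_le (g := fun ω => 51200 / r * |W n γ ω| ^ 5) fun ω => ?_).trans
      (avg_le_of_moment_six hM (by positivity) fun ω => ?_)
    · have := h.drift_taylor ω
      rw [show linCoeff n β K γ * W n γ ω ^ 2 + cubCoeff n β K γ * W n γ ω ^ 4 -
          drift n β K γ ω * W n γ ω = -(drift n β K γ ω - (linCoeff n β K γ * W n γ ω +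
            cubCoeff n β K γ * W n γ ω ^ 3)) * W n γ ω by ring, abs_mul, abs_neg]
      calc _ ≤ 51200 / r * W n γ ω ^ 4 * |W n γ ω| := by gcongr
        _ = _ := by rw [← Even.pow_abs (show Even 4 by decide)]; ring
    · gcongr
      exact abs_pow_le_moment _ (by norm_num)
  have h4 : avg n β K (fun ω => 12 / r * |W n γ ω| + (2 * 0 +
      4 * (|W n γ ω| + 1) / r * |(1 : ℝ)|)) ≤ 20 / r * (1 + M) :=
    avg_le_of_moment_six hM (by positivity) fun ω => by
      have q1 := abs_pow_le_moment (W n γ ω) (show 1 ≤ 6 by norm_num)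
      have q0 : 0 ≤ W n γ ω ^ 6 := by positivity
      rw [pow_one] at q1
      calc _ = (16 * |W n γ ω| + 4) / r := by simp; ring
        _ ≤ (20 * (1 + W n γ ω ^ 6)) / r := by gcongr; linarith
        _ = _ := by ring
  have h6 := abs_sub_le (linCoeff n β K γ * moment n β K γ 2 + cubCoeff n β K γ * moment n β K γ 4)
    (avg n β K (fun ω => drift n β K γ ω * W n γ ω)) (spinVar β)
  have h7 := abs_sub_le (avg n β K (fun ω => drift n β K γ ω * W n γ ω))
    (avg n β K (fun ω => (∑ i, (ω i : ℝ) ^ 2) / n * 1)) (spinVar β)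
  calc _ ≤ 51200 / r * (1 + M) + (20 / r * (1 + M) + (2 + 300 * (1 + M)) / r) := by linarith
    _ = (51520 * (1 + M) + 2) / r := by ring
    _ ≤ _ := by gcongr; linarith

end Regime

/-! ### Stein's equation for an even quartic potential -/

/-- The potential `a₁ x² + a₂ x⁴`. -/
def potential (a₁ a₂ x : ℝ) : ℝ := a₁ * x ^ 2 + a₂ * x ^ 4

/-- The derivative of the potential. -/
def potentialDeriv (a₁ a₂ x : ℝ) : ℝ := 2 * a₁ * x + 4 * a₂ * x ^ 3

/-- Uniform control of the coefficients of a confining even quartic potential. -/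
structure Confining (A D E a₁ a₂ : ℝ) : Prop where
  nonneg : 0 ≤ D
  abs_le : |a₁| ≤ A
  quartic_nonneg : 0 ≤ a₂
  quartic_le : a₂ ≤ A
  deriv_ge : ∀ w, 0 ≤ w → -D ≤ potentialDeriv a₁ a₂ w
  potential_ge : ∀ u, 0 ≤ u → (D + 1) * u - E ≤ potential a₁ a₂ u

/-- The unnormalised density. -/
noncomputable def weight (a₁ a₂ x : ℝ) : ℝ := Real.exp (-potential a₁ a₂ x)

/-- The unnormalised mass to the left of `w`. -/
noncomputable def leftMass (a₁ a₂ w : ℝ) : ℝ := ∫ x in Set.Iic w, weight a₁ a₂ x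

/-- The unnormalised mass to the right of `w`. -/
noncomputable def rightMass (a₁ a₂ w : ℝ) : ℝ := ∫ x in Set.Ioi w, weight a₁ a₂ x

lemma weight_pos (a₁ a₂ x : ℝ) : 0 < weight a₁ a₂ x := Real.exp_pos _

lemma potential_neg (a₁ a₂ x : ℝ) : potential a₁ a₂ (-x) = potential a₁ a₂ x := by
  simp only [potential]; ring

lemma potentialDeriv_neg (a₁ a₂ x : ℝ) : potentialDeriv a₁ a₂ (-x) = -potentialDeriv a₁ a₂ x := by
  simp only [potentialDeriv]; ring

lemma continuous_weight (a₁ a₂ : ℝ) : Continuous (weight a₁ a₂) := by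
  unfold weight potential; fun_prop

lemma hasDerivAt_potential (a₁ a₂ x : ℝ) :
    HasDerivAt (potential a₁ a₂) (potentialDeriv a₁ a₂ x) x :=
  ((((hasDerivAt_id' x).pow 2).const_mul a₁).add
    (((hasDerivAt_id' x).pow 4).const_mul a₂)).congr_deriv (by simp [potentialDeriv]; ring)

lemma hasDerivAt_potentialDeriv (a₁ a₂ x : ℝ) :
    HasDerivAt (potentialDeriv a₁ a₂) (2 * a₁ + 12 * a₂ * x ^ 2) x :=
  (((hasDerivAt_id' x).const_mul (2 * a₁)).add
    (((hasDerivAt_id' x).pow 3).const_mul (4 * a₂))).congr_deriv (by simp; ring)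

lemma leftMass_eq (a₁ a₂ w : ℝ) : leftMass a₁ a₂ w = rightMass a₁ a₂ (-w) := by
  rw [leftMass, rightMass, ← integral_comp_neg_Iic]
  simp only [weight, potential_neg]

namespace Confining
variable {A D E a₁ a₂ : ℝ}

lemma integrable_weight (h : Confining A D E a₁ a₂) : Integrable (weight a₁ a₂) := by
  have hb : ∀ x, 0 ≤ x → weight a₁ a₂ x ≤ Real.exp E * Real.exp (-1 * x) := fun x hx => by
    rw [weight, ← Real.exp_add, Real.exp_le_exp]
    have := h.potential_ge x hx
    have := mul_nonneg h.nonneg hx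
    linarith
  rw [← integrableOn_univ, ← Set.Iic_union_Ioi (a := (0 : ℝ))]
  refine IntegrableOn.union ?_ ?_
  · refine Integrable.mono' ((integrableOn_exp_mul_Iic one_pos 0).const_mul (Real.exp E))
      (continuous_weight _ _).aestronglyMeasurable ?_
    refine (ae_restrict_iff' measurableSet_Iic).2 (.of_forall fun x hx => ?_)
    rw [Real.norm_of_nonneg (weight_pos _ _ _).le]
    have := hb (-x) (by simpa using hx)
    rw [weight, potential_neg] at this
    simpa [weight] using this
  · refine Integrable.mono' ((integrableOn_exp_mul_Ioi (neg_lt_zero.2 one_pos) 0).const_mul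
      (Real.exp E)) (continuous_weight _ _).aestronglyMeasurable ?_
    refine (ae_restrict_iff' measurableSet_Ioi).2 (.of_forall fun x hx => ?_)
    rw [Real.norm_of_nonneg (weight_pos _ _ _).le]
    exact hb x (le_of_lt hx)

lemma leftMass_add_rightMass (h : Confining A D E a₁ a₂) (w : ℝ) :
    leftMass a₁ a₂ w + rightMass a₁ a₂ w = ∫ x, weight a₁ a₂ x :=
  intervalIntegral.integral_Iic_add_Ioi h.integrable_weight.integrableOn
    h.integrable_weight.integrableOn

lemma integral_weight_pos (h : Confining A D E a₁ a₂) : 0 < ∫ x, weight a₁ a₂ x :=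
  integral_exp_pos h.integrable_weight

lemma leftMass_nonneg (w : ℝ) : 0 ≤ leftMass a₁ a₂ w :=
  setIntegral_nonneg measurableSet_Iic fun _ _ => (weight_pos _ _ _).le

lemma rightMass_nonneg (w : ℝ) : 0 ≤ rightMass a₁ a₂ w :=
  setIntegral_nonneg measurableSet_Ioi fun _ _ => (weight_pos _ _ _).le

lemma leftMass_mono (h : Confining A D E a₁ a₂) {w z : ℝ} (hwz : w ≤ z) :
    leftMass a₁ a₂ w ≤ leftMass a₁ a₂ z :=
  setIntegral_mono_set h.integrable_weight.integrableOn
    (.of_forall fun _ => (weight_pos _ _ _).le) (Set.Iic_subset_Iic.2 hwz).eventuallyLE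

lemma rightMass_anti (h : Confining A D E a₁ a₂) {w z : ℝ} (hwz : w ≤ z) :
    rightMass a₁ a₂ z ≤ rightMass a₁ a₂ w := by
  have := h.leftMass_add_rightMass w
  have := h.leftMass_add_rightMass z
  have := h.leftMass_mono hwz
  linarith

lemma hasDerivAt_leftMass (h : Confining A D E a₁ a₂) (w : ℝ) :
    HasDerivAt (leftMass a₁ a₂) (weight a₁ a₂ w) w := by
  have e : leftMass a₁ a₂ = fun w => leftMass a₁ a₂ 0 + ∫ x in (0 : ℝ)..w, weight a₁ a₂ x := by
    funext w
    rw [← intervalIntegral.integral_Iic_sub_Iic h.integrable_weight.integrableOn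
      h.integrable_weight.integrableOn]
    simp [leftMass]
  rw [e]
  exact (intervalIntegral.integral_hasDerivAt_right h.integrable_weight.intervalIntegrable
    ((continuous_weight _ _).stronglyMeasurableAtFilter _ _)
    (continuous_weight _ _).continuousAt).const_add _

lemma hasDerivAt_rightMass (h : Confining A D E a₁ a₂) (w : ℝ) :
    HasDerivAt (rightMass a₁ a₂) (-weight a₁ a₂ w) w := by
  have e : rightMass a₁ a₂ = fun w => (∫ x, weight a₁ a₂ x) - leftMass a₁ a₂ w := by
    funext w
    have := h.leftMass_add_rightMass w
    linarith
  rw [e]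
  exact (h.hasDerivAt_leftMass w).const_sub _

/-- The tail is compared with an exponential of rate κ. -/
lemma rightMass_le (h : Confining A D E a₁ a₂) {w κ : ℝ} (hκ : 0 < κ)
    (hb : ∀ u, 0 ≤ u → κ * u - E ≤ potential a₁ a₂ (w + u) - potential a₁ a₂ w) :
    Real.exp (potential a₁ a₂ w) * rightMass a₁ a₂ w * κ ≤ Real.exp E := by
  have h1 : rightMass a₁ a₂ w ≤ ∫ x in Set.Ioi w,
      Real.exp (E - potential a₁ a₂ w + κ * w) * Real.exp (-κ * x) := by
    refine setIntegral_mono_on h.integrable_weight.integrableOn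
      ((integrableOn_exp_mul_Ioi (neg_lt_zero.2 hκ) w).const_mul _) measurableSet_Ioi fun x hx => ?_
    rw [weight, ← Real.exp_add, Real.exp_le_exp]
    have := hb (x - w) (sub_nonneg.2 (le_of_lt hx))
    rw [add_sub_cancel] at this
    linarith
  rw [integral_const_mul, integral_exp_mul_Ioi (neg_lt_zero.2 hκ)] at h1
  calc _ ≤ Real.exp (potential a₁ a₂ w) * (Real.exp (E - potential a₁ a₂ w + κ * w) *
        (-Real.exp (-κ * w) / -κ)) * κ := by gcongr
    _ = Real.exp (potential a₁ a₂ w) * Real.exp (E - potential a₁ a₂ w + κ * w) *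
        Real.exp (-κ * w) := by field_simp
    _ = Real.exp E := by rw [← Real.exp_add, ← Real.exp_add]; congr 1; ring

/-- The mixed quartic terms 6w²u² + 4wu³ are nonnegative for w, u ≥ 0. No convexity is needed, so a₁
may be negative. -/
lemma potential_add_ge (h : Confining A D E a₁ a₂) {w u : ℝ} (hw : 0 ≤ w) (hu : 0 ≤ u) :
    potentialDeriv a₁ a₂ w * u + potential a₁ a₂ u ≤
      potential a₁ a₂ (w + u) - potential a₁ a₂ w := by
  have := h.quartic_nonneg
  have h1 : 0 ≤ a₂ * (6 * w ^ 2 * u ^ 2 + 4 * w * u ^ 3) := by positivity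
  simp only [potentialDeriv, potential]
  nlinarith

/-- Mills-type bounds for the tails. -/
lemma mills (h : Confining A D E a₁ a₂) {w : ℝ} (hw : 0 ≤ w) :
    Real.exp (potential a₁ a₂ w) * rightMass a₁ a₂ w ≤ (D + 1) * Real.exp E ∧
    |potentialDeriv a₁ a₂ w| * (Real.exp (potential a₁ a₂ w) * rightMass a₁ a₂ w) ≤
      (D + 1) * Real.exp E := by
  have hE := Real.exp_pos E
  have hD := h.nonneg
  have m0 : 0 ≤ Real.exp (potential a₁ a₂ w) * rightMass a₁ a₂ w :=
    mul_nonneg (Real.exp_pos _).le (rightMass_nonneg w)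
  have hd := h.deriv_ge w hw
  -- The slope is at least -D while the potential grows at rate D + 1; the surplus leaves decay rate
  -- 1.
  have h1 := h.rightMass_le (w := w) one_pos fun u hu => by
    have := h.potential_add_ge hw hu
    have := h.potential_ge u hu
    have := mul_le_mul_of_nonneg_right hd hu
    linarith
  rw [mul_one] at h1
  refine ⟨by nlinarith, ?_⟩
  -- A nonpositive slope has modulus at most D; a positive slope can itself be taken as the decay
  -- rate.
  rcases le_or_gt (potentialDeriv a₁ a₂ w) 0 with hn | hp
  · rw [abs_of_nonpos hn]
    exact mul_le_mul (by linarith) h1 m0 (by linarith)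
  · rw [abs_of_pos hp, mul_comm]
    refine (h.rightMass_le hp fun u hu => ?_).trans (by nlinarith)
    have := h.potential_add_ge hw hu
    have := h.potential_ge u hu
    have := mul_nonneg hD hu
    linarith

lemma mills_left (h : Confining A D E a₁ a₂) {w : ℝ} (hw : w ≤ 0) :
    Real.exp (potential a₁ a₂ w) * leftMass a₁ a₂ w ≤ (D + 1) * Real.exp E ∧
    |potentialDeriv a₁ a₂ w| * (Real.exp (potential a₁ a₂ w) * leftMass a₁ a₂ w) ≤
      (D + 1) * Real.exp E := by
  have := h.mills (neg_nonneg.2 hw)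
  rwa [potential_neg, potentialDeriv_neg, abs_neg, ← leftMass_eq] at this

lemma abs_potentialDeriv_le (h : Confining A D E a₁ a₂) (x : ℝ) :
    |potentialDeriv a₁ a₂ x| ≤ 6 * A * (1 + |x|) ^ 3 := by
  have hA : 0 ≤ A := (abs_nonneg _).trans h.abs_le
  have hy := abs_nonneg x
  have h4 : |a₂| ≤ A := by rw [abs_of_nonneg h.quartic_nonneg]; exact h.quartic_le
  calc |potentialDeriv a₁ a₂ x| ≤ 2 * A * |x| + 4 * A * |x| ^ 3 := by
        refine (abs_add_le _ _).trans (add_le_add ?_ ?_)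
        · rw [abs_mul, abs_mul, abs_two]; gcongr; exact h.abs_le
        · rw [abs_mul, abs_mul, abs_pow, abs_of_pos (show (0 : ℝ) < 4 by norm_num)]; gcongr
    _ = A * (2 * |x| + 4 * |x| ^ 3) := by ring
    _ ≤ A * (6 * (1 + |x|) ^ 3) := by
        gcongr
        nlinarith [pow_nonneg hy 3, pow_nonneg hy 2]
    _ = _ := by ring

lemma abs_potentialDeriv_deriv_le (h : Confining A D E a₁ a₂) (x : ℝ) :
    |2 * a₁ + 12 * a₂ * x ^ 2| ≤ 14 * A * (1 + |x|) ^ 3 := by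
  have hA : 0 ≤ A := (abs_nonneg _).trans h.abs_le
  have hy := abs_nonneg x
  have h4 : |a₂| ≤ A := by rw [abs_of_nonneg h.quartic_nonneg]; exact h.quartic_le
  calc |2 * a₁ + 12 * a₂ * x ^ 2| ≤ 2 * A + 12 * A * |x| ^ 2 := by
        refine (abs_add_le _ _).trans (add_le_add ?_ ?_)
        · rw [abs_mul, abs_two]; gcongr; exact h.abs_le
        · rw [abs_mul, abs_mul, abs_pow, abs_of_pos (show (0 : ℝ) < 12 by norm_num)]; gcongr
    _ = A * (2 + 12 * |x| ^ 2) := by ring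
    _ ≤ A * (14 * (1 + |x|) ^ 3) := by
        gcongr
        nlinarith [pow_nonneg hy 3, pow_nonneg hy 2]
    _ = _ := by ring

/-- Regularity of a solution of the first-order equation `g' = U' g + c` on a convex set on which it
is bounded. -/
lemma solution_regularity (h : Confining A D E a₁ a₂) {g : ℝ → ℝ} {c b : ℝ} {s : Set ℝ}
    (hs : Convex ℝ s) (hc : |c| ≤ 1)
    (hg : ∀ x, HasDerivAt g (potentialDeriv a₁ a₂ x * g x + c) x)
    (hb : ∀ x ∈ s, |g x| ≤ b) (hb' : ∀ x ∈ s, |potentialDeriv a₁ a₂ x * g x| ≤ b)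
    {x y : ℝ} (hx : x ∈ s) (hy : y ∈ s) :
    |g x - g y| ≤ (b + 1) * |x - y| ∧ (|x - y| ≤ 1 →
      |g x - g y - (x - y) * (potentialDeriv a₁ a₂ x * g x + c)| ≤
        640 * A * (b + 1) * (1 + |x| ^ 3) * |x - y| * |x - y|) := by
  have hA : 0 ≤ A := (abs_nonneg _).trans h.abs_le
  have b0 : 0 ≤ b := (abs_nonneg _).trans (hb x hx)
  have hd : ∀ u ∈ s, |potentialDeriv a₁ a₂ u * g u + c| ≤ b + 1 := fun u hu =>
    (abs_add_le _ _).trans (add_le_add (hb' u hu) hc)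
  refine ⟨?_, fun hxy => ?_⟩
  · exact hs.norm_image_sub_le_of_norm_hasDerivWithin_le (fun u _ => (hg u).hasDerivWithinAt)
      hd hy hx
  · have hseg : segment ℝ y x ⊆ s := hs.segment_subset hy hx
    have hy' := left_mem_segment ℝ y x
    have hx' := right_mem_segment ℝ y x
    have hcs : Convex ℝ (segment ℝ y x) := convex_segment y x
    have hnear : ∀ u ∈ segment ℝ y x, |u - x| ≤ |x - y| := by
      intro u hu
      rw [segment_eq_uIcc] at hu
      have := Set.abs_sub_right_of_mem_uIcc hu
      rwa [abs_sub_comm u x]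
    set Q := 640 * A * (b + 1) * (1 + |x| ^ 3) with hQ
    -- The second derivative of g is U''g + U'(U'g + c), which grows at most cubically because g and
    -- U'g are bounded. On |v| ≤ |x| + 1 its constant is 640 = (14 + 6) · 32.
    have hd2 : ∀ u ∈ segment ℝ y x, |(potentialDeriv a₁ a₂ u * g u) -
        (potentialDeriv a₁ a₂ x * g x)| ≤ Q * |u - x| := by
      intro u hu
      have hderiv : ∀ v, HasDerivAt (fun v => potentialDeriv a₁ a₂ v * g v)
          ((2 * a₁ + 12 * a₂ * v ^ 2) * g v + potentialDeriv a₁ a₂ v *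
            (potentialDeriv a₁ a₂ v * g v + c)) v := fun v =>
        (hasDerivAt_potentialDeriv a₁ a₂ v).mul (hg v)
      refine hcs.norm_image_sub_le_of_norm_hasDerivWithin_le
        (fun v _ => (hderiv v).hasDerivWithinAt) (fun v hv => ?_) hx' hu
      have hv1 : |v| ≤ |x| + 1 := by
        have h1 := abs_sub_abs_le_abs_sub v x
        have := hnear v hv
        linarith
      have hcube : (1 + |v|) ^ 3 ≤ 32 * (1 + |x| ^ 3) := by
        have hp := abs_nonneg x
        calc (1 + |v|) ^ 3 ≤ (|x| + 2) ^ 3 := by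
              have := abs_nonneg v
              exact pow_le_pow_left₀ (by linarith) (by linarith) 3
          _ ≤ 4 * (|x| ^ 3 + 2 ^ 3) := by
              have := mul_nonneg (show 0 ≤ |x| + 2 by linarith) (sq_nonneg (|x| - 2))
              nlinarith
          _ ≤ _ := by nlinarith [pow_nonneg hp 3]
      calc _ ≤ 14 * A * (1 + |v|) ^ 3 * b + 6 * A * (1 + |v|) ^ 3 * (b + 1) := by
            refine (abs_add_le _ _).trans (add_le_add ?_ ?_)
            · rw [abs_mul]
              gcongr
              · exact h.abs_potentialDeriv_deriv_le v
              · exact hb v (hseg hv)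
            · rw [abs_mul]
              gcongr
              · exact h.abs_potentialDeriv_le v
              · exact hd v (hseg hv)
        _ ≤ 20 * A * (b + 1) * (1 + |v|) ^ 3 := by
            have : 0 ≤ A * (1 + |v|) ^ 3 := by positivity
            nlinarith
        _ ≤ 20 * A * (b + 1) * (32 * (1 + |x| ^ 3)) := by gcongr
        _ = Q := by rw [hQ]; ring
    have hlin : ∀ u, HasDerivAt (fun u => g u - u * (potentialDeriv a₁ a₂ x * g x + c))
        (potentialDeriv a₁ a₂ u * g u - potentialDeriv a₁ a₂ x * g x) u := fun u =>
      ((hg u).sub ((hasDerivAt_id' u).mul_const _)).congr_deriv (by ring)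
    have := hcs.norm_image_sub_le_of_norm_hasDerivWithin_le (C := Q * |x - y|)
      (fun u _ => (hlin u).hasDerivWithinAt)
      (fun u hu => (hd2 u hu).trans (mul_le_mul_of_nonneg_left (hnear u hu)
        (by positivity))) hy' hx'
    rw [Real.norm_eq_abs, Real.norm_eq_abs] at this
    calc _ = |g x - x * (potentialDeriv a₁ a₂ x * g x + c) -
          (g y - y * (potentialDeriv a₁ a₂ x * g x + c))| := by congr 1; ring
      _ ≤ _ := this

end Confining

namespace Confining
variable {A D E a₁ a₂ : ℝ}

lemma lawZ_real_Iic (h : Confining A D E a₁ a₂) (z : ℝ) :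
    (lawZ a₁ a₂).real (Set.Iic z) = leftMass a₁ a₂ z / ∫ x, weight a₁ a₂ x := by
  rw [Measure.real, lawZ, tilted_apply_eq_ofReal_integral' _ measurableSet_Iic,
    ENNReal.toReal_ofReal, integral_div]
  · rfl
  · exact setIntegral_nonneg measurableSet_Iic fun x _ =>
      div_nonneg (Real.exp_pos _).le h.integral_weight_pos.le

/-- Existence of a regular solution of Stein's equation for the law with potential
`a₁ x² + a₂ x⁴`. -/
lemma exists_steinPair (h : Confining A D E a₁ a₂) (z : ℝ) : ∃ g d : ℝ → ℝ,
    SteinPair ((640 * A + 2) * ((D + 1) * Real.exp E + 1)) z g d ∧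
    ∀ w, d w - potentialDeriv a₁ a₂ w * g w =
      (if w ≤ z then 1 else 0) - (lawZ a₁ a₂).real (Set.Iic z) := by
  have hA : 0 ≤ A := (abs_nonneg _).trans h.abs_le
  set J := ∫ x, weight a₁ a₂ x with hJ
  have J0 : 0 < J := h.integral_weight_pos
  set q := leftMass a₁ a₂ z / J with hq
  set b := (D + 1) * Real.exp E with hb
  have b0 : 0 ≤ b := mul_nonneg (by linarith [h.nonneg]) (Real.exp_pos _).le
  have q0 : 0 ≤ q := div_nonneg (leftMass_nonneg _) J0.le
  have hsum := h.leftMass_add_rightMass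
  have q1' : 1 - q = rightMass a₁ a₂ z / J := by
    rw [hq, eq_div_iff J0.ne', sub_mul, div_mul_cancel₀ _ J0.ne']; linarith [hsum z]
  have q1 : 0 ≤ 1 - q := by rw [q1']; exact div_nonneg (rightMass_nonneg _) J0.le
  -- The solution decomposes into integrals from -∞ to the left of z and from +∞ to its right; both
  -- branches equal e^U · left · right / J at z, so they glue continuously.
  set gL : ℝ → ℝ := fun w => (1 - q) * (Real.exp (potential a₁ a₂ w) * leftMass a₁ a₂ w) with hgL
  set gR : ℝ → ℝ := fun w => q * (Real.exp (potential a₁ a₂ w) * rightMass a₁ a₂ w) with hgR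
  have hexp : ∀ w, Real.exp (potential a₁ a₂ w) * weight a₁ a₂ w = 1 := fun w => by
    rw [weight, ← Real.exp_add]; simp
  have dL : ∀ w, HasDerivAt gL (potentialDeriv a₁ a₂ w * gL w + (1 - q)) w := fun w => by
    refine (((hasDerivAt_potential a₁ a₂ w).exp.mul
      (h.hasDerivAt_leftMass w)).const_mul (1 - q)).congr_deriv ?_
    rw [hexp]; simp only [hgL]; ring
  have dR : ∀ w, HasDerivAt gR (potentialDeriv a₁ a₂ w * gR w + -q) w := fun w => by
    refine (((hasDerivAt_potential a₁ a₂ w).exp.mul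
      (h.hasDerivAt_rightMass w)).const_mul q).congr_deriv ?_
    rw [mul_neg, hexp]; simp only [hgR]; ring
  have hz : gL z = gR z := by simp only [hgL, hgR]; rw [q1', hq]; ring
  have ex : ∀ w, 0 < Real.exp (potential a₁ a₂ w) := fun w => Real.exp_pos _
  have comb : ∀ x y u : ℝ, 0 ≤ x → x ≤ y → y ≤ b → |u| * y ≤ b → |x| ≤ b ∧ |u * x| ≤ b := by
    intro x y u hx hxy hy hu
    rw [abs_mul, abs_of_nonneg hx]
    exact ⟨hxy.trans hy, (mul_le_mul_of_nonneg_left hxy (abs_nonneg u)).trans hu⟩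
  have bL : ∀ w ∈ Set.Iic z, |gL w| ≤ b ∧ |potentialDeriv a₁ a₂ w * gL w| ≤ b := by
    intro w hw
    have g0 : 0 ≤ gL w := mul_nonneg q1 (mul_nonneg (ex w).le (leftMass_nonneg _))
    rcases le_total w 0 with h0 | h0
    · have := h.mills_left h0
      exact comb _ _ _ g0 (mul_le_of_le_one_left (mul_nonneg (ex w).le (leftMass_nonneg _))
        (by linarith)) this.1 this.2
    -- Between 0 and z the left mass is not small. The factor 1 - q, which is the right mass at z
    -- over J, then lets the right tail at w dominate.
    · have := h.mills h0
      refine comb _ _ _ g0 ?_ this.1 this.2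
      have h1 : (1 - q) * leftMass a₁ a₂ w ≤ rightMass a₁ a₂ w := by
        rw [q1', div_mul_eq_mul_div, div_le_iff₀ J0]
        have := rightMass_nonneg (a₁ := a₁) (a₂ := a₂) w
        exact mul_le_mul (h.rightMass_anti hw) (by linarith [hsum w]) (leftMass_nonneg _) this
      calc gL w = Real.exp (potential a₁ a₂ w) * ((1 - q) * leftMass a₁ a₂ w) := by
            simp only [hgL]; ring
        _ ≤ _ := mul_le_mul_of_nonneg_left h1 (ex w).le
  have bR : ∀ w ∈ Set.Ici z, |gR w| ≤ b ∧ |potentialDeriv a₁ a₂ w * gR w| ≤ b := by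
    intro w hw
    have g0 : 0 ≤ gR w := mul_nonneg q0 (mul_nonneg (ex w).le (rightMass_nonneg _))
    rcases le_total 0 w with h0 | h0
    · have := h.mills h0
      exact comb _ _ _ g0 (mul_le_of_le_one_left (mul_nonneg (ex w).le (rightMass_nonneg _))
        (by linarith)) this.1 this.2
    · have := h.mills_left h0
      refine comb _ _ _ g0 ?_ this.1 this.2
      have h1 : q * rightMass a₁ a₂ w ≤ leftMass a₁ a₂ w := by
        rw [hq, div_mul_eq_mul_div, div_le_iff₀ J0]
        have := leftMass_nonneg (a₁ := a₁) (a₂ := a₂) w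
        exact mul_le_mul (h.leftMass_mono hw) (by linarith [hsum w]) (rightMass_nonneg _) this
      calc gR w = Real.exp (potential a₁ a₂ w) * (q * rightMass a₁ a₂ w) := by
            simp only [hgR]; ring
        _ ≤ _ := mul_le_mul_of_nonneg_left h1 (ex w).le
  set g : ℝ → ℝ := fun w => if w ≤ z then gL w else gR w with hg
  set d : ℝ → ℝ := fun w => potentialDeriv a₁ a₂ w * g w + ((if w ≤ z then 1 else 0) - q) with hd
  have gle : ∀ w, w ≤ z → g w = gL w := fun w hw => if_pos hw
  have gge : ∀ w, z ≤ w → g w = gR w := fun w hw => by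
    rcases hw.eq_or_lt with rfl | hlt
    · rw [gle _ le_rfl, hz]
    · exact if_neg (not_le.2 hlt)
  have bg : ∀ w, |g w| ≤ b ∧ |potentialDeriv a₁ a₂ w * g w| ≤ b := fun w => by
    rcases le_total w z with hw | hw
    · rw [gle w hw]; exact bL w hw
    · rw [gge w hw]; exact bR w hw
  have cL : |1 - q| ≤ 1 := _root_.abs_le.2 ⟨by linarith, by linarith⟩
  have cR : |-q| ≤ 1 := _root_.abs_le.2 ⟨by linarith, by linarith⟩
  have regL := fun x y (hx : x ∈ Set.Iic z) (hy : y ∈ Set.Iic z) => h.solution_regularity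
    (convex_Iic z) cL dL (fun w hw => (bL w hw).1) (fun w hw => (bL w hw).2) hx hy
  have regR := fun x y (hx : x ∈ Set.Ici z) (hy : y ∈ Set.Ici z) => h.solution_regularity
    (convex_Ici z) cR dR (fun w hw => (bR w hw).1) (fun w hw => (bR w hw).2) hx hy
  have bd : ∀ w, |d w| ≤ b + 1 := fun w => by
    refine (abs_add_le _ _).trans (add_le_add (bg w).2 ?_)
    split_ifs
    · exact cL
    · simpa using cR
  have lip' : ∀ x y, x ≤ y → |g x - g y| ≤ (b + 1) * |x - y| := by
    intro x y hxy
    rcases le_total y z with hy | hy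
    · rw [gle x (hxy.trans hy), gle y hy]
      exact (regL x y (hxy.trans hy) hy).1
    · rcases le_total z x with hx | hx
      · rw [gge x hx, gge y hy]
        exact (regR x y hx hy).1
      · have h1 := (regL x z hx (Set.mem_Iic.2 le_rfl)).1
        have h2 := (regR z y (Set.mem_Ici.2 le_rfl) hy).1
        rw [← hz] at h2
        rw [gle x hx, gge y hy]
        refine (abs_sub_le _ (gL z) _).trans ((add_le_add h1 h2).trans (le_of_eq ?_))
        rw [abs_of_nonpos (by linarith), abs_of_nonpos (by linarith), abs_of_nonpos (by linarith)]
        ring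
  have lip : ∀ x y, |g x - g y| ≤ (b + 1) * |x - y| := fun x y => by
    rcases le_total x y with hxy | hxy
    · exact lip' x y hxy
    · rw [abs_sub_comm, abs_sub_comm x]; exact lip' y x hxy
  refine ⟨g, d, ⟨fun w => ?_, fun w => ?_, fun w v hv => ?_⟩, fun w => ?_⟩
  · have := (bg w).1
    nlinarith [mul_nonneg hA b0]
  · have := bd w
    nlinarith [mul_nonneg hA b0]
  · have e : w - (w - v) = v := by ring
    -- Across the kink only the Lipschitz bound is available, which costs the indicator. Otherwise w
    -- and w - v lie on the same branch and the second-order estimate applies.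
    by_cases hnear : |w - z| ≤ |v|
    · rw [if_pos hnear]
      have h1 := lip w (w - v)
      rw [e] at h1
      have h2 : |v * d w| ≤ (b + 1) * |v| := by
        rw [abs_mul, mul_comm]; gcongr; exact bd w
      have h3 : 0 ≤ |v| * (1 + |w| ^ 3) := by positivity
      calc _ ≤ (b + 1) * |v| + (b + 1) * |v| := (abs_sub _ _).trans (add_le_add h1 h2)
        _ = 2 * (b + 1) * |v| * 1 := by ring
        _ ≤ (640 * A + 2) * (b + 1) * |v| * (|v| * (1 + |w| ^ 3) + 1) := by
            gcongr <;> linarith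
    · rw [if_neg hnear, add_zero]
      have hv2 := _root_.abs_le.1 (le_refl |v|)
      have fin : |g w - g (w - v) - v * d w| ≤
          640 * A * (b + 1) * (1 + |w| ^ 3) * |v| * |v| := by
        rcases le_total w z with hw | hw
        · rw [abs_of_nonpos (by linarith)] at hnear
          have hw' : w - v ≤ z := by linarith
          have := (regL w (w - v) hw hw').2
          rw [e] at this
          simp only [hd]
          rw [gle _ hw, gle _ hw', if_pos hw]
          exact this hv
        · rw [abs_of_nonneg (by linarith)] at hnear
          have hw' : z ≤ w - v := by linarith
          have := (regR w (w - v) hw hw').2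
          rw [e] at this
          have hlt : ¬ w ≤ z := by
            intro hle
            have := abs_nonneg v
            linarith
          simp only [hd]
          rw [gge _ hw, gge _ hw', if_neg hlt, zero_sub]
          exact this hv
      refine fin.trans ?_
      have : 0 ≤ (b + 1) * (1 + |w| ^ 3) * |v| * |v| := by positivity
      nlinarith
  · rw [h.lawZ_real_Iic]; simp only [hd]; ring

end Confining

/-! ### From Stein's equation to the Kolmogorov distance -/

/-- Uniform bound of the Kolmogorov distance in terms of the mismatch of coefficients. -/
lemma Regime.kolmogorov_le {n : ℕ} {β K γ A D E a₁ a₂ M Θ : ℝ} (h : Regime n β K γ)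
    (hM : avg n β K (fun ω => W n γ ω ^ 6) ≤ M) (hΘ : |linCoeff n β K γ| ≤ Θ)
    (hc : Confining A D E a₁ a₂) :
    kolmogorov n β K γ a₁ a₂ ≤
      (1000000 + 4 * Θ) * ((640 * A + 2) * ((D + 1) * Real.exp E + 1) * (2 + M) / spinVar β) /
        (n : ℝ) ^ γ / spinVar β + (640 * A + 2) * ((D + 1) * Real.exp E + 1) * (1 + M) *
        (|linCoeff n β K γ / spinVar β - 2 * a₁| + |cubCoeff n β K γ / spinVar β - 4 * a₂|) := by
  have p0 := spinVar_pos β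
  refine ciSup_le fun z => ?_
  obtain ⟨g, d, hg, he⟩ := hc.exists_steinPair z
  set B := (640 * A + 2) * ((D + 1) * Real.exp E + 1)
  have hB : 0 ≤ B := (abs_nonneg _).trans (hg.bound 0)
  have key := h.abs_stein_sub_le hM hΘ hg
  set θ := linCoeff n β K γ
  set η := cubCoeff n β K γ
  set X := avg n β K (fun ω => (θ * W n γ ω + η * W n γ ω ^ 3) * g (W n γ ω)) with hX
  set Y := avg n β K (fun ω => d (W n γ ω)) with hY
  -- Stein's equation is averaged at W and the potential force exchanged for (θW + ηW³)/p, whose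
  -- pairing with g is controlled; the exchange leaves the coefficient mismatch.
  have e1 : (gibbs n β K).real {ω | W n γ ω ≤ z} - (lawZ a₁ a₂).real (Set.Iic z) =
      (Y - X / spinVar β) + avg n β K (fun ω => ((θ / spinVar β - 2 * a₁) * W n γ ω +
        (η / spinVar β - 4 * a₂) * W n γ ω ^ 3) * g (W n γ ω)) := by
    have e2 : avg n β K (fun ω => ((θ / spinVar β - 2 * a₁) * W n γ ω +
        (η / spinVar β - 4 * a₂) * W n γ ω ^ 3) * g (W n γ ω)) =
        1 / spinVar β * X - avg n β K (fun ω => potentialDeriv a₁ a₂ (W n γ ω) *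
          g (W n γ ω)) := by
      rw [hX, ← avg_const_mul, ← avg_sub]
      congr 1
      funext ω
      simp only [potentialDeriv]; ring
    have e3 : (gibbs n β K).real {ω | W n γ ω ≤ z} - (lawZ a₁ a₂).real (Set.Iic z) =
        Y - avg n β K (fun ω => potentialDeriv a₁ a₂ (W n γ ω) * g (W n γ ω)) := by
      rw [hY, ← avg_sub]
      simp_rw [he]
      rw [avg_sub, avg_const, avg_indicator_le]
    rw [e2, e3]; ring
  have b1 : |Y - X / spinVar β| ≤
      (1000000 + 4 * Θ) * (B * (2 + M) / spinVar β) / (n : ℝ) ^ γ / spinVar β := by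
    rw [le_div_iff₀ p0]
    nth_rewrite 2 [← abs_of_pos p0]
    rw [← abs_mul, sub_mul, div_mul_cancel₀ _ p0.ne', abs_sub_comm, mul_comm Y]
    exact key
  have b2 : |avg n β K (fun ω => ((θ / spinVar β - 2 * a₁) * W n γ ω +
        (η / spinVar β - 4 * a₂) * W n γ ω ^ 3) * g (W n γ ω))| ≤
      B * (|θ / spinVar β - 2 * a₁| + |η / spinVar β - 4 * a₂|) * (1 + M) := by
    refine (abs_avg_le (g := fun ω => (|θ / spinVar β - 2 * a₁| * |W n γ ω| +
      |η / spinVar β - 4 * a₂| * |W n γ ω| ^ 3) * B) fun ω => ?_).trans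
      (Regime.avg_le_of_moment_six hM (by positivity) fun ω => ?_)
    · rw [abs_mul]
      gcongr
      · refine (abs_add_le _ _).trans (le_of_eq ?_)
        rw [abs_mul, abs_mul, abs_pow]
      · exact hg.bound _
    · have q1 := Regime.abs_pow_le_moment (W n γ ω) (show 1 ≤ 6 by norm_num)
      have q3 := Regime.abs_pow_le_moment (W n γ ω) (show 3 ≤ 6 by norm_num)
      rw [pow_one] at q1
      calc _ ≤ (|θ / spinVar β - 2 * a₁| * (1 + W n γ ω ^ 6) +
            |η / spinVar β - 4 * a₂| * (1 + W n γ ω ^ 6)) * B := by gcongr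
        _ = _ := by ring
  rw [e1]
  refine (abs_add_le _ _).trans ((add_le_add b1 b2).trans (le_of_eq ?_))
  ring

/-- Beyond 1 + A/(2a) the quartic force beats the most negative quadratic one; before it the slope
is at least -D. The constant E comes from completing the square in u². -/
lemma exists_confining_quartic {A a : ℝ} (ha : 0 < a) : ∃ D E, ∀ a₁ a₂ : ℝ, |a₁| ≤ A → a ≤ a₂ →
    a₂ ≤ A → Confining A D E a₁ a₂ := by
  by_cases hA : 0 ≤ A
  swap
  · exact ⟨0, 0, fun a₁ _ h => absurd ((abs_nonneg a₁).trans h) hA⟩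
  set D := 2 * A * (1 + A / (2 * a)) with hD
  have D0 : 0 ≤ D := by positivity
  refine ⟨D, D + 1 + (A + D + 1) ^ 2 / (4 * a), fun a₁ a₂ h1 h2 h3 =>
    ⟨D0, h1, by linarith, h3, fun w hw => ?_, fun u hu => ?_⟩⟩
  · have h4 := neg_le_of_abs_le h1
    have h5 : -(2 * A * w) + 4 * a * w ^ 3 ≤ potentialDeriv a₁ a₂ w := by
      have : -A * w ≤ a₁ * w := by gcongr
      have : a * w ^ 3 ≤ a₂ * w ^ 3 := by gcongr
      simp only [potentialDeriv]; linarith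
    refine le_trans ?_ h5
    rcases le_total (1 + A / (2 * a)) w with hl | hl
    · have h6 : A ≤ 2 * a * w := by
        have : A / (2 * a) ≤ w := by linarith
        rwa [div_le_iff₀' (by positivity)] at this
      have h7 : 1 ≤ w := by
        have : 0 ≤ A / (2 * a) := by positivity
        linarith
      have : 2 * A * w ≤ 4 * a * w ^ 3 := by
        calc 2 * A * w ≤ 2 * (2 * a * w) * w := by gcongr
          _ = 4 * a * w ^ 2 * 1 := by ring
          _ ≤ 4 * a * w ^ 2 * w := by gcongr
          _ = _ := by ring
      linarith
    · have : 2 * A * w ≤ D := by rw [hD]; gcongr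
      have : 0 ≤ 4 * a * w ^ 3 := by positivity
      linarith
  · have h4 := neg_le_of_abs_le h1
    have h5 : -(A * u ^ 2) + a * u ^ 4 ≤ potential a₁ a₂ u := by
      have : -A * u ^ 2 ≤ a₁ * u ^ 2 := by gcongr
      have : a * u ^ 4 ≤ a₂ * u ^ 4 := by gcongr
      simp only [potential]; linarith
    refine le_trans ?_ h5
    set m := A + D + 1 with hm
    have h6 : 0 ≤ (2 * a * u ^ 2 - m) ^ 2 / (4 * a) := by positivity
    have h7 : (2 * a * u ^ 2 - m) ^ 2 / (4 * a) = a * u ^ 4 - m * u ^ 2 + m ^ 2 / (4 * a) := by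
      field_simp; ring
    rw [h7] at h6
    have h8 : (D + 1) * u ≤ (D + 1) * (1 + u ^ 2) := by
      gcongr
      nlinarith
    rw [hm] at h6 ⊢
    linarith

lemma exists_confining_quadratic {A a : ℝ} (ha : 0 < a) : ∃ D E, ∀ a₁ : ℝ, a ≤ a₁ → a₁ ≤ A →
    Confining A D E a₁ 0 := by
  refine ⟨0, 1 / (4 * a), fun a₁ h1 h2 => ⟨le_rfl, ?_, le_rfl, by linarith, fun w hw => ?_,
    fun u hu => ?_⟩⟩
  · rwa [abs_of_pos (by linarith)]
  · have : 0 ≤ a₁ * w := mul_nonneg (by linarith) hw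
    simp only [potentialDeriv]; linarith
  · have h6 : 0 ≤ (2 * a * u - 1) ^ 2 / (4 * a) := by positivity
    have h7 : (2 * a * u - 1) ^ 2 / (4 * a) = a * u ^ 2 - u + 1 / (4 * a) := by
      field_simp; ring
    have : a * u ^ 2 ≤ a₁ * u ^ 2 := by gcongr
    simp only [potential]; linarith

/-! ### Asymptotics of the parameters and coefficients -/

lemma Kc_pos {β : ℝ} (h : 0 < β) : 0 < Kc β := by
  have := Real.exp_pos β; rw [Kc]; positivity

lemma continuousAt_Kc {β : ℝ} (h : 0 < β) : ContinuousAt Kc β := by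
  unfold Kc
  exact ContinuousAt.div (by fun_prop) (by fun_prop) (by positivity)

/-- What makes K_c critical: the linear part of the drift vanishes there, leaving only the
contribution of k/n^{Δ₂}. -/
lemma spinVar_mul_Kc {β : ℝ} (h : 0 < β) : spinVar β * (2 * β * Kc β) = 1 := by
  have := Real.exp_pos β
  rw [spinVar, Kc]; field_simp; norm_num

lemma linCoeff_eq {n : ℕ} {β : ℕ → ℝ} {k Δ₂ γ : ℝ} (hn : 1 ≤ n) (hβ : 0 < β n) :
    linCoeff n (β n) (Kseq β k Δ₂ n) γ = coeff1 (β n) k * (n : ℝ) ^ (1 - 2 * γ - Δ₂) := by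
  have hn' : (0 : ℝ) < n := by exact_mod_cast hn
  have e1 := spinVar_mul_Kc hβ
  have hK := Kc_pos hβ
  have e2 : (n : ℝ) ^ (1 - 2 * γ - Δ₂) = n / ((n : ℝ) ^ γ) ^ 2 / (n : ℝ) ^ Δ₂ := by
    rw [Real.rpow_sub hn', Real.rpow_sub hn', Real.rpow_one, mul_comm 2 γ, Real.rpow_mul hn'.le]
    norm_num
  have e3 : 1 - spinVar (β n) * (2 * β n * Kseq β k Δ₂ n) =
      coeff1 (β n) k / (n : ℝ) ^ Δ₂ := by
    have : spinVar (β n) * (2 * β n) = 1 / Kc (β n) := by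
      rw [eq_div_iff hK.ne']; linarith
    rw [Kseq, coeff1, ← mul_assoc, this]
    field_simp
    ring
  rw [linCoeff, e2, e3]; ring

lemma cubCoeff_eq {n : ℕ} {β K γ : ℝ} (hn : 1 ≤ n) :
    cubCoeff n β K γ = (n : ℝ) ^ (1 - 4 * γ) * coeff2 β K := by
  have hn' : (0 : ℝ) < n := by exact_mod_cast hn
  rw [cubCoeff, Real.rpow_sub hn', Real.rpow_one, mul_comm 4 γ, Real.rpow_mul hn'.le]
  norm_num

lemma tendsto_Kseq {β₀ : ℝ} (hβ₀ : 0 < β₀) {β : ℕ → ℝ} (hβ : Tendsto β atTop (𝓝 β₀)) (k : ℝ)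
    {Δ₂ : ℝ} (hΔ₂ : 0 < Δ₂) : Tendsto (Kseq β k Δ₂) atTop (𝓝 (Kc β₀)) := by
  have h1 : Tendsto (fun n => Kc (β n)) atTop (𝓝 (Kc β₀)) :=
    (continuousAt_Kc hβ₀).tendsto.comp hβ
  have h2 : Tendsto (fun n : ℕ => k / (n : ℝ) ^ Δ₂) atTop (𝓝 0) :=
    tendsto_const_nhds.div_atTop ((tendsto_rpow_atTop hΔ₂).comp tendsto_natCast_atTop_atTop)
  have := h1.sub h2
  rw [sub_zero] at this
  exact this

lemma exp_lt_four {β₀ : ℝ} (h : β₀ < betaC) : Real.exp β₀ < 4 := by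
  rw [← Real.exp_log (show (0 : ℝ) < 4 by norm_num)]
  exact Real.exp_lt_exp.2 h

/-- In the limit 2βK tends to (e^{β₀} + 2)/2, strictly between 3/2 and 3. The midpoint (e^{β₀} +
4)/2 keeps e^{β_n} uniformly away from 4. -/
lemma eventually_regime {β₀ : ℝ} (hβ₀ : 0 < β₀) (hβ₀c : β₀ < betaC) {β : ℕ → ℝ}
    (hβ : Tendsto β atTop (𝓝 β₀)) (k : ℝ) {Δ₂ γ : ℝ} (hΔ₂ : 0 < Δ₂) (hγ : 1 / 4 ≤ γ)
    (hγ' : γ ≤ 1 / 2) : ∀ᶠ n : ℕ in atTop, Regime n (β n) (Kseq β k Δ₂ n) γ ∧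
      Real.exp (β n) ≤ (Real.exp β₀ + 4) / 2 := by
  have h4 := exp_lt_four hβ₀c
  have h1 := Real.add_one_lt_exp hβ₀.ne'
  have hexp : Tendsto (fun n => Real.exp (β n)) atTop (𝓝 (Real.exp β₀)) :=
    (Real.continuous_exp.tendsto _).comp hβ
  have hfield : Tendsto (fun n => 2 * β n * Kseq β k Δ₂ n) atTop (𝓝 (2 * β₀ * Kc β₀)) :=
    (hβ.const_mul 2).mul (tendsto_Kseq hβ₀ hβ k hΔ₂)
  have e : 2 * β₀ * Kc β₀ = (Real.exp β₀ + 2) / 2 := by rw [Kc]; field_simp; norm_num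
  filter_upwards [eventually_ge_atTop 1, hβ.eventually_const_lt hβ₀,
    hexp.eventually_le_const (show Real.exp β₀ < (Real.exp β₀ + 4) / 2 by linarith),
    hfield.eventually_const_le (show 1 < 2 * β₀ * Kc β₀ by rw [e]; linarith),
    hfield.eventually_le_const (show 2 * β₀ * Kc β₀ < 4 by rw [e]; linarith)] with n a1 a2 a3 a4 a5
  exact ⟨⟨a1, hγ, hγ', a2, by linarith, a4, a5⟩, a3⟩

lemma tendsto_coeff1 {β₀ : ℝ} (hβ₀ : 0 < β₀) {β : ℕ → ℝ} (hβ : Tendsto β atTop (𝓝 β₀)) (k : ℝ) :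
    Tendsto (fun n => coeff1 (β n) k) atTop (𝓝 (coeff1 β₀ k)) :=
  tendsto_const_nhds.div ((continuousAt_Kc hβ₀).tendsto.comp hβ) (Kc_pos hβ₀).ne'

lemma third_le_spinVar {β : ℝ} (h : Real.exp β ≤ 4) : 1 / 3 ≤ spinVar β := by
  have := Real.exp_pos β
  rw [spinVar, div_le_div_iff₀ (by norm_num) (by positivity)]; linarith

/-- The sign of c₂ is that of 3p - 1 = (4 - e^β)/(e^β + 2), again positive exactly below log 4. -/
lemma Regime.coeff2_ge {n : ℕ} {β K γ a : ℝ} (h : Regime n β K γ) (ha : a < 4)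
    (hβ : Real.exp β ≤ a) : (4 - a) / 108 ≤ coeff2 β K := by
  have h1 := h.one_le_field
  have he := Real.exp_pos β
  rw [coeff2_eq (by linarith)]
  have h3 := third_le_spinVar h.exp_le
  have h4 : (4 - a) / 6 ≤ 3 * spinVar β - 1 := by
    have : 3 * spinVar β - 1 = (4 - Real.exp β) / (Real.exp β + 2) := by
      rw [spinVar]; field_simp; ring
    rw [this]
    exact div_le_div₀ (by linarith) (by linarith) (by linarith) (by linarith)
  have h5 : 1 ≤ (2 * β * K) ^ 3 := one_le_pow₀ h1
  calc (4 - a) / 108 = 1 * (1 / 3 * ((4 - a) / 6)) / 6 := by ring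
    _ ≤ (2 * β * K) ^ 3 * (spinVar β * (3 * spinVar β - 1)) / 6 := by
        have : 0 ≤ 4 - a := by linarith
        have := (spinVar_pos β).le
        gcongr
    _ = _ := by ring

/-! ### Constants uniform in n -/

/-- Uniform bound for the sixth moment at the critical scale. -/
lemma exists_moment_bound_critical {a : ℝ} (ha : a < 4) {Θ : ℝ} (hΘ : 0 ≤ Θ) : ∃ M, 0 ≤ M ∧
    ∀ {n : ℕ} {β K : ℝ}, Regime n β K (1 / 4) → Real.exp β ≤ a →
      |linCoeff n β K (1 / 4)| ≤ Θ → avg n β K (fun ω => W n (1 / 4) ω ^ 6) ≤ M := by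
  obtain ⟨c, hc, key⟩ := Regime.exists_drift_mul_pow_five_ge ha
  -- The linear coefficient can be as low as -Θ. Raising it to 1 costs Θ + 1 times w⁶, which is paid
  -- by c w⁸; the factor n/r⁴ in front of c is 1 at γ = 1/4.
  set m := Θ + 1 with hm
  have m0 : 0 ≤ m := by linarith
  refine ⟨2 / 1 * (m * (m / c) ^ 3 + 129 + 109 * (109 / (1 / 2)) ^ 5), by positivity,
    fun {n β K} h hβ hθ => h.moment_six_le one_pos fun ω => le_trans ?_ (key h hβ ω)⟩
  have hn := h.cast_pos
  have e : (n : ℝ) / ((n : ℝ) ^ (1 / 4 : ℝ)) ^ 4 = 1 := by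
    rw [← Real.rpow_natCast, ← Real.rpow_mul hn.le]; norm_num; exact_mod_cast hn.ne'
  rw [e, mul_one, one_mul]
  have hθ' := neg_le_of_abs_le hθ
  have hy : 0 ≤ W n (1 / 4) ω ^ 2 := sq_nonneg _
  have e6 : W n (1 / 4) ω ^ 6 = (W n (1 / 4) ω ^ 2) ^ 3 := by ring
  have e8 : W n (1 / 4) ω ^ 8 = (W n (1 / 4) ω ^ 2) ^ 4 := by ring
  rw [e6, e8]
  generalize W n (1 / 4) ω ^ 2 = y at *
  have h1 : -Θ * y ^ 3 ≤ linCoeff n β K (1 / 4) * y ^ 3 := by gcongr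
  have h2 : m * y ^ 3 ≤ c * y ^ 4 + m * (m / c) ^ 3 := by
    rcases le_total y (m / c) with hl | hl
    · have : m * y ^ 3 ≤ m * (m / c) ^ 3 := by gcongr
      have : 0 ≤ c * y ^ 4 := by positivity
      linarith
    · have h3 : m ≤ c * y := by rwa [div_le_iff₀' hc] at hl
      have : m * y ^ 3 ≤ c * y * y ^ 3 := by gcongr
      have : 0 ≤ m * (m / c) ^ 3 := by positivity
      nlinarith
  rw [hm] at h2 ⊢
  linarith

/-- Uniform bound for the sixth moment when the drift is linear to leading order. -/
lemma exists_moment_bound_gaussian {a : ℝ} (ha : a < 4) {κ : ℝ} (hκ : 0 < κ) : ∃ M, 0 ≤ M ∧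
    ∀ {n : ℕ} {β K γ : ℝ}, Regime n β K γ → Real.exp β ≤ a →
      κ ≤ linCoeff n β K γ → avg n β K (fun ω => W n γ ω ^ 6) ≤ M := by
  obtain ⟨c, hc, key⟩ := Regime.exists_drift_mul_pow_five_ge ha
  refine ⟨2 / κ * (0 + 129 + 109 * (109 / (κ / 2)) ^ 5), by positivity,
    fun {n β K γ} h hβ hθ => h.moment_six_le hκ fun ω => le_trans ?_ (key h hβ ω)⟩
  have h1 : 0 ≤ c * (n / ((n : ℝ) ^ γ) ^ 4) * W n γ ω ^ 8 := by positivity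
  have h2 : κ * W n γ ω ^ 6 ≤ linCoeff n β K γ * W n γ ω ^ 6 := by gcongr
  linarith

/-- The Kolmogorov bound with a single constant. -/
lemma exists_kolmogorov_bound {A D E M Θ : ℝ} (hA : 0 ≤ A) (hD : 0 ≤ D) (hM0 : 0 ≤ M)
    (hΘ0 : 0 ≤ Θ) : ∃ C, 0 ≤ C ∧ ∀ {n : ℕ} {β K γ a₁ a₂ : ℝ}, Regime n β K γ →
    avg n β K (fun ω => W n γ ω ^ 6) ≤ M → |linCoeff n β K γ| ≤ Θ → Confining A D E a₁ a₂ →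
    kolmogorov n β K γ a₁ a₂ ≤ C * (1 / (n : ℝ) ^ γ + (|linCoeff n β K γ / spinVar β - 2 * a₁| +
      |cubCoeff n β K γ / spinVar β - 4 * a₂|)) := by
  set B := (640 * A + 2) * ((D + 1) * Real.exp E + 1) with hB
  have B0 : 0 ≤ B := by positivity
  refine ⟨(1000000 + 4 * Θ) * (B * (2 + M) / (1 / 3)) / (1 / 3) + B * (1 + M), by positivity,
    fun {n β K γ a₁ a₂} h hM hΘ hc => (h.kolmogorov_le hM hΘ hc).trans ?_⟩
  rw [← hB]
  have hp := third_le_spinVar h.exp_le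
  have hr : 0 < (n : ℝ) ^ γ := by linarith [h.one_le_rpow]
  set q := |linCoeff n β K γ / spinVar β - 2 * a₁| + |cubCoeff n β K γ / spinVar β - 4 * a₂|
  have q0 : 0 ≤ q := by positivity
  set C₁ := (1000000 + 4 * Θ) * (B * (2 + M) / (1 / 3)) / (1 / 3) with hC₁
  have C₁0 : 0 ≤ C₁ := by positivity
  calc _ ≤ (1000000 + 4 * Θ) * (B * (2 + M) / (1 / 3)) / (n : ℝ) ^ γ / (1 / 3) +
        B * (1 + M) * q := by gcongr
    _ = C₁ * (1 / (n : ℝ) ^ γ) + B * (1 + M) * q := by rw [hC₁]; ring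
    _ ≤ _ := by
        have h1 : 0 ≤ B * (1 + M) * (1 / (n : ℝ) ^ γ) := by positivity
        have h2 : 0 ≤ C₁ * q := by positivity
        nlinarith

lemma kolmogorov_le_one (n : ℕ) (β K γ a₁ a₂ : ℝ) : kolmogorov n β K γ a₁ a₂ ≤ 1 := by
  refine ciSup_le fun t => ?_
  have h1 : (gibbs n β K).real {ω | W n γ ω ≤ t} ≤ 1 := measureReal_le_one
  have h2 : (lawZ a₁ a₂).real (Set.Iic t) ≤ 1 := by
    by_cases hi : Integrable (fun x : ℝ => Real.exp (-(a₁ * x ^ 2 + a₂ * x ^ 4)))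
    · have : IsProbabilityMeasure (lawZ a₁ a₂) := isProbabilityMeasure_tilted hi
      exact measureReal_le_one
    · rw [lawZ, tilted_of_not_integrable hi]; simp
  have h3 := measureReal_nonneg (μ := gibbs n β K) (s := {ω | W n γ ω ≤ t})
  have h4 := measureReal_nonneg (μ := lawZ a₁ a₂) (s := Set.Iic t)
  rw [abs_le]; constructor <;> linarith

/-- The finitely many exceptional n are covered by `x n ≤ 1`, at the price of a larger constant. -/
lemma exists_bound_of_eventually {x f : ℕ → ℝ} {P : ℕ → Prop} {C : ℝ} (hx : ∀ n, x n ≤ 1)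
    (hf : ∀ n, 1 ≤ n → 0 < f n) (h : ∀ᶠ n in atTop, P n → x n ≤ C * f n) :
    ∃ C', 0 ≤ C' ∧ ∀ n, 1 ≤ n → P n → x n ≤ C' * f n := by
  obtain ⟨N, hN⟩ := eventually_atTop.1 h
  have s0 : 0 ≤ ∑ m ∈ Finset.range N, |1 / f m| := Finset.sum_nonneg fun _ _ => abs_nonneg _
  refine ⟨|C| + ∑ m ∈ Finset.range N, |1 / f m|, by positivity, fun n hn hP => ?_⟩
  have f0 := hf n hn
  rcases lt_or_ge n N with hlt | hge
  · have h1 : |1 / f n| ≤ ∑ m ∈ Finset.range N, |1 / f m| :=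
      Finset.single_le_sum (f := fun m => |1 / f m|) (fun _ _ => abs_nonneg _)
        (Finset.mem_range.2 hlt)
    rw [abs_of_pos (by positivity)] at h1
    calc x n ≤ 1 := hx n
      _ = 1 / f n * f n := by field_simp
      _ ≤ _ := by
          gcongr
          linarith [abs_nonneg C]
  · refine (hN n hge hP).trans ?_
    gcongr
    linarith [le_abs_self C]

lemma moment_pos {n : ℕ} (hn : 1 ≤ n) (β K γ : ℝ) {l : ℕ} (hl : Even l) : 0 < moment n β K γ l := by
  refine avg_pos (f := fun ω : Config n => W n γ ω ^ l) (fun ω => hl.pow_nonneg _)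
    (ω₀ := fun _ => 1) (pow_pos ?_ _)
  have : (0 : ℝ) < n := by exact_mod_cast hn
  simp only [W, totalSpin]
  simp
  positivity

lemma moment_le {n : ℕ} {β K γ M : ℝ} (hM : avg n β K (fun ω => W n γ ω ^ 6) ≤ M) {l : ℕ}
    (hl : l ≤ 6) (he : Even l) : moment n β K γ l ≤ 1 + M := by
  have := Regime.avg_le_of_moment_six hM zero_le_one (f := fun ω => W n γ ω ^ l) fun ω => by
    rw [one_mul, ← he.pow_abs]; exact Regime.abs_pow_le_moment _ hl
  rwa [one_mul] at this

lemma tendsto_natCast_rpow_neg {s : ℝ} (hs : s < 0) :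
    Tendsto (fun n : ℕ => (n : ℝ) ^ s) atTop (𝓝 0) := by
  have := (tendsto_rpow_neg_atTop (neg_pos.2 hs)).comp tendsto_natCast_atTop_atTop
  rw [neg_neg] at this
  exact this

/-- The difference equals (xm - p)/(pm). This turns a moment identity xm ≈ p into a matching of
coefficients. -/
lemma abs_div_sub_inv_le {x p m u b : ℝ} (hp : 1 / 3 ≤ p) (hb : 0 < b) (hm : b ≤ m)
    (h : |x * m - p| ≤ u) : |x / p - 1 / m| ≤ 3 / b * u := by
  have hp0 : 0 < p := by linarith
  have hm0 : 0 < m := by linarith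
  have u0 : 0 ≤ u := (abs_nonneg _).trans h
  have e : x / p - 1 / m = (x * m - p) / (p * m) := by field_simp
  rw [e, abs_div, abs_of_pos (mul_pos hp0 hm0)]
  calc _ ≤ u / (1 / 3 * b) := by gcongr
    _ = _ := by field_simp

/-! ### The three scaling regimes -/

lemma critical_regime {β₀ : ℝ} (hβ₀ : 0 < β₀) (hβ₀c : β₀ < betaC) {β : ℕ → ℝ}
    (hβ : Tendsto β atTop (𝓝 β₀)) {k : ℝ} (hk : k ≠ 0) :
    (∀ᶠ n : ℕ in atTop, critA1 n (β n) (Kseq β k (1 / 2) n) k ≠ 0 ∧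
      0 < critA2 n (β n) (Kseq β k (1 / 2) n) k) ∧
    ∃ C, 0 ≤ C ∧ ∀ n, 1 ≤ n → 0 < critA2 n (β n) (Kseq β k (1 / 2) n) k →
      kolmogorov n (β n) (Kseq β k (1 / 2) n) (1 / 4) (critA1 n (β n) (Kseq β k (1 / 2) n) k)
        (critA2 n (β n) (Kseq β k (1 / 2) n) k) ≤ C * (n : ℝ) ^ (-(1 / 4) : ℝ) := by
  have h4 := exp_lt_four hβ₀c
  set a := (Real.exp β₀ + 4) / 2 with ha
  have ha4 : a < 4 := by rw [ha]; linarith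
  set Θ := |coeff1 β₀ k| + 1 with hΘ
  have Θ0 : 0 ≤ Θ := by positivity
  obtain ⟨M, M0, hM⟩ := exists_moment_bound_critical ha4 Θ0
  -- With c₃ ≥ 1/6 and c₂ ≤ 64, |a₁| ≤ 3Θ and a₂ ≤ 96. With c₃ ≤ 7/6, a₂ ≥ (4 - a)/504, whence the
  -- weaker bound with 540.
  set A := 3 * Θ + 96 with hA
  have c0 : 0 < (4 - a) / 540 := by linarith
  obtain ⟨D, E, hconf⟩ := exists_confining_quartic (A := A) c0
  have main : ∀ᶠ n : ℕ in atTop, Regime n (β n) (Kseq β k (1 / 2) n) (1 / 4) ∧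
      avg n (β n) (Kseq β k (1 / 2) n) (fun ω => W n (1 / 4) ω ^ 6) ≤ M ∧
      linCoeff n (β n) (Kseq β k (1 / 2) n) (1 / 4) = coeff1 (β n) k ∧
      cubCoeff n (β n) (Kseq β k (1 / 2) n) (1 / 4) = coeff2 (β n) (Kseq β k (1 / 2) n) ∧
      |coeff1 (β n) k| ≤ Θ ∧ coeff1 (β n) k ≠ 0 ∧
      (4 - a) / 108 ≤ coeff2 (β n) (Kseq β k (1 / 2) n) ∧
      1 / 6 ≤ coeff3 n (β n) (Kseq β k (1 / 2) n) k ∧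
      coeff3 n (β n) (Kseq β k (1 / 2) n) k ≤ 7 / 6 ∧
      |coeff3 n (β n) (Kseq β k (1 / 2) n) k - spinVar (β n)| ≤
        60000 * (2 + M) * (n : ℝ) ^ (-(1 / 4) : ℝ) := by
    have hsmall : Tendsto (fun n : ℕ => 60000 * (2 + M) * (n : ℝ) ^ (-(1 / 4) : ℝ)) atTop (𝓝 0) := by
      simpa using (tendsto_natCast_rpow_neg (show -(1 / 4 : ℝ) < 0 by norm_num)).const_mul
        (60000 * (2 + M))
    filter_upwards [eventually_regime hβ₀ hβ₀c hβ k (show (0 : ℝ) < 1 / 2 by norm_num) le_rfl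
      (show (1 : ℝ) / 4 ≤ 1 / 2 by norm_num), eventually_ge_atTop 1,
      (tendsto_coeff1 hβ₀ hβ k).abs.eventually_le_const (show |coeff1 β₀ k| < Θ by linarith),
      hsmall.eventually_le_const (show (0 : ℝ) < 1 / 6 by norm_num)] with n hreg hn hc1 hs
    obtain ⟨hr, hea⟩ := hreg
    have hlin : linCoeff n (β n) (Kseq β k (1 / 2) n) (1 / 4) = coeff1 (β n) k := by
      rw [linCoeff_eq hn hr.beta_pos]; norm_num
    have hcub : cubCoeff n (β n) (Kseq β k (1 / 2) n) (1 / 4) =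
        coeff2 (β n) (Kseq β k (1 / 2) n) := by
      rw [cubCoeff_eq hn]; norm_num
    have hm := hM hr hea (by rwa [hlin])
    have hid := hr.abs_moment_identity_le hm
    rw [hlin, hcub, div_eq_mul_inv _ ((n : ℝ) ^ (1 / 4 : ℝ)), ← Real.rpow_neg hr.cast_pos.le] at hid
    -- In this scaling θ = c₁ and η = c₂, so the moment identity says that c₃ equals p up to
    -- O(n^{-1/4}).
    change |coeff3 n (β n) (Kseq β k (1 / 2) n) k - spinVar (β n)| ≤ _ at hid
    have hp := third_le_spinVar hr.exp_le
    have hp1 := spinVar_le_one (β n)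
    have h5 := abs_le.1 (hid.trans hs)
    exact ⟨hr, hm, hlin, hcub, hc1, div_ne_zero hk (Kc_pos hr.beta_pos).ne',
      hr.coeff2_ge ha4 hea, by linarith [h5.1], by linarith [h5.2], hid⟩
  constructor
  · filter_upwards [main] with n ⟨hr, hm, hlin, hcub, hc1, hne, hc2, hc3, hc3', hid⟩
    refine ⟨div_ne_zero hne (by positivity), div_pos (by linarith) (by linarith)⟩
  · by_cases hD : 0 ≤ D
    swap
    · exact absurd (hconf 0 A (by simp; positivity) (by rw [hA]; linarith [Real.exp_pos β₀])
        le_rfl).nonneg hD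
    obtain ⟨C, C0, hC⟩ := exists_kolmogorov_bound (A := A) (D := D) (E := E) (by positivity)
      hD M0 Θ0
    refine exists_bound_of_eventually (C := C * (1 + (Θ + 64) * (18 * (60000 * (2 + M)))))
      (P := fun n => 0 < critA2 n (β n) (Kseq β k (1 / 2) n) k)
      (f := fun n => (n : ℝ) ^ (-(1 / 4) : ℝ))
      (fun n => kolmogorov_le_one _ _ _ _ _ _) (fun n hn => Real.rpow_pos_of_pos
        (by exact_mod_cast hn) _) ?_
    filter_upwards [main] with n ⟨hr, hm, hlin, hcub, hc1, hne, hc2, hc3, hc3', hid⟩ _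
    set c₁ := coeff1 (β n) k
    set c₂ := coeff2 (β n) (Kseq β k (1 / 2) n) with hc₂
    set c₃ := coeff3 n (β n) (Kseq β k (1 / 2) n) k with hc₃
    set p := spinVar (β n)
    set e := (n : ℝ) ^ (-(1 / 4) : ℝ) with he
    have hp : 1 / 3 ≤ p := third_le_spinVar hr.exp_le
    have hc2u : |c₂| ≤ 64 := hr.abs_coeff2_le
    have hc20 : 0 < c₂ := by linarith
    have e0 : 0 ≤ e := (Real.rpow_nonneg (Nat.cast_nonneg n) _)
    have ea1 : critA1 n (β n) (Kseq β k (1 / 2) n) k = c₁ / (2 * c₃) := rfl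
    have ea2 : critA2 n (β n) (Kseq β k (1 / 2) n) k = c₂ / (4 * c₃) := rfl
    have conf : Confining A D E (c₁ / (2 * c₃)) (c₂ / (4 * c₃)) := by
      refine hconf _ _ ?_ ?_ ?_
      · rw [abs_div, abs_of_pos (show 0 < 2 * c₃ by linarith), div_le_iff₀ (by linarith)]
        nlinarith
      · rw [le_div_iff₀ (by linarith)]
        nlinarith
      · rw [div_le_iff₀ (by linarith)]
        have := le_of_abs_le hc2u
        nlinarith
    have key := hC hr hm (by rwa [hlin]) conf
    rw [hlin, hcub, ← ea1, ← ea2] at key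
    have hdiff : |1 / p - 1 / c₃| ≤ 3 / (1 / 6) * (60000 * (2 + M) * e) :=
      abs_div_sub_inv_le hp (by norm_num) hc3 (by rwa [one_mul])
    have d1 : c₁ / p - 2 * critA1 n (β n) (Kseq β k (1 / 2) n) k = c₁ * (1 / p - 1 / c₃) := by
      rw [ea1]; field_simp
    have d2 : c₂ / p - 4 * critA2 n (β n) (Kseq β k (1 / 2) n) k = c₂ * (1 / p - 1 / c₃) := by
      rw [ea2]; field_simp
    rw [d1, d2, abs_mul, abs_mul, one_div ((n : ℝ) ^ _), ← Real.rpow_neg hr.cast_pos.le] at key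
    refine key.trans ?_
    rw [mul_assoc]
    refine mul_le_mul_of_nonneg_left ?_ C0
    calc _ ≤ e + (Θ * (3 / (1 / 6) * (60000 * (2 + M) * e)) +
          64 * (3 / (1 / 6) * (60000 * (2 + M) * e))) := by gcongr
      _ = _ := by ring

lemma gaussian_regime {β₀ : ℝ} (hβ₀ : 0 < β₀) (hβ₀c : β₀ < betaC) {β : ℕ → ℝ}
    (hβ : Tendsto β atTop (𝓝 β₀)) {k Δ₂ γ : ℝ} (hk : 0 < k) (hΔ₂ : 0 < Δ₂)
    (hγΔ : 2 * γ = 1 - Δ₂) (hγ : 1 / 4 < γ) (hγ' : γ < 1 / 2) :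
    ∃ C, 0 ≤ C ∧ ∀ n, 1 ≤ n → kolmogorov n (β n) (Kseq β k Δ₂ n) γ
      (2 * moment n (β n) (Kseq β k Δ₂ n) γ 2)⁻¹ 0 ≤
        C * ((n : ℝ) ^ (-γ) + (n : ℝ) ^ (1 - 4 * γ)) := by
  have h4 := exp_lt_four hβ₀c
  set a := (Real.exp β₀ + 4) / 2 with ha
  have ha4 : a < 4 := by rw [ha]; linarith
  have hlim0 : 0 < coeff1 β₀ k := div_pos hk (Kc_pos hβ₀)
  set κ := coeff1 β₀ k / 2 with hκ
  have κ0 : 0 < κ := by positivity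
  set Θ := coeff1 β₀ k + 1 with hΘ
  have Θ0 : 0 < Θ := by positivity
  obtain ⟨M, M0, hM⟩ := exists_moment_bound_gaussian ha4 κ0
  -- The lower bound on a₁ comes from E W² ≤ 1 + M, the upper bound 3Θ from E W² ≥ 1/(6Θ). The extra
  -- summand in `A` makes the interval nonempty, which yields `D ≥ 0`.
  obtain ⟨D, E, hconf⟩ := exists_confining_quadratic (A := 3 * Θ + 1 / (2 * (1 + M)))
    (a := 1 / (2 * (1 + M))) (by positivity)
  have hD : 0 ≤ D := (hconf (1 / (2 * (1 + M))) le_rfl (by linarith)).nonneg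
  obtain ⟨C, C0, hC⟩ := exists_kolmogorov_bound (A := 3 * Θ + 1 / (2 * (1 + M))) (D := D) (E := E)
    (by positivity) hD M0 Θ0.le
  set Q := 60000 * (2 + M) + 64 * (1 + M) with hQ
  have Q0 : 0 ≤ Q := by positivity
  have hsmall : Tendsto (fun n : ℕ => Q * ((n : ℝ) ^ (-γ) + (n : ℝ) ^ (1 - 4 * γ))) atTop
      (𝓝 0) := by
    simpa using ((tendsto_natCast_rpow_neg (show -γ < 0 by linarith)).add
      (tendsto_natCast_rpow_neg (show 1 - 4 * γ < 0 by linarith))).const_mul Q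
  obtain ⟨C', C'0, hC'⟩ := exists_bound_of_eventually (P := fun _ => True)
    (x := fun n => kolmogorov n (β n) (Kseq β k Δ₂ n) γ
      (2 * moment n (β n) (Kseq β k Δ₂ n) γ 2)⁻¹ 0)
    (C := C * (1 + (3 / (1 / (6 * Θ)) * Q + 192)))
    (f := fun n => (n : ℝ) ^ (-γ) + (n : ℝ) ^ (1 - 4 * γ))
    (fun n => kolmogorov_le_one _ _ _ _ _ _) (fun n hn => by
      have : (0 : ℝ) < n := by exact_mod_cast hn
      positivity) (by
    filter_upwards [eventually_regime hβ₀ hβ₀c hβ k hΔ₂ hγ.le hγ'.le, eventually_ge_atTop 1,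
      (tendsto_coeff1 hβ₀ hβ k).eventually_le_const (show coeff1 β₀ k < Θ by linarith),
      (tendsto_coeff1 hβ₀ hβ k).eventually_const_le (show κ < coeff1 β₀ k by rw [hκ]; linarith),
      hsmall.eventually_le_const (show (0 : ℝ) < 1 / 6 by norm_num)] with n hreg hn hc1 hc1' hs _
    obtain ⟨hr, hea⟩ := hreg
    have hlin : linCoeff n (β n) (Kseq β k Δ₂ n) γ = coeff1 (β n) k := by
      rw [linCoeff_eq hn hr.beta_pos, hγΔ]; simp
    have hcub := cubCoeff_eq (β := β n) (K := Kseq β k Δ₂ n) (γ := γ) hn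
    have hm := hM hr hea (by rwa [hlin])
    have hid := hr.abs_moment_identity_le hm
    rw [hlin, hcub, div_eq_mul_inv, ← Real.rpow_neg hr.cast_pos.le] at hid
    have hp := third_le_spinVar hr.exp_le
    have hc2 := hr.abs_coeff2_le
    have m2 := moment_le hm (l := 2) (by norm_num) (by decide)
    have m4 := moment_le hm (l := 4) (by norm_num) (by decide)
    have m2p := moment_pos hn (β n) (Kseq β k Δ₂ n) γ (l := 2) (by decide)
    have m4p := moment_pos hn (β n) (Kseq β k Δ₂ n) γ (l := 4) (by decide)
    set c₁ := coeff1 (β n) k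
    set c₂ := coeff2 (β n) (Kseq β k Δ₂ n)
    set s := moment n (β n) (Kseq β k Δ₂ n) γ 2
    set t := moment n (β n) (Kseq β k Δ₂ n) γ 4
    set p := spinVar (β n)
    have e0 : 0 ≤ (n : ℝ) ^ (-γ) := Real.rpow_nonneg (Nat.cast_nonneg n) _
    have f0 : 0 ≤ (n : ℝ) ^ (1 - 4 * γ) := Real.rpow_nonneg (Nat.cast_nonneg n) _
    set e := (n : ℝ) ^ (-γ) with he
    set f := (n : ℝ) ^ (1 - 4 * γ) with hf
    -- Since γ > 1/4, the fourth moment enters with the factor n^{1-4γ} and counts as an error.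
    have hs1 : |c₁ * s - p| ≤ Q * (e + f) := by
      have h1 : |f * c₂ * t| ≤ f * 64 * (1 + M) := by
        rw [abs_mul, abs_mul, abs_of_nonneg f0, abs_of_pos m4p]; gcongr
      have h2 : |c₁ * s - p| ≤ |c₁ * s + f * c₂ * t - p| + |f * c₂ * t| := by
        have := abs_sub (c₁ * s + f * c₂ * t - p) (f * c₂ * t)
        rwa [show c₁ * s + f * c₂ * t - p - f * c₂ * t = c₁ * s - p by ring] at this
      refine h2.trans ((add_le_add hid h1).trans ?_)
      rw [hQ]
      have : 0 ≤ 60000 * (2 + M) * f := by positivity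
      have : 0 ≤ 64 * (1 + M) * e := by positivity
      linarith
    have hsl : 1 / (6 * Θ) ≤ s := by
      rw [div_le_iff₀ (by positivity)]
      have := (abs_le.1 (hs1.trans hs)).1
      have : c₁ * s ≤ Θ * s := by gcongr
      linarith
    have conf : Confining (3 * Θ + 1 / (2 * (1 + M))) D E (2 * s)⁻¹ 0 := by
      refine hconf _ ?_ ?_
      · rw [← one_div]; gcongr
      · have h1 : (2 * s)⁻¹ ≤ (2 * (1 / (6 * Θ)))⁻¹ := by gcongr
        have h2 : (2 * (1 / (6 * Θ)))⁻¹ = 3 * Θ := by field_simp; norm_num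
        have : 0 < 1 / (2 * (1 + M)) := by positivity
        linarith
    have key := hC hr hm (by rw [hlin, abs_of_pos (κ0.trans_le hc1')]; exact hc1) conf
    have hdiff := abs_div_sub_inv_le hp (by positivity) hsl hs1
    rw [hlin, hcub, mul_zero, sub_zero, show 2 * (2 * s)⁻¹ = 1 / s by field_simp,
      one_div ((n : ℝ) ^ γ), ← Real.rpow_neg hr.cast_pos.le, ← he] at key
    have h3 : |f * c₂ / p| ≤ 192 * f := by
      rw [abs_div, abs_mul, abs_of_nonneg f0, abs_of_pos (show 0 < p by linarith)]
      calc _ ≤ f * 64 / (1 / 3) := by gcongr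
        _ = _ := by ring
    refine key.trans ?_
    rw [mul_assoc]
    refine mul_le_mul_of_nonneg_left ?_ C0
    calc _ ≤ e + (3 / (1 / (6 * Θ)) * (Q * (e + f)) + 192 * f) := by gcongr
      _ ≤ _ := by linarith)
  exact ⟨C', C'0, fun n hn => hC' n hn trivial⟩

lemma quartic_regime {β₀ : ℝ} (hβ₀ : 0 < β₀) (hβ₀c : β₀ < betaC) {β : ℕ → ℝ}
    (hβ : Tendsto β atTop (𝓝 β₀)) (k : ℝ) {Δ₂ : ℝ} (hΔ : 1 / 2 < Δ₂) :
    ∃ C, 0 ≤ C ∧ ∀ n, 1 ≤ n → kolmogorov n (β n) (Kseq β k Δ₂ n) (1 / 4) 0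
      (4 * moment n (β n) (Kseq β k Δ₂ n) (1 / 4) 4)⁻¹ ≤
        C * ((n : ℝ) ^ (-(1 / 4) : ℝ) + (n : ℝ) ^ (-(Δ₂ - 1 / 2))) := by
  have h4 := exp_lt_four hβ₀c
  set a := (Real.exp β₀ + 4) / 2 with ha
  have ha4 : a < 4 := by rw [ha]; linarith
  set Θ := |coeff1 β₀ k| + 1 with hΘ
  have Θ0 : 0 ≤ Θ := by positivity
  obtain ⟨M, M0, hM⟩ := exists_moment_bound_critical ha4 Θ0
  have c0 : 0 < 1 / (4 * (1 + M)) := by positivity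
  -- From c₂ ≤ 64 and c₂ E W⁴ ≥ 1/6 one gets E W⁴ ≥ 1/384, so a₂ ≤ 96; its lower bound comes from E
  -- W⁴ ≤ 1 + M.
  set A := 96 + 1 / (4 * (1 + M)) with hA
  obtain ⟨D, E, hconf⟩ := exists_confining_quartic (A := A) c0
  have hD : 0 ≤ D := (hconf 0 A (by simp; positivity) (by rw [hA]; linarith) le_rfl).nonneg
  obtain ⟨C, C0, hC⟩ := exists_kolmogorov_bound (A := A) (D := D) (E := E) (by positivity)
    hD M0 Θ0
  set Q := 60000 * (2 + M) + Θ * (1 + M) with hQ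
  have Q0 : 0 ≤ Q := by positivity
  have hsmall : Tendsto (fun n : ℕ => Q * ((n : ℝ) ^ (-(1 / 4) : ℝ) + (n : ℝ) ^ (-(Δ₂ - 1 / 2))))
      atTop (𝓝 0) := by
    simpa using ((tendsto_natCast_rpow_neg (show -(1 / 4 : ℝ) < 0 by norm_num)).add
      (tendsto_natCast_rpow_neg (show -(Δ₂ - 1 / 2) < 0 by linarith))).const_mul Q
  obtain ⟨C', C'0, hC'⟩ := exists_bound_of_eventually (P := fun _ => True)
    (x := fun n => kolmogorov n (β n) (Kseq β k Δ₂ n) (1 / 4) 0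
      (4 * moment n (β n) (Kseq β k Δ₂ n) (1 / 4) 4)⁻¹)
    (C := C * (1 + (3 / (1 / 384) * Q + 3 * Θ)))
    (f := fun n => (n : ℝ) ^ (-(1 / 4) : ℝ) + (n : ℝ) ^ (-(Δ₂ - 1 / 2)))
    (fun n => kolmogorov_le_one _ _ _ _ _ _) (fun n hn => by
      have : (0 : ℝ) < n := by exact_mod_cast hn
      positivity) (by
    filter_upwards [eventually_regime hβ₀ hβ₀c hβ k (show 0 < Δ₂ by linarith)
      (le_refl (1 / 4 : ℝ)) (by norm_num), eventually_ge_atTop 1,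
      (tendsto_coeff1 hβ₀ hβ k).abs.eventually_le_const (show |coeff1 β₀ k| < Θ by linarith),
      hsmall.eventually_le_const (show (0 : ℝ) < 1 / 6 by norm_num)] with n hreg hn hc1 hs _
    obtain ⟨hr, hea⟩ := hreg
    have hlin : linCoeff n (β n) (Kseq β k Δ₂ n) (1 / 4) =
        coeff1 (β n) k * (n : ℝ) ^ (-(Δ₂ - 1 / 2)) := by
      rw [linCoeff_eq hn hr.beta_pos]; congr 2; ring
    have hcub : cubCoeff n (β n) (Kseq β k Δ₂ n) (1 / 4) =
        coeff2 (β n) (Kseq β k Δ₂ n) := by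
      rw [cubCoeff_eq hn]; norm_num
    have e0 : 0 ≤ (n : ℝ) ^ (-(1 / 4) : ℝ) := Real.rpow_nonneg (Nat.cast_nonneg n) _
    have f0 : 0 ≤ (n : ℝ) ^ (-(Δ₂ - 1 / 2)) := Real.rpow_nonneg (Nat.cast_nonneg n) _
    have f1 : (n : ℝ) ^ (-(Δ₂ - 1 / 2)) ≤ 1 :=
      Real.rpow_le_one_of_one_le_of_nonpos hr.one_le_cast (by linarith)
    set e := (n : ℝ) ^ (-(1 / 4) : ℝ) with he
    set f := (n : ℝ) ^ (-(Δ₂ - 1 / 2)) with hf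
    set c₁ := coeff1 (β n) k
    -- For Δ₂ > 1/2 the whole linear term is an error of order n^{-(Δ₂-1/2)}, whatever the sign of
    -- k.
    have hlinf : |linCoeff n (β n) (Kseq β k Δ₂ n) (1 / 4)| ≤ Θ * f := by
      rw [hlin, abs_mul, abs_of_nonneg f0]; gcongr
    have hlinle : |linCoeff n (β n) (Kseq β k Δ₂ n) (1 / 4)| ≤ Θ :=
      hlinf.trans (mul_le_of_le_one_right Θ0 f1)
    have hm := hM hr hea hlinle
    have hid := hr.abs_moment_identity_le hm
    rw [hcub, div_eq_mul_inv _ ((n : ℝ) ^ (1 / 4 : ℝ)), ← Real.rpow_neg hr.cast_pos.le, ← he] at hid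
    have hp := third_le_spinVar hr.exp_le
    have hc2 := hr.abs_coeff2_le
    have m2 := moment_le hm (l := 2) (by norm_num) (by decide)
    have m4 := moment_le hm (l := 4) (by norm_num) (by decide)
    have m2p := moment_pos hn (β n) (Kseq β k Δ₂ n) (1 / 4) (l := 2) (by decide)
    have m4p := moment_pos hn (β n) (Kseq β k Δ₂ n) (1 / 4) (l := 4) (by decide)
    set θ := linCoeff n (β n) (Kseq β k Δ₂ n) (1 / 4)
    set c₂ := coeff2 (β n) (Kseq β k Δ₂ n)
    set s := moment n (β n) (Kseq β k Δ₂ n) (1 / 4) 2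
    set t := moment n (β n) (Kseq β k Δ₂ n) (1 / 4) 4
    set p := spinVar (β n)
    have ht1 : |c₂ * t - p| ≤ Q * (e + f) := by
      have h1 : |θ * s| ≤ Θ * f * (1 + M) := by
        rw [abs_mul, abs_of_pos m2p]; gcongr
      have h2 : |c₂ * t - p| ≤ |θ * s + c₂ * t - p| + |θ * s| := by
        have := abs_sub (θ * s + c₂ * t - p) (θ * s)
        rwa [show θ * s + c₂ * t - p - θ * s = c₂ * t - p by ring] at this
      refine h2.trans ((add_le_add hid h1).trans ?_)
      rw [hQ]
      have : 0 ≤ 60000 * (2 + M) * f := by positivity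
      have : 0 ≤ Θ * (1 + M) * e := by positivity
      linarith
    have htl : 1 / 384 ≤ t := by
      have := (abs_le.1 (ht1.trans hs)).1
      have : c₂ * t ≤ 64 * t := by gcongr; exact le_of_abs_le hc2
      linarith
    have conf : Confining A D E 0 (4 * t)⁻¹ := by
      refine hconf _ _ (by simp; positivity) ?_ ?_
      · rw [← one_div]; gcongr
      · have h1 : (4 * t)⁻¹ ≤ (4 * (1 / 384))⁻¹ := by gcongr
        have h2 : (4 * (1 / 384) : ℝ)⁻¹ = 96 := by norm_num
        linarith
    have key := hC hr hm hlinle conf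
    have hdiff := abs_div_sub_inv_le hp (by norm_num) htl ht1
    rw [hcub, mul_zero, sub_zero, show 4 * (4 * t)⁻¹ = 1 / t by field_simp,
      one_div ((n : ℝ) ^ (1 / 4 : ℝ)), ← Real.rpow_neg hr.cast_pos.le, ← he] at key
    have h3 : |θ / p| ≤ 3 * Θ * f := by
      rw [abs_div, abs_of_pos (show 0 < p by linarith)]
      calc _ ≤ Θ * f / (1 / 3) := by gcongr
        _ = _ := by ring
    refine key.trans ?_
    rw [mul_assoc]
    refine mul_le_mul_of_nonneg_left ?_ C0
    have : 0 ≤ Θ * e := by positivity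
    calc _ ≤ e + (3 * Θ * f + 3 / (1 / 384) * (Q * (e + f))) := by gcongr
      _ ≤ _ := by linarith)
  exact ⟨C', C'0, fun n hn => hC' n hn trivial⟩

end BEG

/-! ### Assembly of the rates -/

theorem theorem2p4 (β₀ : ℝ) (hβ₀ : 0 < β₀) (hβ₀c : β₀ < BEG.betaC)
    (β : ℕ → ℝ) (hβpos : ∀ n : ℕ, 1 ≤ n → 0 < β n) (hβ : Tendsto β atTop (𝓝 β₀))
    (k Δ₂ γ : ℝ) (hk : k ≠ 0) (hΔ₂ : 0 < Δ₂) (hγ0 : 0 < γ) (hγ1 : γ ≤ 1 / 2)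
    (hv : min (2 * γ + Δ₂ - 1) (4 * γ - 1) = 0) :
    Tendsto (fun n : ℕ => (β n, BEG.Kseq β k Δ₂ n)) atTop (𝓝 (β₀, BEG.Kc β₀)) ∧
    -- (1)
    (γ = 1 / 4 → Δ₂ = 1 / 2 →
      (∀ᶠ n : ℕ in atTop, BEG.critA1 n (β n) (BEG.Kseq β k Δ₂ n) k ≠ 0 ∧
        0 < BEG.critA2 n (β n) (BEG.Kseq β k Δ₂ n) k) ∧
      ∃ C : ℝ, ∀ n : ℕ, 1 ≤ n → 0 < BEG.critA2 n (β n) (BEG.Kseq β k Δ₂ n) k →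
        BEG.kolmogorov n (β n) (BEG.Kseq β k Δ₂ n) γ
          (BEG.critA1 n (β n) (BEG.Kseq β k Δ₂ n) k)
          (BEG.critA2 n (β n) (BEG.Kseq β k Δ₂ n) k) ≤ C * (n : ℝ) ^ (-(1 / 4) : ℝ)) ∧
    -- (2)
    (2 * γ = 1 - Δ₂ → 1 / 4 < γ → γ < 1 / 2 → 0 < k →
      (∀ n : ℕ, 1 ≤ n → 0 < (2 * BEG.moment n (β n) (BEG.Kseq β k Δ₂ n) γ 2)⁻¹) ∧
      ∃ C : ℝ, ∀ n : ℕ, 1 ≤ n →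
        (γ ≤ 1 / 3 → BEG.kolmogorov n (β n) (BEG.Kseq β k Δ₂ n) γ
          (2 * BEG.moment n (β n) (BEG.Kseq β k Δ₂ n) γ 2)⁻¹ 0 ≤ C * (n : ℝ) ^ (1 - 4 * γ)) ∧
        (1 / 3 ≤ γ → BEG.kolmogorov n (β n) (BEG.Kseq β k Δ₂ n) γ
          (2 * BEG.moment n (β n) (BEG.Kseq β k Δ₂ n) γ 2)⁻¹ 0 ≤ C * (n : ℝ) ^ (-γ))) ∧
    -- (3)
    (γ = 1 / 4 → 1 / 2 < Δ₂ →
      (∀ n : ℕ, 1 ≤ n → 0 < (4 * BEG.moment n (β n) (BEG.Kseq β k Δ₂ n) γ 4)⁻¹) ∧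
      ∃ C : ℝ, ∀ n : ℕ, 1 ≤ n →
        (Δ₂ < 3 / 4 → BEG.kolmogorov n (β n) (BEG.Kseq β k Δ₂ n) γ
          0 (4 * BEG.moment n (β n) (BEG.Kseq β k Δ₂ n) γ 4)⁻¹ ≤
            C * (n : ℝ) ^ (-(Δ₂ - 1 / 2))) ∧
        (3 / 4 ≤ Δ₂ → BEG.kolmogorov n (β n) (BEG.Kseq β k Δ₂ n) γ
          0 (4 * BEG.moment n (β n) (BEG.Kseq β k Δ₂ n) γ 4)⁻¹ ≤
            C * (n : ℝ) ^ (-(1 / 4) : ℝ))) := by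
  have pow_le : ∀ {x y : ℝ} {n : ℕ}, 1 ≤ n → x ≤ y → (n : ℝ) ^ x ≤ (n : ℝ) ^ y :=
    fun hn hxy => Real.rpow_le_rpow_of_exponent_le (by exact_mod_cast hn) hxy
  refine ⟨hβ.prodMk_nhds (BEG.tendsto_Kseq hβ₀ hβ k hΔ₂), ?_, ?_, ?_⟩
  · rintro rfl rfl
    obtain ⟨h, C, -, hC⟩ := BEG.critical_regime hβ₀ hβ₀c hβ hk
    exact ⟨h, C, hC⟩
  · intro hγΔ hγ hγ' hk0
    refine ⟨fun n hn => inv_pos.2 (mul_pos two_pos (BEG.moment_pos hn _ _ _ (by decide))), ?_⟩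
    obtain ⟨C, C0, hC⟩ := BEG.gaussian_regime hβ₀ hβ₀c hβ hk0 hΔ₂ hγΔ hγ hγ'
    -- The two powers of n cross at γ = 1/3; bounding the smaller one by the larger doubles the
    -- constant.
    refine ⟨2 * C, fun n hn => ⟨fun h => (hC n hn).trans ?_, fun h => (hC n hn).trans ?_⟩⟩
    · have := mul_le_mul_of_nonneg_left
        (pow_le hn (show -γ ≤ 1 - 4 * γ by linarith)) C0
      linarith
    · have := mul_le_mul_of_nonneg_left
        (pow_le hn (show 1 - 4 * γ ≤ -γ by linarith)) C0
      linarith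
  · rintro rfl hΔ
    refine ⟨fun n hn => inv_pos.2 (mul_pos four_pos (BEG.moment_pos hn _ _ _ (by decide))), ?_⟩
    obtain ⟨C, C0, hC⟩ := BEG.quartic_regime hβ₀ hβ₀c hβ k hΔ
    -- Here the crossing is at Δ₂ = 3/4.
    refine ⟨2 * C, fun n hn => ⟨fun h => (hC n hn).trans ?_, fun h => (hC n hn).trans ?_⟩⟩
    · have := mul_le_mul_of_nonneg_left
        (pow_le hn (show -(1 / 4 : ℝ) ≤ -(Δ₂ - 1 / 2) by linarith)) C0
      linarith
    · have := mul_le_mul_of_nonneg_left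
        (pow_le hn (show -(Δ₂ - 1 / 2) ≤ -(1 / 4 : ℝ) by linarith)) C0
      linarith
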